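/- Let $q\in L^\infty(\mathbb R_+)$ be a bounded complex-valued measurable function on $\mathbb R_+=(0,\infty)$, let $\alpha\in\mathbb C\cup\{\infty\}$, and put $$\epsilon=\begin{pmatrix}0&1\\1&0\end{pmatrix},\qquad Q=\begin{pmatrix}0&q\\ \overline q&0\end{pmatrix},\qquad A=\begin{pmatrix}\overline\alpha&0\\0&\alpha\end{pmatrix}.$$ Let $S=(1+|\alpha|^2)^{-1/2}I$, $C=(1+|\alpha|^2)^{-1/2}\epsilon A$ if $\alpha\in\mathbb C$, and $S=0$, $C=\epsilon$ if $\alpha=\infty$. For $\lambda\in\mathbb C$ let $\Phi(\cdot,\lambda)$, $\Theta(\cdot,\lambda)$ be the $2\times2$ matrix-valued solutions of $-\epsilon F''+QF=\lambda F$ on $[0,\infty)$ (with $F'$ locally absolutely continuous and the equation holding a.e.) such that $\Phi(0,\lambda)=S$, $\epsilon\Phi'(0,\lambda)=-C$, $\Theta(0,\lambda)=C$, $\epsilon\Theta'(0,\lambda)=S$. For $\lambda\in\mathbb C\setminus\mathbb R$ let $M_\alpha(\lambda)$ be the unique $2\times2$ matrix such that both columns of $\Theta(\cdot,\lambda)-\Phi(\cdot,\lambda)M_\alpha(\lambda)$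 belong to $L^2(\mathbb R_+;\mathbb C^2)$. The spectral measure $\Sigma$ of $\mathbf H=-\epsilon\frac{d^2}{dx^2}+Q$ with the boundary condition $F'(0)+AF(0)=0$ (read as $F(0)=0$ if $\alpha=\infty$) is the positive $2\times2$ matrix-valued Borel measure on $\mathbb R$ such that $\int_{\mathbb R}\frac{d\Sigma(t)}{1+t^2}$ converges and, with $\operatorname{Re}M=\frac12(M+M^*)$, $$M_\alpha(\lambda)=\operatorname{Re}M_\alpha(\mathrm i)+\int_{-\infty}^{\infty}\Big(\frac1{t-\lambda}-\frac t{1+t^2}\Big)\,d\Sigma(t),\qquad \lambda\in\mathbb C\setminus\mathbb R .$$ Theorem. The spectral measure $\Sigma$ exists and is unique. Moreover, there exist a unique even positive Borel measure $\nu$ on $\mathbb R$ and a unique (up to $\nu$-a.e. equality) odd complex-valued function $\psi\in L^\infty(\nu)$ satisfying $|\psi(s)|\le1$ for $\nu$-a.e. $s\in\mathbb R$ such that $$d\Sigma=\begin{pmatrix}1&\psi\\ \overline\psi&1\end{pmatrix}d\nu ,$$ that is, $\nu$ is finite on bounded sets and $\Sigma(B)=\int_B\begin{pmatrix}1&\psi\\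 \overline\psi&1\end{pmatrix}d\nu$ for every bounded Borel set $B\subset\mathbb R$. Here $\psi$ is odd in the sense of $L^\infty(\nu)$: $\psi(-s)=-\psi(s)$ for $\nu$-a.e. $s$. (The pair $(\nu,\psi)$ is called the spectral pair of the Schrödinger operator $-\frac{d^2}{dx^2}+q$ in $L^2(\mathbb R_+)$ with the boundary condition $f'(0)+\alpha f(0)=0$, read as $f(0)=0$ if $\alpha=\infty$.) -/

import Mathlib

open MeasureTheory Set Filter Topology
open scoped ComplexOrder ENNReal Matrix

/-- A positive `2 × 2` matrix-valued measure on the real line, finite on bounded sets: a countably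
additive function on bounded Borel sets, with positive semidefinite values. On all other sets the
function is set to zero, so that two measures are equal iff they agree on bounded Borel sets. -/
@[ext]
structure MatrixMeasure where
  /-- The value on a bounded Borel set. -/
  toFun : Set ℝ → Matrix (Fin 2) (Fin 2) ℂ
  eq_zero : ∀ B : Set ℝ, ¬ (MeasurableSet B ∧ Bornology.IsBounded B) → toFun B = 0
  posSemidef : ∀ B : Set ℝ, (toFun B).PosSemidef
  hasSum_iUnion : ∀ f : ℕ → Set ℝ, (∀ i, MeasurableSet (f i)) →
    Pairwise (Function.onFun Disjoint f) → Bornology.IsBounded (⋃ i, f i) →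
    HasSum (fun i => toFun (f i)) (toFun (⋃ i, f i))

namespace MatrixMeasure

variable (Sg : MatrixMeasure) (v : Fin 2 → ℂ)

/-- The number `⟨Σ(B) v, v⟩`, for a bounded Borel set `B`. -/
noncomputable def quadVal (B : Set ℝ) : ℝ :=
  (star v ⬝ᵥ (Sg.toFun B *ᵥ v)).re

theorem quadVal_nonneg (B : Set ℝ) : 0 ≤ Sg.quadVal v B :=
  (Complex.le_def.1 ((Sg.posSemidef B).dotProduct_mulVec_nonneg v)).1

theorem quadVal_hasSum (f : ℕ → Set ℝ) (hf : ∀ i, MeasurableSet (f i))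
    (hd : Pairwise (Function.onFun Disjoint f)) (hb : Bornology.IsBounded (⋃ i, f i)) :
    HasSum (fun i => Sg.quadVal v (f i)) (Sg.quadVal v (⋃ i, f i)) := by
  have hc : Continuous fun A : Matrix (Fin 2) (Fin 2) ℂ => (star v ⬝ᵥ (A *ᵥ v)).re := by
    fun_prop
  let g : Matrix (Fin 2) (Fin 2) ℂ →+ ℝ :=
    { toFun := fun A => (star v ⬝ᵥ (A *ᵥ v)).re
      map_zero' := by simp
      map_add' := fun A B => by rw [Matrix.add_mulVec, dotProduct_add, Complex.add_re] }
  exact (Sg.hasSum_iUnion f hf hd hb).map g hc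

theorem ofReal_quadVal_iUnion (f : ℕ → Set ℝ) (hf : ∀ i, MeasurableSet (f i))
    (hd : Pairwise (Function.onFun Disjoint f)) (hb : Bornology.IsBounded (⋃ i, f i)) :
    ENNReal.ofReal (Sg.quadVal v (⋃ i, f i)) = ∑' i, ENNReal.ofReal (Sg.quadVal v (f i)) := by
  have h := Sg.quadVal_hasSum v f hf hd hb
  rw [← h.tsum_eq, ENNReal.ofReal_tsum_of_nonneg (fun i => Sg.quadVal_nonneg v _) h.summable]

theorem quadVal_empty : Sg.quadVal v ∅ = 0 := by
  have h := Sg.quadVal_hasSum v (fun _ => ∅) (fun _ => MeasurableSet.empty)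
    (fun _ _ _ => disjoint_bot_left) (by simp)
  have h2 := h.summable.tendsto_atTop_zero
  exact tendsto_nhds_unique tendsto_const_nhds h2

/-- The part of the scalar measure `⟨Σ(·) v, v⟩` on `(n, n + 1]`. -/
noncomputable def quadPiece (n : ℤ) : Measure ℝ :=
  Measure.ofMeasurable
    (fun B _ => ENNReal.ofReal (Sg.quadVal v (B ∩ Ioc (n : ℝ) (n + 1))))
    (by simp [quadVal_empty])
    (by
      intro f hf hd
      rw [iUnion_inter]
      refine Sg.ofReal_quadVal_iUnion v _ (fun i => (hf i).inter measurableSet_Ioc)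
        (fun i j hij => (hd hij).mono inter_subset_left inter_subset_left) ?_
      exact (Metric.isBounded_Ioc (n : ℝ) (n + 1)).subset (iUnion_subset fun i => inter_subset_right))

/-- The positive scalar measure `B ↦ ⟨Σ(B) v, v⟩` on the real line. -/
noncomputable def quad : Measure ℝ :=
  Measure.sum fun n : ℤ => Sg.quadPiece v n

theorem quad_apply (B : Set ℝ) (hB : MeasurableSet B) (hb : Bornology.IsBounded B) :
    Sg.quad v B = ENNReal.ofReal (Sg.quadVal v B) := by
  have hU : ⋃ n : ℤ, B ∩ Ioc (n : ℝ) (n + 1) = B := by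
    rw [← inter_iUnion, iUnion_Ioc_intCast, inter_univ]
  have e : ℕ ≃ ℤ := (Denumerable.eqv ℤ).symm
  have hU' : ⋃ k : ℕ, B ∩ Ioc ((e k : ℤ) : ℝ) (e k + 1) = B := by
    refine Eq.trans ?_ hU
    exact e.surjective.iUnion_comp (fun n : ℤ => B ∩ Ioc (n : ℝ) (n + 1))
  have h := Sg.ofReal_quadVal_iUnion v (fun k : ℕ => B ∩ Ioc ((e k : ℤ) : ℝ) (e k + 1))
    (fun k => hB.inter measurableSet_Ioc)
    (fun i j hij => ((pairwise_disjoint_Ioc_intCast ℝ) (e.injective.ne hij)).mono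
      inter_subset_right inter_subset_right)
    (by rw [hU']; exact hb)
  rw [hU'] at h
  rw [h, quad, Measure.sum_apply _ hB,
    ← e.tsum_eq fun n : ℤ => (Sg.quadPiece v n) B]
  refine tsum_congr fun k => ?_
  rw [quadPiece, Measure.ofMeasurable_apply _ hB]

/-- `J = ∫ f dΣ`, where the integral of a scalar function against a matrix-valued measure is the
matrix with `⟨J v, v⟩ = ∫ f d⟨Σ v, v⟩` for all `v ∈ ℂ²` (by polarisation, this determines `J`, and
it is the entrywise integral). The integral is required to converge absolutely. -/
def HasIntegral (f : ℝ → ℂ) (J : Matrix (Fin 2) (Fin 2) ℂ) : Prop :=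
  ∀ v : Fin 2 → ℂ, Integrable f (Sg.quad v) ∧ star v ⬝ᵥ (J *ᵥ v) = ∫ t, f t ∂(Sg.quad v)

/-- `dΣ = R dν`: on every bounded Borel set `B`, `R` is `ν`-integrable and `Σ(B) = ∫_B R dν`,
entry by entry. -/
def HasDensity (ν : Measure ℝ) (R : ℝ → Matrix (Fin 2) (Fin 2) ℂ) : Prop :=
  ∀ B : Set ℝ, MeasurableSet B → Bornology.IsBounded B → ∀ i j : Fin 2,
    IntegrableOn (fun t => R t i j) B ν ∧ Sg.toFun B i j = ∫ t in B, R t i j ∂ν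

end MatrixMeasure

/-- The matrix `ε`. -/
def epsMat : Matrix (Fin 2) (Fin 2) ℂ := !![0, 1; 1, 0]

/-- The matrix `A` of the boundary condition `F'(0) + A F(0) = 0`, for finite `α`. -/
noncomputable def bdryA (a : ℂ) : Matrix (Fin 2) (Fin 2) ℂ := !![star a, 0; 0, a]

/-- The matrix `S` of the boundary condition `C F(0) + S ε F'(0) = 0`, where `α ∈ ℂ ∪ {∞}`. -/
noncomputable def bdryS (α : OnePoint ℂ) : Matrix (Fin 2) (Fin 2) ℂ :=
  α.elim 0 fun a => ((1 / √(1 + ‖a‖ ^ 2) : ℝ) : ℂ) • (1 : Matrix (Fin 2) (Fin 2) ℂ)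

/-- The matrix `C` of the boundary condition `C F(0) + S ε F'(0) = 0`, where `α ∈ ℂ ∪ {∞}`. -/
noncomputable def bdryC (α : OnePoint ℂ) : Matrix (Fin 2) (Fin 2) ℂ :=
  α.elim epsMat fun a => ((1 / √(1 + ‖a‖ ^ 2) : ℝ) : ℂ) • (epsMat * bdryA a)

/-- The matrix potential `Q = [[0, q], [q̄, 0]]`. -/
noncomputable def hermPotential (q : ℝ → ℂ) (x : ℝ) : Matrix (Fin 2) (Fin 2) ℂ :=
  !![0, q x; star (q x), 0]

/-- `F` is a matrix-valued solution of `-ε F'' + Q F = z F` on `[0, ∞)` with derivative `F'` (called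
`F₁`): `F` is continuously differentiable, `F'` is locally absolutely continuous, and the equation
holds almost everywhere. -/
structure IsEigenSolution (Q : ℝ → Matrix (Fin 2) (Fin 2) ℂ) (z : ℂ)
    (F F₁ : ℝ → Matrix (Fin 2) (Fin 2) ℂ) : Prop where
  hasDeriv : ∀ x : ℝ, 0 ≤ x → ∀ i j : Fin 2,
    HasDerivWithinAt (fun t => F t i j) (F₁ x i j) (Ici 0) x
  absCont : ∀ b : ℝ, 0 ≤ b → ∀ i j : Fin 2,
    AbsolutelyContinuousOnInterval (fun t => F₁ t i j) 0 b
  equation : ∀ᵐ x ∂(volume.restrict (Ioi (0 : ℝ))), ∃ F₂ : Matrix (Fin 2) (Fin 2) ℂ,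
    (∀ i j : Fin 2, HasDerivAt (fun t => F₁ t i j) (F₂ i j) x) ∧
      -(epsMat * F₂) + Q x * F x = z • F x

/-- `M` is the value at `z` of the Titchmarsh–Weyl `M`-function of `-ε d²/dx² + Q` with boundary
parameter `α`: for the fundamental system `Φ`, `Θ` with `Φ(0) = S`, `ε Φ'(0) = -C`, `Θ(0) = C`,
`ε Θ'(0) = S`, it is the unique matrix `N` such that both columns of `Θ - Φ N` belong to
`L²((0, ∞); ℂ²)`. -/
def IsMValue (Q : ℝ → Matrix (Fin 2) (Fin 2) ℂ) (α : OnePoint ℂ) (z : ℂ)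
    (M : Matrix (Fin 2) (Fin 2) ℂ) : Prop :=
  ∃ Φ Φ₁ Θ Θ₁ : ℝ → Matrix (Fin 2) (Fin 2) ℂ,
    IsEigenSolution Q z Φ Φ₁ ∧ IsEigenSolution Q z Θ Θ₁ ∧
    Φ 0 = bdryS α ∧ epsMat * Φ₁ 0 = -bdryC α ∧
    Θ 0 = bdryC α ∧ epsMat * Θ₁ 0 = bdryS α ∧
    ∀ N : Matrix (Fin 2) (Fin 2) ℂ,
      (∀ i j : Fin 2, MemLp (fun x => (Θ x - Φ x * N) i j) 2 (volume.restrict (Ioi (0 : ℝ)))) ↔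
        N = M

/-- The real part `(M + M*) / 2` of a matrix. -/
noncomputable def matRe (M : Matrix (Fin 2) (Fin 2) ℂ) : Matrix (Fin 2) (Fin 2) ℂ :=
  (1 / 2 : ℂ) • (M + Mᴴ)

/-- `Σ` is the spectral measure of `-ε d²/dx² + Q` with boundary parameter `α`: the integral
`∫ dΣ(t) / (1 + t²)` converges and the `M`-function has the representation
`M(z) = Re M(i) + ∫ (1 / (t - z) - t / (1 + t²)) dΣ(t)` for all non-real `z`. -/
def IsSpectralMeasure (Q : ℝ → Matrix (Fin 2) (Fin 2) ℂ) (α : OnePoint ℂ)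
    (Sg : MatrixMeasure) : Prop :=
  ∃ M : ℂ → Matrix (Fin 2) (Fin 2) ℂ,
    (∀ z : ℂ, z.im ≠ 0 → IsMValue Q α z (M z)) ∧
    (∀ v : Fin 2 → ℂ, Integrable (fun t : ℝ => 1 / (1 + t ^ 2)) (Sg.quad v)) ∧
    ∀ z : ℂ, z.im ≠ 0 →
      Sg.HasIntegral (fun t : ℝ => 1 / ((t : ℂ) - z) - (t : ℂ) / (1 + (t : ℂ) ^ 2))
        (M z - matRe (M Complex.I))

/-- `ν` is an even positive measure, `ψ ∈ L^∞(ν)` is odd with `|ψ| ≤ 1` `ν`-a.e., and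
`dΣ = [[1, ψ], [ψ̄, 1]] dν`. -/
structure IsSpectralPair (Sg : MatrixMeasure) (ν : Measure ℝ) (ψ : ℝ → ℂ) : Prop where
  even : ν.map (fun t => -t) = ν
  memLp : MemLp ψ ∞ ν
  odd : ∀ᵐ t ∂ν, ψ (-t) = -ψ t
  norm_le : ∀ᵐ t ∂ν, ‖ψ t‖ ≤ 1
  density : Sg.HasDensity ν fun t => !![1, ψ t; star (ψ t), 1]

/-! The `M`-function has to be shown to exist and to be unique, its quadratic forms have to be given
Nevanlinna representations without a linear term, and two symmetries of the system have to be passed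
on to the measure.

The analytic core is Lagrange's identity: for solutions F at w and G at z, (z - conj w) ∫ ⟨F, G⟩ is
a difference of boundary terms. If f and f'' are in L², so is f' (`HasSecondDeriv.memLp_deriv`);
hence the boundary term at infinity is integrable and drops out for square-integrable solutions. The
Weyl solutions W(z)v = (Θ - ΦM(z))v therefore satisfy (z - conj w)⟨W(w)a, W(z)b⟩ = a*(M(z) - M(w)*)b
(`IsWeylSolution.kernel`). The same identity yields uniqueness of M; existence is Weyl's argument
with nested compact matrix discs (`exists_isMValue`).

The kernel identity replaces the theory of unbounded self-adjoint operators. For fixed v it makes (z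
- i)W(z)v ↦ (z + i)W(z)v - 2iW(i)v extend to a unitary operator on the closed span of the W(z)v
(`IsGramKernel.exists_unitary`). Its spectral measure at W(i)v, carried from the circle to the line,
represents v*M(z)v. An atom at u = 1 would produce a linear term in z; there is none because W(iy)v
tends weakly to zero as y → ∞ (`exists_isGramKernel`). The representing measures are unique by
Stieltjes inversion (`nevanlinna_ext`), so they inherit the linear relations between the quadratic
forms and assemble into a matrix measure.

Conjugation by σ = diag(1, -1) changes the signs of ε and Q, so M(-z) = -σM(z)σ. The map F ↦ ε
conj(F) preserves the system and replaces z by conj z; together with M(conj z) = M(z)* this gives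
M₀₀ = M₁₁. By uniqueness of the measures, the diagonal entries of Σ are one even measure ν, and
Σ₀₁(-B) = -Σ₀₁(B). Positivity of Σ(B) gives |Σ₀₁(B)| ≤ ν(B), so Σ₀₁ has an odd density ψ bounded by
1. Conversely the entries of Σ determine ν and ψ. -/

/-! ### Complex-valued absolutely continuous functions -/

/-- The real and imaginary parts are covered by the real-valued theory; they are recombined through
multiplication by the constant functions 1 and i. -/
theorem absolutelyContinuousOnInterval_primitive {f : ℝ → ℂ} {a b : ℝ}
    (h : IntervalIntegrable f volume a b) :
    AbsolutelyContinuousOnInterval (fun x => ∫ t in a..x, f t) a b := by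
  have hre : IntervalIntegrable (fun t => (f t).re) volume a b := ⟨h.1.re, h.2.re⟩
  have him : IntervalIntegrable (fun t => (f t).im) volume a b := ⟨h.1.im, h.2.im⟩
  have h1 := hre.absolutelyContinuousOnInterval_intervalIntegral (c := a) (by simp)
  have h2 := him.absolutelyContinuousOnInterval_intervalIntegral (c := a) (by simp)
  have hc (w : ℂ) : AbsolutelyContinuousOnInterval (fun _ : ℝ => w) a b :=
    (LipschitzWith.const w).lipschitzOnWith.absolutelyContinuousOnInterval
  have h3 := (h1.smul (hc 1)).add (h2.smul (hc Complex.I))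
  rw [absolutelyContinuousOnInterval_iff] at h3 ⊢
  intro ε hε
  obtain ⟨δ, hδ, H⟩ := h3 ε hε
  refine ⟨δ, hδ, fun E hE hlt => ?_⟩
  refine lt_of_eq_of_lt (Finset.sum_congr rfl fun i hi => ?_) (H E hE hlt)
  have key : ∀ x ∈ uIcc a b, ∫ t in a..x, f t =
      (((fun x => ∫ t in a..x, (f t).re) • (fun _ => 1) +
        (fun x => ∫ t in a..x, (f t).im) • (fun _ => Complex.I) : ℝ → ℂ)) x := by
    intro x hx
    have hfx : IntervalIntegrable f volume a x := h.mono_set (uIcc_subset_uIcc_left hx)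
    have e := intervalIntegral.intervalIntegral_eq_integral_uIoc f a x volume
    have e1 := intervalIntegral.intervalIntegral_eq_integral_uIoc
      (fun t => (f t).re) a x volume
    have e2 := intervalIntegral.intervalIntegral_eq_integral_uIoc
      (fun t => (f t).im) a x volume
    have e3 := integral_re_add_im (𝕜 := ℂ) (f := f) (intervalIntegrable_iff.1 hfx)
    simp only [RCLike.re_to_complex, RCLike.im_to_complex, RCLike.I_to_complex] at e3
    simp only [Pi.add_apply, Pi.smul_apply', e, e1, e2]
    rw [← e3]
    split_ifs <;> simp
  rw [key _ (hE.1 i (Finset.mem_range.1 hi |> fun h => by simpa using h)).1,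
    key _ (hE.1 i (Finset.mem_range.1 hi |> fun h => by simpa using h)).2]

/-- Subtracting the primitive of F' leaves an absolutely continuous function with derivative zero
almost everywhere, hence a constant. -/
theorem AbsolutelyContinuousOnInterval.integral_eq_sub_of_ae_hasDerivAt {F F' : ℝ → ℂ} {a b : ℝ}
    (hF : AbsolutelyContinuousOnInterval F a b)
    (hd : ∀ᵐ x, x ∈ uIcc a b → HasDerivAt F (F' x) x)
    (hi : IntervalIntegrable F' volume a b) :
    ∫ x in a..b, F' x = F b - F a := by
  have g_ac := hF.sub (absolutelyContinuousOnInterval_primitive hi)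
  have g_d : ∀ᵐ x, x ∈ uIcc a b → HasDerivAt (F - fun x => ∫ t in a..x, F' t) 0 x := by
    filter_upwards [hd, hi.ae_hasDerivAt_integral] with x h1 h2 hx
    simpa using (h1 hx).sub (h2 hx a (by simp))
  obtain ⟨C, hC⟩ := g_ac.const_of_ae_hasDerivAt_zero g_d
  have h1 := hC a (by simp)
  have h2 := hC b (by simp)
  simp only [Pi.sub_apply, intervalIntegral.integral_same, sub_zero] at h1 h2
  rw [h1, ← h2]; ring

/-! ### Green's formula and square-integrable derivatives on the half-line -/

/-- `f` is twice differentiable on `[0, ∞)`, in the sense of absolutely continuous functions, with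
first derivative `f₁` and second derivative `f₂`. -/
structure HasSecondDeriv (f f₁ f₂ : ℝ → ℂ) : Prop where
  deriv : ∀ x : ℝ, 0 ≤ x → HasDerivWithinAt f (f₁ x) (Ici 0) x
  absCont : ∀ b : ℝ, 0 ≤ b → AbsolutelyContinuousOnInterval f₁ 0 b
  ae_deriv : ∀ᵐ x ∂(volume.restrict (Ioi (0 : ℝ))), HasDerivAt f₁ (f₂ x) x
  integrable : ∀ b : ℝ, 0 ≤ b → IntervalIntegrable f₂ volume 0 b

namespace HasSecondDeriv

variable {f f₁ f₂ g g₁ g₂ : ℝ → ℂ}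

theorem add (hf : HasSecondDeriv f f₁ f₂) (hg : HasSecondDeriv g g₁ g₂) :
    HasSecondDeriv (fun x => f x + g x) (fun x => f₁ x + g₁ x) (fun x => f₂ x + g₂ x) where
  deriv x hx := (hf.deriv x hx).add (hg.deriv x hx)
  absCont b hb := (hf.absCont b hb).add (hg.absCont b hb)
  ae_deriv := by
    filter_upwards [hf.ae_deriv, hg.ae_deriv] with x h1 h2 using h1.add h2
  integrable b hb := (hf.integrable b hb).add (hg.integrable b hb)

theorem const_mul (c : ℂ) (hf : HasSecondDeriv f f₁ f₂) :
    HasSecondDeriv (fun x => c * f x) (fun x => c * f₁ x) (fun x => c * f₂ x) where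
  deriv x hx := (hf.deriv x hx).const_mul c
  absCont b hb := (hf.absCont b hb).const_smul c
  ae_deriv := by filter_upwards [hf.ae_deriv] with x h1 using h1.const_mul c
  integrable b hb := (hf.integrable b hb).const_mul c

theorem star (hf : HasSecondDeriv f f₁ f₂) :
    HasSecondDeriv (fun x => star (f x)) (fun x => star (f₁ x)) (fun x => star (f₂ x)) where
  deriv x hx := (hf.deriv x hx).star
  absCont b hb := by
    have h := hf.absCont b hb
    rw [absolutelyContinuousOnInterval_iff] at h ⊢
    simpa [dist_star_star] using h
  ae_deriv := by filter_upwards [hf.ae_deriv] with x h1 using h1.star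
  integrable b hb := by
    have h := hf.integrable b hb
    rw [intervalIntegrable_iff] at h ⊢
    exact (starL' ℝ (A := ℂ)).integrable_comp_iff.2 h

theorem continuousOn (hf : HasSecondDeriv f f₁ f₂) : ContinuousOn f (Ici 0) :=
  fun x hx => (hf.deriv x hx).continuousWithinAt

theorem hasDerivAt (hf : HasSecondDeriv f f₁ f₂) {x : ℝ} (hx : 0 < x) : HasDerivAt f (f₁ x) x :=
  (hf.deriv x hx.le).hasDerivAt (Ici_mem_nhds hx)

theorem continuousOn_deriv_Icc (hf : HasSecondDeriv f f₁ f₂) {b : ℝ} (hb : 0 ≤ b) :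
    ContinuousOn f₁ (Icc 0 b) := by
  simpa [uIcc_of_le hb] using (hf.absCont b hb).continuousOn

theorem continuousOn_deriv (hf : HasSecondDeriv f f₁ f₂) : ContinuousOn f₁ (Ici 0) := by
  intro x hx
  have hx : 0 ≤ x := hx
  have h := hf.continuousOn_deriv_Icc (b := x + 1) (by linarith) x ⟨hx, by linarith⟩
  refine h.mono_of_mem_nhdsWithin ?_
  rw [← Ici_inter_Iic]
  exact inter_mem_nhdsWithin _ (Iic_mem_nhds (by linarith))

/-- The derivative is continuous, hence bounded on [0, b], so f is Lipschitz there. -/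
theorem absolutelyContinuous (hf : HasSecondDeriv f f₁ f₂) {b : ℝ} (hb : 0 ≤ b) :
    AbsolutelyContinuousOnInterval f 0 b := by
  obtain ⟨C, hC⟩ := (hf.absCont b hb).exists_bound
  have hC0 : 0 ≤ C := (norm_nonneg _).trans (hC 0 (by simp))
  have := (convex_Icc (0 : ℝ) b).lipschitzOnWith_of_nnnorm_hasDerivWithin_le (C := ⟨C, hC0⟩)
    (f := f) (f' := f₁) (fun x hx => (hf.deriv x hx.1).mono Icc_subset_Ici_self)
    (fun x hx => hC x (by rwa [uIcc_of_le hb]))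
  rw [← uIcc_of_le hb] at this
  exact this.absolutelyContinuousOnInterval

theorem ae_uIcc {p : ℝ → Prop} {b : ℝ} (hb : 0 ≤ b)
    (h : ∀ᵐ x ∂(volume.restrict (Ioi (0 : ℝ))), p x) : ∀ᵐ x, x ∈ uIcc 0 b → p x := by
  rw [ae_restrict_iff' measurableSet_Ioi] at h
  have h0 : ∀ᵐ x : ℝ, x ≠ 0 := by simp [ae_iff]
  filter_upwards [h, h0] with x h1 h2 hx
  rw [uIcc_of_le hb] at hx
  exact h1 (lt_of_le_of_ne hx.1 (Ne.symm h2))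

/-- Half of Green's formula: antisymmetrising in f and g cancels the terms f₁g₁. With f conjugated
and g = f it is the energy identity. -/
theorem integral_mul_deriv (hf : HasSecondDeriv f f₁ f₂) (hg : HasSecondDeriv g g₁ g₂) {b : ℝ}
    (hb : 0 ≤ b) :
    ∫ x in (0)..b, (f₁ x * g₁ x + f x * g₂ x) = f b * g₁ b - f 0 * g₁ 0 := by
  have hac := (hf.absolutelyContinuous hb).smul (hg.absCont b hb)
  refine hac.integral_eq_sub_of_ae_hasDerivAt ?_ ?_
  · have h0 : ∀ᵐ x ∂(volume.restrict (Ioi (0 : ℝ))), x ∈ Ioi (0 : ℝ) :=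
      ae_restrict_mem measurableSet_Ioi
    refine ae_uIcc hb ?_
    filter_upwards [hg.ae_deriv, h0] with x h1 h2
    exact (hf.hasDerivAt h2).mul h1
  · refine IntervalIntegrable.add ?_ ?_
    · refine ContinuousOn.intervalIntegrable ?_
      exact (hf.absCont b hb).continuousOn.mul (hg.absCont b hb).continuousOn
    · exact (hg.integrable b hb).continuousOn_mul (hf.absolutelyContinuous hb).continuousOn

/-- Green's formula on a bounded interval. -/
theorem green (hf : HasSecondDeriv f f₁ f₂) (hg : HasSecondDeriv g g₁ g₂) {b : ℝ}
    (hb : 0 ≤ b) :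
    ∫ x in (0)..b, (f x * g₂ x - f₂ x * g x) =
      (f b * g₁ b - f₁ b * g b) - (f 0 * g₁ 0 - f₁ 0 * g 0) := by
  have h1 := hf.integral_mul_deriv hg hb
  have h2 := hg.integral_mul_deriv hf hb
  have i1 : IntervalIntegrable (fun x => f x * g₂ x) volume 0 b :=
    (hg.integrable b hb).continuousOn_mul (hf.absolutelyContinuous hb).continuousOn
  have i2 : IntervalIntegrable (fun x => g x * f₂ x) volume 0 b :=
    (hf.integrable b hb).continuousOn_mul (hg.absolutelyContinuous hb).continuousOn
  have i3 : IntervalIntegrable (fun x => f₁ x * g₁ x) volume 0 b :=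
    ((hf.absCont b hb).continuousOn.mul (hg.absCont b hb).continuousOn).intervalIntegrable
  have i4 : IntervalIntegrable (fun x => g₁ x * f₁ x) volume 0 b :=
    ((hg.absCont b hb).continuousOn.mul (hf.absCont b hb).continuousOn).intervalIntegrable
  have h3 := intervalIntegral.integral_sub (i3.add i1) (i4.add i2)
  rw [h1, h2] at h3
  calc _ = ∫ x in (0)..b, ((f₁ x * g₁ x + f x * g₂ x) - (g₁ x * f₁ x + g x * f₂ x)) := by
        congr 1; ext x; ring
    _ = _ := by rw [h3]; ring

end HasSecondDeriv

/-- Used to show that an integrable boundary term with a limit at infinity must have limit zero. -/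
theorem not_integrableOn_Ioi_of_le_norm {F : ℝ → ℂ} {a c : ℝ} (hc : 0 < c)
    (h : ∀ x, a < x → c ≤ ‖F x‖) : ¬ IntegrableOn F (Ioi a) := by
  intro hi
  have h2 : IntegrableOn (fun _ : ℝ => c) (Ioi a) := by
    refine Integrable.mono' hi.norm aestronglyMeasurable_const ?_
    filter_upwards [ae_restrict_mem measurableSet_Ioi] with x hx
    rw [Real.norm_of_nonneg hc.le]; exact h x hx
  rw [integrableOn_const_iff] at h2
  simp [hc.ne'] at h2

namespace HasSecondDeriv

variable {f f₁ f₂ g g₁ g₂ : ℝ → ℂ}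

/-- Integration by parts expresses ∫₀ᵇ |f'|² through Re(conj f · f')(b) and bounded terms. If the
energy ever exceeded the bound K + |Re(conj f · f')(0)| + 1, then Re(conj f · f') ≥ 1 from there on,
so |f|² would grow linearly, contradicting f ∈ L². -/
theorem memLp_deriv (hf : HasSecondDeriv f f₁ f₂)
    (h0 : MemLp f 2 (volume.restrict (Ioi (0 : ℝ))))
    (h2 : MemLp f₂ 2 (volume.restrict (Ioi (0 : ℝ)))) :
    MemLp f₁ 2 (volume.restrict (Ioi (0 : ℝ))) := by
  have hm : AEStronglyMeasurable f₁ (volume.restrict (Ioi (0 : ℝ))) :=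
    (hf.continuousOn_deriv.mono Ioi_subset_Ici_self).aestronglyMeasurable measurableSet_Ioi
  have hprod : IntegrableOn (fun x => Star.star (f x) * f₂ x) (Ioi 0) := h0.star.integrable_mul h2
  have hsq : IntegrableOn (fun x => Star.star (f x) * f x) (Ioi 0) := h0.star.integrable_mul h0
  set K := ∫ x in Ioi (0 : ℝ), ‖Star.star (f x) * f₂ x‖ with hK
  -- the energy identity
  have hid (b : ℝ) (hb : 0 ≤ b) : (∫ x in (0)..b, ‖f₁ x‖ ^ 2) =
      (Star.star (f b) * f₁ b).re - (Star.star (f 0) * f₁ 0).re -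
        (∫ x in (0)..b, Star.star (f x) * f₂ x).re := by
    have h := hf.star.integral_mul_deriv hf hb
    have i1 : IntervalIntegrable (fun x => Star.star (f₁ x) * f₁ x) volume 0 b :=
      ((hf.star.absCont b hb).continuousOn.mul (hf.absCont b hb).continuousOn).intervalIntegrable
    have i2 : IntervalIntegrable (fun x => Star.star (f x) * f₂ x) volume 0 b :=
      (hf.integrable b hb).continuousOn_mul (hf.star.absolutelyContinuous hb).continuousOn
    rw [intervalIntegral.integral_add i1 i2] at h
    have h3 : ∫ x in (0)..b, Star.star (f₁ x) * f₁ x = ((∫ x in (0)..b, ‖f₁ x‖ ^ 2 : ℝ) : ℂ) := by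
      rw [← intervalIntegral.integral_ofReal]
      refine intervalIntegral.integral_congr fun x _ => ?_
      simpa using Complex.conj_mul' (f₁ x)
    rw [h3] at h
    have := congrArg Complex.re h
    simp only [Complex.add_re, Complex.ofReal_re, Complex.sub_re] at this
    linarith
  have hKb (b : ℝ) (hb : 0 ≤ b) : ‖∫ x in (0)..b, Star.star (f x) * f₂ x‖ ≤ K := by
    rw [intervalIntegral.integral_of_le hb]
    refine (norm_integral_le_integral_norm _).trans ?_
    exact setIntegral_mono_set hprod.norm (ae_of_all _ fun _ => norm_nonneg _)
      (Ioc_subset_Ioi_self).eventuallyLE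
  -- boundedness of the energy
  have hbdd : ∀ b, 0 ≤ b → ∫ x in (0)..b, ‖f₁ x‖ ^ 2 ≤
      K + |(Star.star (f 0) * f₁ 0).re| + 1 := by
    by_contra! hcon
    obtain ⟨b₀, hb₀, hlt⟩ := hcon
    have hge : ∀ b, b₀ ≤ b → 1 ≤ (Star.star (f b) * f₁ b).re := by
      intro b hb
      have hb0 : 0 ≤ b := hb₀.trans hb
      have hmono : ∫ x in (0)..b₀, ‖f₁ x‖ ^ 2 ≤ ∫ x in (0)..b, ‖f₁ x‖ ^ 2 := by
        refine intervalIntegral.integral_mono_interval le_rfl hb₀ hb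
          (ae_of_all _ fun _ => by positivity) ?_
        exact ((hf.absCont b hb0).continuousOn.norm.pow 2).intervalIntegrable
      have h4 := hid b hb0
      have h5 := (abs_le.1 ((Complex.abs_re_le_norm _).trans (hKb b hb0))).1
      have h6 := (abs_le.1 (le_refl |(Star.star (f 0) * f₁ 0).re|)).1
      linarith
    -- The derivative of |f|² is 2 Re(conj f · f') ≥ 2 beyond b₀, so after one unit of length |f|²
    -- is at least 1.
    have hgrow : ∀ x, b₀ + 1 < x → 1 ≤ ‖Star.star (f x) * f x‖ := by
      intro x hx
      have hd : ∀ y, 0 < y → HasDerivAt (fun y => (Star.star (f y) * f y).re)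
          (2 * (Star.star (f y) * f₁ y).re) y := by
        intro y hy
        have h7 := ((hf.hasDerivAt hy).star.mul (hf.hasDerivAt hy))
        have h8 := Complex.reCLM.hasFDerivAt.comp_hasDerivAt y h7
        refine h8.congr_deriv ?_
        simp; ring
      have h9 := (convex_Icc b₀ x).mul_sub_le_image_sub_of_le_deriv (C := 2)
        (f := fun y => (Star.star (f y) * f y).re) ?_ ?_ ?_ b₀ (by simp; linarith) x
        (by simp; linarith) (by linarith)
      · have h10 : 0 ≤ (Star.star (f b₀) * f b₀).re := by
          simp; nlinarith [sq_nonneg (f b₀).re, sq_nonneg (f b₀).im]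
        refine le_trans ?_ (Complex.re_le_norm _)
        linarith
      · have hc : ContinuousOn f (Icc b₀ x) :=
          hf.continuousOn.mono (fun y hy => hb₀.trans hy.1)
        exact Complex.continuous_re.comp_continuousOn (hc.star.mul hc)
      · intro y hy
        rw [interior_Icc] at hy
        exact (hd y (hb₀.trans_lt hy.1)).differentiableAt.differentiableWithinAt
      · intro y hy
        rw [interior_Icc] at hy
        rw [(hd y (hb₀.trans_lt hy.1)).deriv]
        have := hge y hy.1.le
        linarith
    refine not_integrableOn_Ioi_of_le_norm one_pos hgrow (hsq.mono_set ?_)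
    exact Ioi_subset_Ioi (by linarith)
  rw [memLp_two_iff_integrable_sq_norm hm]
  refine integrableOn_Ioi_of_intervalIntegral_norm_bounded
    (K + |(Star.star (f 0) * f₁ 0).re| + 1) 0 (l := atTop) (b := id) ?_ tendsto_id ?_
  · intro i
    refine IntegrableOn.mono_set (t := Icc 0 i) ?_ Ioc_subset_Icc_self
    rcases le_or_gt 0 i with hi | hi
    · exact ((hf.continuousOn_deriv_Icc hi).norm.pow 2).integrableOn_Icc
    · simp [Icc_eq_empty (not_le.2 hi)]
  · filter_upwards [eventually_ge_atTop 0] with b hb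
    simpa using hbdd b hb

/-- Green's formula on the half-line, for square-integrable functions with square-integrable second
derivatives. -/
theorem green_Ioi (hf : HasSecondDeriv f f₁ f₂) (hg : HasSecondDeriv g g₁ g₂)
    (hf0 : MemLp f 2 (volume.restrict (Ioi (0 : ℝ))))
    (hf2 : MemLp f₂ 2 (volume.restrict (Ioi (0 : ℝ))))
    (hg0 : MemLp g 2 (volume.restrict (Ioi (0 : ℝ))))
    (hg2 : MemLp g₂ 2 (volume.restrict (Ioi (0 : ℝ)))) :
    ∫ x in Ioi (0 : ℝ), (f x * g₂ x - f₂ x * g x) = -(f 0 * g₁ 0 - f₁ 0 * g 0) := by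
  have hf1 := hf.memLp_deriv hf0 hf2
  have hg1 := hg.memLp_deriv hg0 hg2
  have hi : IntegrableOn (fun x => f x * g₂ x - f₂ x * g x) (Ioi 0) :=
    (hf0.integrable_mul hg2).sub (hf2.integrable_mul hg0)
  have hB : IntegrableOn (fun x => f x * g₁ x - f₁ x * g x) (Ioi 0) :=
    (hf0.integrable_mul hg1).sub (hf1.integrable_mul hg0)
  have hlim := intervalIntegral_tendsto_integral_Ioi 0 hi tendsto_id
  set L := ∫ x in Ioi (0 : ℝ), (f x * g₂ x - f₂ x * g x)
  have hlim2 : Tendsto (fun b => f b * g₁ b - f₁ b * g b) atTop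
      (𝓝 (L + (f 0 * g₁ 0 - f₁ 0 * g 0))) := by
    refine (hlim.add_const (f 0 * g₁ 0 - f₁ 0 * g 0)).congr' ?_
    filter_upwards [eventually_ge_atTop 0] with b hb
    rw [id, hf.green hg hb]; ring
  -- The boundary term converges by Green's formula on (0, b), and it is integrable as a sum of
  -- products of L² functions; so its limit vanishes.
  have hz : L + (f 0 * g₁ 0 - f₁ 0 * g 0) = 0 := by
    by_contra hne
    have hpos : 0 < ‖L + (f 0 * g₁ 0 - f₁ 0 * g 0)‖ := norm_pos_iff.2 hne
    have h1 := hlim2.norm.eventually (lt_mem_nhds (half_lt_self hpos))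
    obtain ⟨a, ha⟩ := eventually_atTop.1 h1
    refine not_integrableOn_Ioi_of_le_norm (a := max a 0) (half_pos hpos)
      (fun x hx => (ha x ((le_max_left _ _).trans hx.le)).le) ?_
    exact hB.mono_set (Ioi_subset_Ioi (le_max_right _ _))
  linear_combination hz

end HasSecondDeriv

/-! ### Existence of solutions -/

/-- Carathéodory's existence theorem on the half-line, for a globally Lipschitz right-hand side. -/
theorem exists_continuous_eq_add_integral {E : Type*} [NormedAddCommGroup E] [NormedSpace ℝ E]
    [CompleteSpace E] (L : ℝ → E → E) (k : ℝ) (hk : 0 ≤ k)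
    (hmeas : ∀ Y : ℝ → E, Continuous Y → AEStronglyMeasurable (fun t => L t (Y t)) volume)
    (hzero : ∀ t, L t 0 = 0) (hlip : ∀ t u v, ‖L t u - L t v‖ ≤ k * ‖u - v‖) (Y₀ : E) :
    ∃ Y : ℝ → E, Continuous Y ∧ ∀ x, 0 ≤ x → Y x = Y₀ + ∫ t in (0)..x, L t (Y t) := by
  -- The solution is sought as exp(κt) G(t) with G bounded. In this weight the Picard operator has
  -- Lipschitz constant at most k/κ ≤ 1/2 on the whole half-line; the summand 2 keeps κ positive
  -- when k = 0.
  set κ : ℝ := 2 * k + 2 with hκ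
  have hκ0 : 0 < κ := by positivity
  have hbd (t : ℝ) (u : E) : ‖L t u‖ ≤ k * ‖u‖ := by simpa [hzero] using hlip t u 0
  have hw (G : BoundedContinuousFunction ℝ E) : Continuous fun t => Real.exp (κ * t) • G t := by
    fun_prop
  have hint (G : BoundedContinuousFunction ℝ E) (a b : ℝ) :
      IntervalIntegrable (fun t => L t (Real.exp (κ * t) • G t)) volume a b := by
    have h1 : IntervalIntegrable (fun t => k * ‖Real.exp (κ * t) • G t‖) volume a b :=
      (continuous_const.mul (hw G).norm).intervalIntegrable a b
    exact h1.mono_fun' (hmeas _ (hw G)).restrict (ae_of_all _ fun t => hbd t _)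
  have hexp (x : ℝ) (hx : 0 ≤ x) : Real.exp (-κ * x) * ∫ t in (0)..x, k * Real.exp (κ * t) ≤
      1 / 2 := by
    rw [intervalIntegral.integral_const_mul, intervalIntegral.integral_comp_mul_left _ hκ0.ne']
    simp only [mul_zero, integral_exp, smul_eq_mul, Real.exp_zero]
    have h1 : Real.exp (-κ * x) * (k * (κ⁻¹ * (Real.exp (κ * x) - 1))) =
        (k / κ) * (Real.exp (-κ * x) * Real.exp (κ * x) - Real.exp (-κ * x)) := by
      field_simp
    rw [h1, ← Real.exp_add]
    have h2 : k / κ ≤ 1 / 2 := by rw [div_le_div_iff₀ hκ0 two_pos]; linarith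
    have h3 := Real.exp_pos (-κ * x)
    have h4 : 0 ≤ k / κ := by positivity
    have h5 : Real.exp (-κ * x) ≤ 1 := Real.exp_le_one_iff.2 (by nlinarith)
    rw [show -κ * x + κ * x = 0 by ring, Real.exp_zero]
    nlinarith
  have hest (G G' : BoundedContinuousFunction ℝ E) (x : ℝ) (hx : 0 ≤ x) :
      Real.exp (-κ * x) * ‖(∫ t in (0)..x, L t (Real.exp (κ * t) • G t)) -
        ∫ t in (0)..x, L t (Real.exp (κ * t) • G' t)‖ ≤ 1 / 2 * dist G G' := by
    rw [← intervalIntegral.integral_sub (hint G _ _) (hint G' _ _)]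
    have h1 : ‖∫ t in (0)..x, (L t (Real.exp (κ * t) • G t) - L t (Real.exp (κ * t) • G' t))‖ ≤
        ∫ t in (0)..x, k * Real.exp (κ * t) * dist G G' := by
      refine intervalIntegral.norm_integral_le_of_norm_le hx (ae_of_all _ fun t _ => ?_) ?_
      · refine (hlip t _ _).trans ?_
        rw [← smul_sub, norm_smul, Real.norm_of_nonneg (Real.exp_pos _).le, mul_assoc]
        gcongr
        rw [← dist_eq_norm]
        exact BoundedContinuousFunction.dist_coe_le_dist t
      · exact Continuous.intervalIntegrable (by fun_prop) _ _
    rw [intervalIntegral.integral_mul_const] at h1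
    calc _ ≤ Real.exp (-κ * x) * ((∫ t in (0)..x, k * Real.exp (κ * t)) * dist G G') := by gcongr
      _ = (Real.exp (-κ * x) * (∫ t in (0)..x, k * Real.exp (κ * t))) * dist G G' := by ring
      _ ≤ _ := by gcongr; exact hexp x hx
  -- the weighted Picard operator
  let T₀ (G : BoundedContinuousFunction ℝ E) (x : ℝ) : E :=
    Real.exp (-κ * max x 0) • (Y₀ + ∫ t in (0)..(max x 0), L t (Real.exp (κ * t) • G t))
  have hTc (G : BoundedContinuousFunction ℝ E) : Continuous (T₀ G) := by
    have h1 := intervalIntegral.continuous_primitive (fun a b => hint G a b) 0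
    have h2 : Continuous fun x : ℝ => max x 0 := by fun_prop
    exact (by fun_prop : Continuous fun x : ℝ => Real.exp (-κ * max x 0)).smul
      (continuous_const.add (h1.comp h2))
  have hTd (G G' : BoundedContinuousFunction ℝ E) (x : ℝ) :
      dist (T₀ G x) (T₀ G' x) ≤ 1 / 2 * dist G G' := by
    have := hest G G' (max x 0) (le_max_right _ _)
    rw [dist_eq_norm]
    simp only [T₀]
    rw [← smul_sub, norm_smul, Real.norm_of_nonneg (Real.exp_pos _).le, add_sub_add_left_eq_sub]
    exact this
  have hTb (G : BoundedContinuousFunction ℝ E) (x : ℝ) :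
      ‖T₀ G x‖ ≤ ‖Y₀‖ + 1 / 2 * dist G 0 := by
    have h1 := hTd G 0 x
    have h2 : ‖T₀ 0 x‖ ≤ ‖Y₀‖ := by
      simp only [T₀, BoundedContinuousFunction.coe_zero, Pi.zero_apply, smul_zero, hzero,
        intervalIntegral.integral_zero, add_zero, norm_smul, Real.norm_eq_abs, Real.abs_exp]
      have h5 : Real.exp (-κ * max x 0) ≤ 1 :=
        Real.exp_le_one_iff.2 (by nlinarith [le_max_right x 0])
      nlinarith [norm_nonneg Y₀]
    rw [dist_eq_norm] at h1
    calc ‖T₀ G x‖ = ‖T₀ 0 x + (T₀ G x - T₀ 0 x)‖ := by rw [add_sub_cancel]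
      _ ≤ _ := (norm_add_le _ _).trans (add_le_add h2 h1)
  let T (G : BoundedContinuousFunction ℝ E) : BoundedContinuousFunction ℝ E :=
    BoundedContinuousFunction.ofNormedAddCommGroup (T₀ G) (hTc G) _ (hTb G)
  have hT : ContractingWith (1 / 2) T := by
    refine ⟨by rw [← NNReal.coe_lt_coe]; norm_num, LipschitzWith.of_dist_le_mul fun G G' => ?_⟩
    rw [BoundedContinuousFunction.dist_le (by positivity)]
    intro x
    exact (hTd G G' x).trans_eq (by norm_num)
  obtain ⟨G, hG⟩ : ∃ G, T G = G := ⟨_, hT.fixedPoint_isFixedPt⟩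
  refine ⟨fun t => Real.exp (κ * t) • G t, hw G, fun x hx => ?_⟩
  have h1 : T₀ G x = G x := congrArg (fun F : BoundedContinuousFunction ℝ E => F x) hG
  beta_reduce
  rw [← h1]
  simp only [T₀, max_eq_left hx]
  rw [smul_smul, ← Real.exp_add]
  simp

theorem HasSecondDeriv.congr_ae {f f₁ f₂ f₂' : ℝ → ℂ} (hf : HasSecondDeriv f f₁ f₂)
    (h : f₂ =ᵐ[volume.restrict (Ioi (0 : ℝ))] f₂') : HasSecondDeriv f f₁ f₂' where
  deriv := hf.deriv
  absCont := hf.absCont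
  ae_deriv := by filter_upwards [hf.ae_deriv, h] with x h1 h2 using h2 ▸ h1
  integrable b hb := by
    refine (hf.integrable b hb).congr_ae ?_
    rw [uIoc_of_le hb]
    exact ae_restrict_of_ae_restrict_of_subset Ioc_subset_Ioi_self h

theorem HasSecondDeriv.of_integral_eq {f f₁ f₂ : ℝ → ℂ} (hc : Continuous f₁)
    (hi : ∀ a b, IntervalIntegrable f₂ volume a b)
    (h0 : ∀ x, 0 ≤ x → f x = f 0 + ∫ t in (0)..x, f₁ t)
    (h1 : ∀ x, 0 ≤ x → f₁ x = f₁ 0 + ∫ t in (0)..x, f₂ t) : HasSecondDeriv f f₁ f₂ where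
  deriv x hx := by
    have h := ((hc.integral_hasStrictDerivAt 0 x).hasDerivAt.const_add (f 0)).hasDerivWithinAt
      (s := Ici 0)
    exact h.congr (fun y hy => h0 y hy) (h0 x hx)
  absCont b hb := by
    have h := (LipschitzWith.const (α := ℝ) (f₁ 0)).lipschitzOnWith (s := uIcc 0 b)
    have h2 := h.absolutelyContinuousOnInterval.add
      (absolutelyContinuousOnInterval_primitive (hi 0 b))
    rw [absolutelyContinuousOnInterval_iff] at h2 ⊢
    intro ε hε
    obtain ⟨δ, hδ, H⟩ := h2 ε hε
    refine ⟨δ, hδ, fun E hE hlt => lt_of_eq_of_lt (Finset.sum_congr rfl fun i hi => ?_)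
      (H E hE hlt)⟩
    have key : ∀ x ∈ uIcc 0 b, f₁ x = ((fun _ => f₁ 0) + (fun x => ∫ t in (0)..x, f₂ t) : ℝ → ℂ) x :=
      fun x hx => h1 x (by rw [uIcc_of_le hb] at hx; exact hx.1)
    rw [key _ (hE.1 i (by simpa using hi)).1, key _ (hE.1 i (by simpa using hi)).2]
  ae_deriv := by
    have hloc : LocallyIntegrable f₂ volume := by
      intro x
      refine ⟨Ioc (x - 1) (x + 1), mem_of_superset (Ioo_mem_nhds (by linarith) (by linarith))
        Ioo_subset_Ioc_self, (intervalIntegrable_iff_integrableOn_Ioc_of_le (by linarith)).1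
        (hi _ _)⟩
    have h := LocallyIntegrable.ae_hasDerivAt_integral hloc
    filter_upwards [ae_restrict_of_ae h, ae_restrict_mem measurableSet_Ioi] with x hx hx0
    refine ((hx 0).const_add (f₁ 0)).congr_of_eventuallyEq ?_
    filter_upwards [Ioi_mem_nhds hx0] with y hy using h1 y (le_of_lt hy)
  integrable b _ := hi 0 b

/-- `(f, g)` is a vector-valued solution of `-ε F'' + Q F = z F` on the half-line, with derivative
`(f₁, g₁)`. -/
structure IsVecSolution (q : ℝ → ℂ) (z : ℂ) (f g f₁ g₁ : ℝ → ℂ) : Prop where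
  fst : HasSecondDeriv f f₁ fun x => star (q x) * f x - z * g x
  snd : HasSecondDeriv g g₁ fun x => q x * g x - z * f x

/-- An essentially bounded potential is replaced by an everywhere bounded Borel one, so that the
right-hand side of the system is Lipschitz with one constant for all t. -/
theorem exists_bounded_ae_eq {q : ℝ → ℂ} (hq : MemLp q ⊤ (volume.restrict (Ioi (0 : ℝ)))) :
    ∃ (p : ℝ → ℂ) (C : ℝ), Measurable p ∧ 0 ≤ C ∧ (∀ x, ‖p x‖ ≤ C) ∧
      q =ᵐ[volume.restrict (Ioi (0 : ℝ))] p := by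
  obtain ⟨C, hC⟩ : ∃ C : ℝ, ∀ᵐ x ∂(volume.restrict (Ioi (0 : ℝ))), ‖q x‖ ≤ C := by
    refine ⟨(eLpNormEssSup q (volume.restrict (Ioi (0 : ℝ)))).toReal, ?_⟩
    have hfin : eLpNormEssSup q (volume.restrict (Ioi (0 : ℝ))) ≠ ⊤ := by
      simpa using hq.2.ne
    filter_upwards [ae_le_eLpNormEssSup (f := q) (μ := volume.restrict (Ioi (0 : ℝ)))] with x hx
    rw [← toReal_enorm]
    exact ENNReal.toReal_mono hfin hx
  set p₀ := hq.1.mk q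
  have hp₀ : Measurable p₀ := hq.1.stronglyMeasurable_mk.measurable
  refine ⟨{x | ‖p₀ x‖ ≤ max C 0}.indicator p₀, max C 0, hp₀.indicator ?_, le_max_right _ _,
    fun x => ?_, ?_⟩
  · exact measurableSet_le hp₀.norm measurable_const
  · by_cases hx : ‖p₀ x‖ ≤ max C 0
    · rwa [indicator_of_mem (by exact hx)]
    · rw [indicator_of_notMem (by exact hx)]; simp
  · filter_upwards [hC, hq.1.ae_eq_mk] with x h1 h2
    rw [indicator_of_mem]
    · exact h2
    · exact (h2 ▸ h1).trans (le_max_left _ _)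

/-- The equation is a first-order system for (f, g, f₁, g₁), linear with bounded measurable
coefficients. It is solved for the bounded representative p, and the second derivatives are then
changed on a null set. -/
theorem exists_isVecSolution {q : ℝ → ℂ} (hq : MemLp q ⊤ (volume.restrict (Ioi (0 : ℝ))))
    (z a b a₁ b₁ : ℂ) : ∃ f g f₁ g₁ : ℝ → ℂ, IsVecSolution q z f g f₁ g₁ ∧
      f 0 = a ∧ g 0 = b ∧ f₁ 0 = a₁ ∧ g₁ 0 = b₁ := by
  obtain ⟨p, C, hpm, hC0, hpC, hqp⟩ := exists_bounded_ae_eq hq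
  let L (t : ℝ) (y : ℂ × ℂ × ℂ × ℂ) : ℂ × ℂ × ℂ × ℂ :=
    (y.2.2.1, y.2.2.2, star (p t) * y.1 - z * y.2.1, p t * y.2.1 - z * y.1)
  have hmeas (Y : ℝ → ℂ × ℂ × ℂ × ℂ) (hY : Continuous Y) :
      Measurable (fun t => L t (Y t)) := by
    have hYm := hY.measurable
    have h2 : Measurable fun t => star (p t) := continuous_star.measurable.comp hpm
    exact hYm.snd.snd.fst.prodMk (hYm.snd.snd.snd.prodMk
      (((h2.mul hYm.fst).sub (hYm.snd.fst.const_mul z)).prodMk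
        ((hpm.mul hYm.snd.fst).sub (hYm.fst.const_mul z))))
  have hlip (t : ℝ) (u v : ℂ × ℂ × ℂ × ℂ) : ‖L t u - L t v‖ ≤ (1 + C + ‖z‖) * ‖u - v‖ := by
    have h1 : ‖u.1 - v.1‖ ≤ ‖u - v‖ := norm_fst_le (u - v)
    have h2 : ‖u.2 - v.2‖ ≤ ‖u - v‖ := norm_snd_le (u - v)
    have h3 : ‖u.2.1 - v.2.1‖ ≤ ‖u - v‖ := (norm_fst_le (u.2 - v.2)).trans h2
    have h4 : ‖u.2.2 - v.2.2‖ ≤ ‖u - v‖ := (norm_snd_le (u.2 - v.2)).trans h2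
    have h5 : ‖u.2.2.1 - v.2.2.1‖ ≤ ‖u - v‖ := (norm_fst_le (u.2.2 - v.2.2)).trans h4
    have h6 : ‖u.2.2.2 - v.2.2.2‖ ≤ ‖u - v‖ := (norm_snd_le (u.2.2 - v.2.2)).trans h4
    have h0 := norm_nonneg (u - v)
    have hz := norm_nonneg z
    have hgen (w x y : ℂ) (hw : ‖w‖ ≤ C) (hx : ‖x‖ ≤ ‖u - v‖) (hy : ‖y‖ ≤ ‖u - v‖) :
        ‖w * x - z * y‖ ≤ (1 + C + ‖z‖) * ‖u - v‖ := by
      refine (norm_sub_le _ _).trans ?_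
      rw [norm_mul, norm_mul]
      have := mul_le_mul hw hx (norm_nonneg _) hC0
      have := mul_le_mul_of_nonneg_left hy hz
      nlinarith
    have hone : ‖u - v‖ ≤ (1 + C + ‖z‖) * ‖u - v‖ := by nlinarith
    rw [norm_prod_le_iff, norm_prod_le_iff, norm_prod_le_iff]
    refine ⟨h5.trans hone, h6.trans hone, ?_, ?_⟩
    · have e : (L t u - L t v).2.2.1 =
        star (p t) * (u.1 - v.1) - z * (u.2.1 - v.2.1) := by simp [L]; ring
      rw [e]
      exact hgen _ _ _ (by simpa using hpC t) h1 h3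
    · have e : (L t u - L t v).2.2.2 =
        p t * (u.2.1 - v.2.1) - z * (u.1 - v.1) := by simp [L]; ring
      rw [e]
      exact hgen _ _ _ (hpC t) h3 h1
  obtain ⟨Y, hYc, hY⟩ := exists_continuous_eq_add_integral L (1 + C + ‖z‖) (by positivity)
    (fun Y hY => (hmeas Y hY).aestronglyMeasurable) (fun t => by simp [L]) hlip (a, b, a₁, b₁)
  have hint (x y : ℝ) : IntervalIntegrable (fun t => L t (Y t)) volume x y := by
    have h1 : IntervalIntegrable (fun t => (1 + C + ‖z‖) * ‖Y t‖) volume x y :=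
      (continuous_const.mul hYc.norm).intervalIntegrable x y
    refine h1.mono_fun' (hmeas Y hYc).aestronglyMeasurable (ae_of_all _ fun t => ?_)
    have := hlip t (Y t) 0
    simpa [L] using this
  have hY0 := hY 0 le_rfl
  simp only [intervalIntegral.integral_same, add_zero] at hY0
  have hproj (φ : (ℂ × ℂ × ℂ × ℂ) →L[ℝ] ℂ) (x : ℝ) (hx : 0 ≤ x) :
      φ (Y x) = φ (Y 0) + ∫ t in (0)..x, φ (L t (Y t)) := by
    rw [hY x hx, map_add, hY0, ContinuousLinearMap.intervalIntegral_comp_comm _ (hint 0 x)]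
  have hpint (φ : (ℂ × ℂ × ℂ × ℂ) →L[ℝ] ℂ) (x y : ℝ) :
      IntervalIntegrable (fun t => φ (L t (Y t))) volume x y :=
    ⟨φ.integrable_comp (hint x y).1, φ.integrable_comp (hint x y).2⟩
  let π₀ : (ℂ × ℂ × ℂ × ℂ) →L[ℝ] ℂ := ContinuousLinearMap.fst ℝ _ _
  let πs : (ℂ × ℂ × ℂ × ℂ) →L[ℝ] (ℂ × ℂ × ℂ) := ContinuousLinearMap.snd ℝ _ _
  let πt : (ℂ × ℂ × ℂ) →L[ℝ] (ℂ × ℂ) := ContinuousLinearMap.snd ℝ _ _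
  let π₁ := (ContinuousLinearMap.fst ℝ ℂ (ℂ × ℂ)).comp πs
  let π₂ := (ContinuousLinearMap.fst ℝ ℂ ℂ).comp (πt.comp πs)
  let π₃ := (ContinuousLinearMap.snd ℝ ℂ ℂ).comp (πt.comp πs)
  have s1 : HasSecondDeriv (fun x => (Y x).1) (fun x => (Y x).2.2.1)
      (fun x => star (p x) * (Y x).1 - z * (Y x).2.1) :=
    .of_integral_eq (by fun_prop) (hpint π₂) (hproj π₀) (hproj π₂)
  have s2 : HasSecondDeriv (fun x => (Y x).2.1) (fun x => (Y x).2.2.2)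
      (fun x => p x * (Y x).2.1 - z * (Y x).1) :=
    .of_integral_eq (by fun_prop) (hpint π₃) (hproj π₁) (hproj π₃)
  refine ⟨_, _, _, _, ⟨s1.congr_ae ?_, s2.congr_ae ?_⟩, ?_, ?_, ?_, ?_⟩
  · filter_upwards [hqp] with x hx
    rw [hx]
  · filter_upwards [hqp] with x hx
    rw [hx]
  all_goals simp [hY0]

/-! ### Vector-valued and matrix-valued solutions -/

namespace IsVecSolution

variable {q : ℝ → ℂ} {z w : ℂ} {f g f₁ g₁ u v u₁ v₁ : ℝ → ℂ}

theorem add (hf : IsVecSolution q z f g f₁ g₁) (hu : IsVecSolution q z u v u₁ v₁) :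
    IsVecSolution q z (fun x => f x + u x) (fun x => g x + v x) (fun x => f₁ x + u₁ x)
      (fun x => g₁ x + v₁ x) where
  fst := (hf.fst.add hu.fst).congr_ae (ae_of_all _ fun x => by ring)
  snd := (hf.snd.add hu.snd).congr_ae (ae_of_all _ fun x => by ring)

theorem const_mul (c : ℂ) (hf : IsVecSolution q z f g f₁ g₁) :
    IsVecSolution q z (fun x => c * f x) (fun x => c * g x) (fun x => c * f₁ x)
      (fun x => c * g₁ x) where
  fst := (hf.fst.const_mul c).congr_ae (ae_of_all _ fun x => by ring)
  snd := (hf.snd.const_mul c).congr_ae (ae_of_all _ fun x => by ring)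

/-- Conjugation by diag(-1, 1) changes the signs of both ε and Q, so it turns z into -z. This is the
source of the parity of ν and ψ. -/
theorem reflect (hf : IsVecSolution q z f g f₁ g₁) :
    IsVecSolution q (-z) (fun x => -f x) g (fun x => -f₁ x) g₁ where
  fst := by
    simpa using (hf.fst.const_mul (-1)).congr_ae (f₂' := fun x => star (q x) * -f x - -z * g x)
      (ae_of_all _ fun x => by ring)
  snd := hf.snd.congr_ae (ae_of_all _ fun x => by ring)

/-- Swapping the components and conjugating leaves ε and Q invariant and conjugates z. This is the
source of the equality of the two diagonal entries of Σ. -/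
theorem conj (hf : IsVecSolution q z f g f₁ g₁) :
    IsVecSolution q (star z) (fun x => star (g x)) (fun x => star (f x)) (fun x => star (g₁ x))
      (fun x => star (f₁ x)) where
  fst := hf.snd.star.congr_ae (ae_of_all _ fun x => by simp)
  snd := hf.fst.star.congr_ae (ae_of_all _ fun x => by simp)

theorem memLp_second (hq : MemLp q ⊤ (volume.restrict (Ioi (0 : ℝ)))) (z : ℂ)
    (hf : MemLp f 2 (volume.restrict (Ioi (0 : ℝ))))
    (hg : MemLp g 2 (volume.restrict (Ioi (0 : ℝ)))) :
    MemLp (fun x => q x * f x - z * g x) 2 (volume.restrict (Ioi (0 : ℝ))) :=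
  (hf.mul hq).sub (hg.const_mul z)

/-- The Wronskian of the vector-valued functions `(f, g)` and `(u, v)`. -/
def wronskian (f g f₁ g₁ u v u₁ v₁ : ℝ → ℂ) (x : ℝ) : ℂ :=
  star (f x) * v₁ x + star (g x) * u₁ x - star (f₁ x) * v x - star (g₁ x) * u x

/-- Since ε exchanges the components, Green's formula is applied crosswise, to f with v and to g
with u; the potential terms cancel. -/
theorem lagrange_interval (hf : IsVecSolution q w f g f₁ g₁) (hu : IsVecSolution q z u v u₁ v₁)
    {b : ℝ} (hb : 0 ≤ b) :
    (z - star w) * ∫ x in (0)..b, (star (f x) * u x + star (g x) * v x) =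
      wronskian f g f₁ g₁ u v u₁ v₁ 0 - wronskian f g f₁ g₁ u v u₁ v₁ b := by
  have h1 := hf.fst.star.green hu.snd hb
  have h2 := hf.snd.star.green hu.fst hb
  have c1 := (hf.fst.star.absolutelyContinuous hb).continuousOn
  have c2 := (hf.snd.star.absolutelyContinuous hb).continuousOn
  have c3 := (hu.fst.absolutelyContinuous hb).continuousOn
  have c4 := (hu.snd.absolutelyContinuous hb).continuousOn
  have e1 : ∀ x, star (f x) * (q x * v x - z * u x) - star (star (q x) * f x - w * g x) * v x =
      -z * (star (f x) * u x) + star w * (star (g x) * v x) := by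
    intro x; simp only [star_sub, star_mul', star_star]; ring
  have e2 : ∀ x, star (g x) * (star (q x) * u x - z * v x) - star (q x * g x - w * f x) * u x =
      -z * (star (g x) * v x) + star w * (star (f x) * u x) := by
    intro x; simp only [star_sub, star_mul']; ring
  simp only [e1] at h1
  simp only [e2] at h2
  have i1 : IntervalIntegrable (fun x => star (f x) * u x) volume 0 b :=
    (c1.mul c3).intervalIntegrable
  have i2 : IntervalIntegrable (fun x => star (g x) * v x) volume 0 b :=
    (c2.mul c4).intervalIntegrable
  rw [intervalIntegral.integral_add (i1.const_mul _) (i2.const_mul _),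
    intervalIntegral.integral_const_mul, intervalIntegral.integral_const_mul] at h1
  rw [intervalIntegral.integral_add (i2.const_mul _) (i1.const_mul _),
    intervalIntegral.integral_const_mul, intervalIntegral.integral_const_mul] at h2
  rw [intervalIntegral.integral_add i1 i2]
  simp only [wronskian]
  linear_combination -h1 - h2

/-- For square-integrable solutions there is no contribution from infinity. Boundedness of q enters
here: it makes the second derivatives square-integrable. -/
theorem lagrange (hq : MemLp q ⊤ (volume.restrict (Ioi (0 : ℝ))))
    (hf : IsVecSolution q w f g f₁ g₁) (hu : IsVecSolution q z u v u₁ v₁)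
    (mf : MemLp f 2 (volume.restrict (Ioi (0 : ℝ))))
    (mg : MemLp g 2 (volume.restrict (Ioi (0 : ℝ))))
    (mu : MemLp u 2 (volume.restrict (Ioi (0 : ℝ))))
    (mv : MemLp v 2 (volume.restrict (Ioi (0 : ℝ)))) :
    (z - star w) * ∫ x in Ioi (0 : ℝ), (star (f x) * u x + star (g x) * v x) =
      wronskian f g f₁ g₁ u v u₁ v₁ 0 := by
  have hq' : MemLp (fun x => star (q x)) ⊤ (volume.restrict (Ioi (0 : ℝ))) := hq.star
  have h1 := hf.fst.star.green_Ioi hu.snd mf.star (memLp_second hq' w mf mg).star mv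
    (memLp_second hq z mv mu)
  have h2 := hf.snd.star.green_Ioi hu.fst mg.star (memLp_second hq w mg mf).star mu
    (memLp_second hq' z mu mv)
  have e1 : ∀ x, star (f x) * (q x * v x - z * u x) - star (star (q x) * f x - w * g x) * v x =
      -z * (star (f x) * u x) + star w * (star (g x) * v x) := by
    intro x; simp only [star_sub, star_mul', star_star]; ring
  have e2 : ∀ x, star (g x) * (star (q x) * u x - z * v x) - star (q x * g x - w * f x) * u x =
      -z * (star (g x) * v x) + star w * (star (f x) * u x) := by
    intro x; simp only [star_sub, star_mul']; ring
  simp only [e1] at h1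
  simp only [e2] at h2
  have i1 : IntegrableOn (fun x => star (f x) * u x) (Ioi 0) := mf.star.integrable_mul mu
  have i2 : IntegrableOn (fun x => star (g x) * v x) (Ioi 0) := mg.star.integrable_mul mv
  rw [integral_add (i1.const_mul _) (i2.const_mul _), integral_const_mul,
    integral_const_mul] at h1
  rw [integral_add (i2.const_mul _) (i1.const_mul _), integral_const_mul,
    integral_const_mul] at h2
  rw [integral_add i1 i2]
  simp only [wronskian]
  linear_combination -h1 - h2

/-- The integrand is |f|² + |g|², continuous and nonnegative, so f and g vanish on [0, b], and with
them their one-sided derivatives at 0. -/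
theorem init_eq_zero (hf : IsVecSolution q z f g f₁ g₁) {b : ℝ} (hb : 0 < b)
    (h : ∫ x in (0)..b, (star (f x) * f x + star (g x) * g x) = 0) :
    f 0 = 0 ∧ g 0 = 0 ∧ f₁ 0 = 0 ∧ g₁ 0 = 0 := by
  have cf := hf.fst.continuousOn.mono (Icc_subset_Ici_self : Icc 0 b ⊆ Ici 0)
  have cg := hf.snd.continuousOn.mono (Icc_subset_Ici_self : Icc 0 b ⊆ Ici 0)
  have hr : ∫ x in (0)..b, (‖f x‖ ^ 2 + ‖g x‖ ^ 2) = 0 := by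
    have e : ∀ x, star (f x) * f x + star (g x) * g x = ((‖f x‖ ^ 2 + ‖g x‖ ^ 2 : ℝ) : ℂ) := by
      intro x
      have h1 := Complex.conj_mul' (f x)
      have h2 := Complex.conj_mul' (g x)
      simp only [Complex.star_def, h1, h2]; push_cast; ring
    simp only [e] at h
    rw [intervalIntegral.integral_ofReal] at h
    exact_mod_cast h
  have hc : ContinuousOn (fun x => ‖f x‖ ^ 2 + ‖g x‖ ^ 2) (Icc 0 b) :=
    (cf.norm.pow 2).add (cg.norm.pow 2)
  have hz : ∀ x ∈ Icc 0 b, ‖f x‖ ^ 2 + ‖g x‖ ^ 2 = 0 := by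
    intro x hx
    by_contra hne
    have := intervalIntegral.integral_pos hb hc (fun y _ => by positivity)
      ⟨x, hx, lt_of_le_of_ne (by positivity) (Ne.symm hne)⟩
    linarith
  have hfz : ∀ x ∈ Icc 0 b, f x = 0 := by
    intro x hx
    have h1 := hz x hx
    have h2 : ‖f x‖ ^ 2 = 0 := by nlinarith [sq_nonneg ‖f x‖, sq_nonneg ‖g x‖]
    simpa using h2
  have hgz : ∀ x ∈ Icc 0 b, g x = 0 := by
    intro x hx
    have h1 := hz x hx
    have h2 : ‖g x‖ ^ 2 = 0 := by nlinarith [sq_nonneg ‖f x‖, sq_nonneg ‖g x‖]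
    simpa using h2
  have h0 : (0 : ℝ) ∈ Icc 0 b := by simp [hb.le]
  have hder (h h₁ : ℝ → ℂ) (hd : HasDerivWithinAt h (h₁ 0) (Ici 0) 0)
      (hh : ∀ x ∈ Icc 0 b, h x = 0) : h₁ 0 = 0 := by
    have h2 : HasDerivWithinAt h 0 (Icc 0 b) 0 :=
      (hasDerivWithinAt_const (0 : ℝ) (Icc 0 b) (0 : ℂ)).congr hh (hh 0 h0)
    exact (uniqueDiffOn_Icc hb 0 h0).eq_deriv _ (hd.mono Icc_subset_Ici_self) h2
  exact ⟨hfz 0 h0, hgz 0 h0, hder f f₁ (hf.fst.deriv 0 le_rfl) hfz,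
    hder g g₁ (hf.snd.deriv 0 le_rfl) hgz⟩

theorem init_eq_zero_of_integral_Ioi (hf : IsVecSolution q z f g f₁ g₁)
    (mf : MemLp f 2 (volume.restrict (Ioi (0 : ℝ))))
    (mg : MemLp g 2 (volume.restrict (Ioi (0 : ℝ))))
    (h : ∫ x in Ioi (0 : ℝ), (star (f x) * f x + star (g x) * g x) = 0) :
    f 0 = 0 ∧ g 0 = 0 ∧ f₁ 0 = 0 ∧ g₁ 0 = 0 := by
  refine hf.init_eq_zero one_pos ?_
  have e : ∀ x, star (f x) * f x + star (g x) * g x = ((‖f x‖ ^ 2 + ‖g x‖ ^ 2 : ℝ) : ℂ) := by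
    intro x
    have h1 := Complex.conj_mul' (f x)
    have h2 := Complex.conj_mul' (g x)
    simp only [Complex.star_def, h1, h2]; push_cast; ring
  simp only [e] at h ⊢
  rw [integral_complex_ofReal] at h
  rw [intervalIntegral.integral_ofReal]
  norm_cast at h ⊢
  have hi : IntegrableOn (fun x => ‖f x‖ ^ 2 + ‖g x‖ ^ 2) (Ioi 0) :=
    ((memLp_two_iff_integrable_sq_norm mf.1).1 mf).add
      ((memLp_two_iff_integrable_sq_norm mg.1).1 mg)
  refine le_antisymm ?_ (intervalIntegral.integral_nonneg zero_le_one fun x _ => by positivity)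
  rw [intervalIntegral.integral_of_le zero_le_one]
  exact (setIntegral_mono_set hi (ae_of_all _ fun _ => by positivity)
    Ioc_subset_Ioi_self.eventuallyLE).trans h.le

end IsVecSolution

/-- Because of ε, the second row of the equation determines the second derivative of the first
component, and conversely. The bound on q supplies the local integrability of the second
derivatives. -/
theorem isEigenSolution_iff {q : ℝ → ℂ} (hq : MemLp q ⊤ (volume.restrict (Ioi (0 : ℝ)))) {z : ℂ}
    {F F₁ : ℝ → Matrix (Fin 2) (Fin 2) ℂ} :
    IsEigenSolution (hermPotential q) z F F₁ ↔ ∀ j, IsVecSolution q z (fun x => F x 0 j)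
      (fun x => F x 1 j) (fun x => F₁ x 0 j) (fun x => F₁ x 1 j) := by
  constructor
  · intro h j
    have hc (i : Fin 2) (b : ℝ) (hb : 0 ≤ b) : ContinuousOn (fun x => F x i j) (uIcc 0 b) := by
      rw [uIcc_of_le hb]
      exact fun x hx => ((h.hasDeriv x hx.1 i j).continuousWithinAt).mono Icc_subset_Ici_self
    have hqi (p : ℝ → ℂ) (hp : MemLp p ⊤ (volume.restrict (Ioi (0 : ℝ)))) (b : ℝ) (hb : 0 ≤ b) :
        IntervalIntegrable p volume 0 b := by
      rw [intervalIntegrable_iff_integrableOn_Ioc_of_le hb]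
      exact (hp.mono_measure (Measure.restrict_mono_set _ Ioc_subset_Ioi_self)).integrable le_top
    have hae : ∀ᵐ x ∂(volume.restrict (Ioi (0 : ℝ))),
        HasDerivAt (fun t => F₁ t 0 j) (star (q x) * F x 0 j - z * F x 1 j) x ∧
          HasDerivAt (fun t => F₁ t 1 j) (q x * F x 1 j - z * F x 0 j) x := by
      filter_upwards [h.equation] with x ⟨F₂, hF₂, hE⟩
      have e0 := congrFun (congrFun hE 0) j
      have e1 := congrFun (congrFun hE 1) j
      simp [epsMat, hermPotential, Matrix.vecMul, dotProduct, Fin.sum_univ_two] at e0 e1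
      refine ⟨(hF₂ 0 j).congr_deriv ?_, (hF₂ 1 j).congr_deriv ?_⟩
      · simp only [Complex.star_def]; linear_combination -e1
      · linear_combination -e0
    exact ⟨⟨fun x hx => h.hasDeriv x hx 0 j, fun b hb => h.absCont b hb 0 j,
      hae.mono fun x hx => hx.1, fun b hb => ((hqi _ hq.star b hb).mul_continuousOn
        (hc 0 b hb)).sub (((hc 1 b hb).const_smul z).intervalIntegrable)⟩,
      ⟨fun x hx => h.hasDeriv x hx 1 j, fun b hb => h.absCont b hb 1 j,
      hae.mono fun x hx => hx.2, fun b hb => ((hqi _ hq b hb).mul_continuousOn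
        (hc 1 b hb)).sub (((hc 0 b hb).const_smul z).intervalIntegrable)⟩⟩
  · intro h
    refine ⟨fun x hx i j => ?_, fun b hb i j => ?_, ?_⟩
    · fin_cases i
      exacts [(h j).fst.deriv x hx, (h j).snd.deriv x hx]
    · fin_cases i
      exacts [(h j).fst.absCont b hb, (h j).snd.absCont b hb]
    · have h0 := ae_all_iff.2 fun j => (h j).fst.ae_deriv
      have h1 := ae_all_iff.2 fun j => (h j).snd.ae_deriv
      filter_upwards [h0, h1] with x h0 h1
      refine ⟨Matrix.of ![fun j => star (q x) * F x 0 j - z * F x 1 j,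
        fun j => q x * F x 1 j - z * F x 0 j], fun i j => ?_, ?_⟩
      · fin_cases i
        exacts [h0 j, h1 j]
      · ext i j
        fin_cases i <;> simp [epsMat, hermPotential, Matrix.vecMul, dotProduct, Fin.sum_univ_two]

theorem IsVecSolution.mulVec {q : ℝ → ℂ} {z : ℂ} {F F₁ : ℝ → Matrix (Fin 2) (Fin 2) ℂ}
    (h : ∀ j, IsVecSolution q z (fun x => F x 0 j)
      (fun x => F x 1 j) (fun x => F₁ x 0 j) (fun x => F₁ x 1 j)) (v : Fin 2 → ℂ) :
    IsVecSolution q z (fun x => (F x *ᵥ v) 0) (fun x => (F x *ᵥ v) 1) (fun x => (F₁ x *ᵥ v) 0)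
      (fun x => (F₁ x *ᵥ v) 1) := by
  have := ((h 0).const_mul (v 0)).add ((h 1).const_mul (v 1))
  simpa [Matrix.mulVec, dotProduct, Fin.sum_univ_two, mul_comm] using this

/-! ### Boundary data -/

/-- A normal form covering finite and infinite α at once: S and C are commuting Hermitian matrices
with S² + C² = 1, S is a real scalar and C is off-diagonal. -/
theorem exists_bdry_eq (α : OnePoint ℂ) : ∃ (s : ℝ) (c : ℂ),
    bdryS α = (s : ℂ) • (1 : Matrix (Fin 2) (Fin 2) ℂ) ∧ bdryC α = !![0, c; star c, 0] ∧
      (s : ℂ) ^ 2 + c * star c = 1 := by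
  induction α using OnePoint.rec with
  | infty => exact ⟨0, 1, by simp [bdryS], by
      simp [bdryC, epsMat], by simp⟩
  | coe a =>
    refine ⟨1 / √(1 + ‖a‖ ^ 2), ((1 / √(1 + ‖a‖ ^ 2) : ℝ) : ℂ) * a, by simp [bdryS], ?_, ?_⟩
    · simp only [bdryC, OnePoint.elim_some, epsMat, bdryA]
      ext i j; fin_cases i <;> fin_cases j <;> simp
    · have h1 : a * star a = ((‖a‖ ^ 2 : ℝ) : ℂ) := by
        simpa using Complex.mul_conj' a
      have h2 : (1 / √(1 + ‖a‖ ^ 2)) ^ 2 * (1 + ‖a‖ ^ 2) = 1 := by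
        rw [div_pow, one_pow, Real.sq_sqrt (by positivity)]
        have : 1 + ‖a‖ ^ 2 ≠ 0 := by positivity
        field_simp
      have h3 : star (((1 / √(1 + ‖a‖ ^ 2) : ℝ) : ℂ) * a) =
          ((1 / √(1 + ‖a‖ ^ 2) : ℝ) : ℂ) * star a := by
        rw [star_mul', Complex.star_def, Complex.conj_ofReal]
      rw [h3]
      calc _ = (((1 / √(1 + ‖a‖ ^ 2)) ^ 2 : ℝ) : ℂ) * (1 + a * star a) := by push_cast; ring
        _ = (((1 / √(1 + ‖a‖ ^ 2)) ^ 2 * (1 + ‖a‖ ^ 2) : ℝ) : ℂ) := by rw [h1]; push_cast; ring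
        _ = 1 := by rw [h2]; simp

/-- The Wronskian form of two pairs `(F(0), ε F'(0))` of boundary data. -/
def bdryForm (a a' b b' : Fin 2 → ℂ) : ℂ := star a ⬝ᵥ b' - star a' ⬝ᵥ b

/-- Expanding (C - SN)*(S + CM) - (S + CN)*(C - SM) leaves (S² + C²)M - N*(S² + C²), because S and C
are Hermitian and commute. -/
theorem bdryForm_weyl (α : OnePoint ℂ) (N M : Matrix (Fin 2) (Fin 2) ℂ) (u v : Fin 2 → ℂ) :
    bdryForm ((bdryC α - bdryS α * N) *ᵥ u) ((bdryS α + bdryC α * N) *ᵥ u)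
      ((bdryC α - bdryS α * M) *ᵥ v) ((bdryS α + bdryC α * M) *ᵥ v) =
      star u ⬝ᵥ ((M - Nᴴ) *ᵥ v) := by
  obtain ⟨s, c, hS, hC, h⟩ := exists_bdry_eq α
  rw [hS, hC]
  simp [bdryForm, Matrix.mulVec, dotProduct, Fin.sum_univ_two, Matrix.vecMul, Matrix.one_apply]
    at h ⊢
  linear_combination (starRingEnd ℂ (u 0) * ((M 0 0 - starRingEnd ℂ (N 0 0)) * v 0 +
    (M 0 1 - starRingEnd ℂ (N 1 0)) * v 1) + starRingEnd ℂ (u 1) *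
    ((M 1 0 - starRingEnd ℂ (N 0 1)) * v 0 + (M 1 1 - starRingEnd ℂ (N 1 1)) * v 1)) * h

/-- The boundary condition is self-adjoint: the two terms cancel because SC = CS. -/
theorem bdryForm_homogeneous (α : OnePoint ℂ) (p : Fin 2 → ℂ) :
    bdryForm (bdryS α *ᵥ p) (-(bdryC α *ᵥ p)) (bdryS α *ᵥ p) (-(bdryC α *ᵥ p)) = 0 := by
  obtain ⟨s, c, hS, hC, h⟩ := exists_bdry_eq α
  rw [hS, hC]
  simp [bdryForm, Matrix.mulVec, dotProduct, Fin.sum_univ_two, Matrix.one_apply]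
  ring

theorem eq_zero_of_bdry (α : OnePoint ℂ) (p : Fin 2 → ℂ) (h1 : bdryS α *ᵥ p = 0)
    (h2 : bdryC α *ᵥ p = 0) : p = 0 := by
  obtain ⟨s, c, hS, hC, h⟩ := exists_bdry_eq α
  rw [hS] at h1
  rw [hC] at h2
  have e0 := congrFun h1 0
  have e1 := congrFun h1 1
  have e2 := congrFun h2 0
  have e3 := congrFun h2 1
  simp [Matrix.mulVec, dotProduct, Fin.sum_univ_two, Matrix.one_apply] at e0 e1 e2 e3 h
  have k0 : p 0 = 0 := by
    have : ((s : ℂ) ^ 2 + c * (starRingEnd ℂ) c) * p 0 = 0 := by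
      rcases e0 with e0 | e0 <;> rcases e3 with e3 | e3 <;> simp [e0, e3]
    rwa [h, one_mul] at this
  have k1 : p 1 = 0 := by
    have : ((s : ℂ) ^ 2 + c * (starRingEnd ℂ) c) * p 1 = 0 := by
      rcases e1 with e1 | e1 <;> rcases e2 with e2 | e2 <;> simp [e1, e2]
    rwa [h, one_mul] at this
  ext i; fin_cases i <;> assumption

/-! ### Weyl solutions and the `M`-function -/

/-- `(f, g)` is the Weyl solution `(Θ - Φ M) v`. -/
structure IsWeylSolution (q : ℝ → ℂ) (α : OnePoint ℂ) (z : ℂ) (M : Matrix (Fin 2) (Fin 2) ℂ)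
    (v : Fin 2 → ℂ) (f g f₁ g₁ : ℝ → ℂ) : Prop where
  sol : IsVecSolution q z f g f₁ g₁
  memLp_fst : MemLp f 2 (volume.restrict (Ioi (0 : ℝ)))
  memLp_snd : MemLp g 2 (volume.restrict (Ioi (0 : ℝ)))
  init : ![f 0, g 0] = (bdryC α - bdryS α * M) *ᵥ v
  init_deriv : ![g₁ 0, f₁ 0] = (bdryS α + bdryC α * M) *ᵥ v

/-- All columns of `Θ - Φ M` are square-integrable. -/
def IsWeylMatrix (q : ℝ → ℂ) (α : OnePoint ℂ) (z : ℂ) (M : Matrix (Fin 2) (Fin 2) ℂ) : Prop :=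
  ∀ v : Fin 2 → ℂ, ∃ f g f₁ g₁ : ℝ → ℂ, IsWeylSolution q α z M v f g f₁ g₁

theorem IsVecSolution.wronskian_zero {f g f₁ g₁ u v u₁ v₁ : ℝ → ℂ} :
    wronskian f g f₁ g₁ u v u₁ v₁ 0 =
      bdryForm ![f 0, g 0] ![g₁ 0, f₁ 0] ![u 0, v 0] ![v₁ 0, u₁ 0] := by
  simp [wronskian, bdryForm, dotProduct, Fin.sum_univ_two]
  ring

section WeylSolutions

variable {q : ℝ → ℂ} {α : OnePoint ℂ} {z w : ℂ} {M N : Matrix (Fin 2) (Fin 2) ℂ}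

/-- Lagrange's identity keeps only the boundary term at 0, where the data of Weyl solutions are
explicit in M and N. Existence of the Nevanlinna measure and the relation between M(z) and M(conj z)
rest on this identity. -/
theorem IsWeylSolution.kernel (hq : MemLp q ⊤ (volume.restrict (Ioi (0 : ℝ))))
    {a b : Fin 2 → ℂ} {f g f₁ g₁ u v u₁ v₁ : ℝ → ℂ}
    (hf : IsWeylSolution q α w N a f g f₁ g₁) (hu : IsWeylSolution q α z M b u v u₁ v₁) :
    (z - star w) * ∫ x in Ioi (0 : ℝ), (star (f x) * u x + star (g x) * v x) =
      star a ⬝ᵥ ((M - Nᴴ) *ᵥ b) := by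
  rw [IsVecSolution.lagrange hq hf.sol hu.sol hf.memLp_fst hf.memLp_snd hu.memLp_fst hu.memLp_snd,
    IsVecSolution.wronskian_zero, hf.init, hf.init_deriv, hu.init, hu.init_deriv, bdryForm_weyl]

theorem sub_star_ne_zero (hz : z.im ≠ 0) : z - star z ≠ 0 := by
  intro h
  have := congrArg Complex.im h
  simp at this
  exact hz (by linarith)

/-- The limit-point property. -/
theorem IsVecSolution.bdry_data_eq_zero (hq : MemLp q ⊤ (volume.restrict (Ioi (0 : ℝ))))
    (hz : z.im ≠ 0) {p : Fin 2 → ℂ} {f g f₁ g₁ : ℝ → ℂ} (h : IsVecSolution q z f g f₁ g₁)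
    (mf : MemLp f 2 (volume.restrict (Ioi (0 : ℝ))))
    (mg : MemLp g 2 (volume.restrict (Ioi (0 : ℝ))))
    (h0 : ![f 0, g 0] = bdryS α *ᵥ p) (h1 : ![g₁ 0, f₁ 0] = -(bdryC α *ᵥ p)) : p = 0 := by
  have hL := IsVecSolution.lagrange hq h h mf mg mf mg
  rw [IsVecSolution.wronskian_zero, h0, h1, bdryForm_homogeneous] at hL
  obtain ⟨e1, e2, e3, e4⟩ := h.init_eq_zero_of_integral_Ioi mf mg
    ((mul_eq_zero.1 hL).resolve_left (sub_star_ne_zero hz))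
  refine eq_zero_of_bdry α p ?_ ?_
  · rw [← h0, e1, e2]; simp
  · rw [← neg_eq_zero, ← h1, e3, e4]; simp

/-- The difference of the two Weyl solutions for v is square-integrable with homogeneous boundary
data generated by p = (N - M)v, so the limit-point property gives p = 0. -/
theorem IsWeylMatrix.unique (hq : MemLp q ⊤ (volume.restrict (Ioi (0 : ℝ)))) (hz : z.im ≠ 0)
    (hM : IsWeylMatrix q α z M) (hN : IsWeylMatrix q α z N) : M = N := by
  have key (v : Fin 2 → ℂ) : (N - M) *ᵥ v = 0 := by
    obtain ⟨f, g, f₁, g₁, hf⟩ := hM v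
    obtain ⟨u, w, u₁, w₁, hu⟩ := hN v
    refine IsVecSolution.bdry_data_eq_zero (α := α) hq hz (hf.sol.add (hu.sol.const_mul (-1)))
      (hf.memLp_fst.add (hu.memLp_fst.const_mul (-1)))
      (hf.memLp_snd.add (hu.memLp_snd.const_mul (-1))) ?_ ?_
    · calc _ = ![f 0, g 0] - ![u 0, w 0] := by
            ext i; fin_cases i <;> simp [sub_eq_add_neg]
        _ = _ := by
            rw [hf.init, hu.init, ← Matrix.sub_mulVec, Matrix.mulVec_mulVec]
            congr 1; noncomm_ring
    · calc _ = ![g₁ 0, f₁ 0] - ![w₁ 0, u₁ 0] := by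
            ext i; fin_cases i <;> simp [sub_eq_add_neg]
        _ = _ := by
            rw [hf.init_deriv, hu.init_deriv, ← Matrix.sub_mulVec, Matrix.mulVec_mulVec,
              ← Matrix.neg_mulVec]
            congr 1; noncomm_ring
  have h0 : N - M = 0 := by
    ext i j
    have := congrFun (key (Pi.single j 1)) i
    simpa using this
  exact (sub_eq_zero.1 h0).symm

theorem IsMValue.isWeylMatrix (hq : MemLp q ⊤ (volume.restrict (Ioi (0 : ℝ))))
    (h : IsMValue (hermPotential q) α z M) : IsWeylMatrix q α z M := by
  obtain ⟨Φ, Φ₁, Θ, Θ₁, hΦ, hΘ, h1, h2, h3, h4, hN⟩ := h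
  rw [isEigenSolution_iff hq] at hΦ hΘ
  have hL := (hN M).2 rfl
  intro v
  have s1 := IsVecSolution.mulVec hΘ v
  have s2 := IsVecSolution.mulVec hΦ (M *ᵥ v)
  have s3 := s1.add (s2.const_mul (-1))
  have e (i : Fin 2) (x : ℝ) : (Θ x *ᵥ v) i + -1 * (Φ x *ᵥ (M *ᵥ v)) i =
      (Θ x - Φ x * M) i 0 * v 0 + (Θ x - Φ x * M) i 1 * v 1 := by
    rw [Matrix.mulVec_mulVec, neg_one_mul, ← sub_eq_add_neg, ← Pi.sub_apply, ← Matrix.sub_mulVec]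
    simp [Matrix.mulVec, dotProduct, Fin.sum_univ_two]
  have hm (i : Fin 2) : MemLp (fun x => (Θ x *ᵥ v) i + -1 * (Φ x *ᵥ (M *ᵥ v)) i) 2
      (volume.restrict (Ioi (0 : ℝ))) := by
    simp only [e]
    exact ((hL i 0).mul_const _).add ((hL i 1).mul_const _)
  refine ⟨_, _, _, _, s3, hm 0, hm 1, ?_, ?_⟩
  · calc _ = Θ 0 *ᵥ v - Φ 0 *ᵥ (M *ᵥ v) := by
          ext i; fin_cases i <;> simp [sub_eq_add_neg]
      _ = _ := by rw [h3, h1, Matrix.mulVec_mulVec, Matrix.sub_mulVec]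
  · calc _ = epsMat *ᵥ (Θ₁ 0 *ᵥ v - Φ₁ 0 *ᵥ (M *ᵥ v)) := by
          ext i; fin_cases i <;> simp [sub_eq_add_neg, epsMat, Matrix.mulVec, dotProduct,
            Fin.sum_univ_two]
      _ = _ := by
          rw [Matrix.mulVec_sub, Matrix.mulVec_mulVec, Matrix.mulVec_mulVec, Matrix.mulVec_mulVec,
            ← Matrix.sub_mulVec, h4, h2]
          congr 1; noncomm_ring

/-! ### Symmetries of the `M`-function -/

/-- The matrix `diag(1, -1)`. -/
def sigMat : Matrix (Fin 2) (Fin 2) ℂ := !![1, 0; 0, -1]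

/-- Conjugation by σ fixes S and changes the sign of C, so the reflected Weyl solution for σv has
the right boundary data for v, up to the sign absorbed in -σMσ. -/
theorem IsWeylMatrix.reflect (h : IsWeylMatrix q α z M) :
    IsWeylMatrix q α (-z) (-(sigMat * M * sigMat)) := by
  intro v
  obtain ⟨f, g, f₁, g₁, hf⟩ := h (sigMat *ᵥ v)
  obtain ⟨s, c, hS, hC, -⟩ := exists_bdry_eq α
  have i1 := hf.init
  have i2 := hf.init_deriv
  refine ⟨_, _, _, _, hf.sol.reflect, hf.memLp_fst.neg, hf.memLp_snd, ?_, ?_⟩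
  · calc _ = -(sigMat *ᵥ ![f 0, g 0]) := by
          ext i; fin_cases i <;> simp [sigMat]
      _ = _ := by
          rw [i1, Matrix.mulVec_mulVec, Matrix.mulVec_mulVec, ← Matrix.neg_mulVec, hS, hC]
          congr 1
          ext i j; fin_cases i <;> fin_cases j <;>
            simp [sigMat, Matrix.mul_apply, Fin.sum_univ_two, Matrix.vecMul, dotProduct]
  · calc _ = sigMat *ᵥ ![g₁ 0, f₁ 0] := by
          ext i; fin_cases i <;> simp [sigMat, Matrix.mulVec, dotProduct, Fin.sum_univ_two]
      _ = _ := by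
          rw [i2, Matrix.mulVec_mulVec, Matrix.mulVec_mulVec, hS, hC]
          congr 1
          ext i j; fin_cases i <;> fin_cases j <;>
            simp [sigMat, Matrix.mul_apply, Fin.sum_univ_two, Matrix.vecMul, dotProduct]

/-- The new matrix is ε conj(M) ε. The Weyl solution for ε conj(v) is conjugated and swapped; S and
C are invariant under this operation. -/
theorem IsWeylMatrix.conj (h : IsWeylMatrix q α z M) :
    IsWeylMatrix q α (star z) !![star (M 1 1), star (M 1 0); star (M 0 1), star (M 0 0)] := by
  intro v
  obtain ⟨f, g, f₁, g₁, hf⟩ := h (epsMat *ᵥ star v)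
  obtain ⟨s, c, hS, hC, -⟩ := exists_bdry_eq α
  have i1 := hf.init
  have i2 := hf.init_deriv
  rw [hS, hC] at i1 i2
  have a0 := congrArg star (congrFun i1 0)
  have a1 := congrArg star (congrFun i1 1)
  have b0 := congrArg star (congrFun i2 0)
  have b1 := congrArg star (congrFun i2 1)
  refine ⟨_, _, _, _, hf.sol.conj, hf.memLp_snd.star, hf.memLp_fst.star, ?_, ?_⟩
  · rw [hS, hC]
    ext i; fin_cases i
    · simp [epsMat, Matrix.mulVec, dotProduct, Fin.sum_univ_two] at a1 ⊢
      rw [a1]; ring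
    · simp [epsMat, Matrix.mulVec, dotProduct, Fin.sum_univ_two] at a0 ⊢
      rw [a0]; ring
  · rw [hS, hC]
    ext i; fin_cases i
    · simp [epsMat, Matrix.mulVec, Matrix.vecMul, dotProduct, Fin.sum_univ_two] at b1 ⊢
      rw [b1]; ring
    · simp [epsMat, Matrix.mulVec, Matrix.vecMul, dotProduct, Fin.sum_univ_two] at b0 ⊢
      rw [b0]; ring

/-- In the kernel identity with w = conj z the factor z - conj w is zero. -/
theorem IsWeylMatrix.conjTranspose_eq (hq : MemLp q ⊤ (volume.restrict (Ioi (0 : ℝ))))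
    (hM : IsWeylMatrix q α z M) (hN : IsWeylMatrix q α (star z) N) : M = Nᴴ := by
  have key (a b : Fin 2 → ℂ) : star a ⬝ᵥ ((M - Nᴴ) *ᵥ b) = 0 := by
    obtain ⟨f, g, f₁, g₁, hf⟩ := hN a
    obtain ⟨u, v, u₁, v₁, hu⟩ := hM b
    rw [← hf.kernel hq hu, star_star, sub_self, zero_mul]
  have h0 : M - Nᴴ = 0 := by
    ext i j
    have := key (Pi.single i 1) (Pi.single j 1)
    rw [← Pi.single_star, star_one, single_one_dotProduct, Matrix.mulVec_single_one] at this
    simpa using this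
  exact sub_eq_zero.1 h0

/-- Taking the adjoint of the Weyl matrix at conj z provided by `IsWeylMatrix.conj` returns M with
its diagonal entries exchanged. -/
theorem IsWeylMatrix.diag_eq (hq : MemLp q ⊤ (volume.restrict (Ioi (0 : ℝ))))
    (hM : IsWeylMatrix q α z M) : M 0 0 = M 1 1 := by
  have h := hM.conjTranspose_eq hq hM.conj
  simpa using congrFun (congrFun h 0) 0

end WeylSolutions

/-! ### Existence of the `M`-function -/

theorem exists_isEigenSolution {q : ℝ → ℂ} (hq : MemLp q ⊤ (volume.restrict (Ioi (0 : ℝ))))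
    (z : ℂ) (A B : Matrix (Fin 2) (Fin 2) ℂ) : ∃ F F₁ : ℝ → Matrix (Fin 2) (Fin 2) ℂ,
      (∀ j, IsVecSolution q z (fun x => F x 0 j) (fun x => F x 1 j) (fun x => F₁ x 0 j)
        (fun x => F₁ x 1 j)) ∧ F 0 = A ∧ F₁ 0 = B := by
  choose f g f₁ g₁ h h0 h1 h2 h3 using
    fun j => exists_isVecSolution hq z (A 0 j) (A 1 j) (B 0 j) (B 1 j)
  refine ⟨fun x => Matrix.of ![fun j => f j x, fun j => g j x],
    fun x => Matrix.of ![fun j => f₁ j x, fun j => g₁ j x], fun j => h j, ?_, ?_⟩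
  · ext i j; fin_cases i <;> simp [h0, h1]
  · ext i j; fin_cases i <;> simp [h2, h3]

/-! ### Energies of solutions and the Weyl discs -/

/-- The square of the Frobenius norm. -/
noncomputable def frobSq (A : Matrix (Fin 2) (Fin 2) ℂ) : ℝ := ∑ i, ∑ j, ‖A i j‖ ^ 2

theorem frobSq_nonneg (A : Matrix (Fin 2) (Fin 2) ℂ) : 0 ≤ frobSq A := by
  unfold frobSq; positivity

theorem continuous_frobSq : Continuous frobSq := by
  unfold frobSq; fun_prop

theorem frobSq_smul (c : ℂ) (A : Matrix (Fin 2) (Fin 2) ℂ) :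
    frobSq (c • A) = ‖c‖ ^ 2 * frobSq A := by
  simp [frobSq, Fin.sum_univ_two, mul_pow]; ring

theorem half_frobSq_le (A B : Matrix (Fin 2) (Fin 2) ℂ) :
    1 / 2 * frobSq B - frobSq A ≤ frobSq (A - B) := by
  have key (a b : ℂ) : 1 / 2 * ‖b‖ ^ 2 - ‖a‖ ^ 2 ≤ ‖a - b‖ ^ 2 := by
    have h1 : ‖b‖ ≤ ‖a - b‖ + ‖a‖ := by
      calc ‖b‖ = ‖a - (a - b)‖ := by congr 1; ring
        _ ≤ _ := (norm_sub_le _ _).trans_eq (add_comm _ _)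
    nlinarith [norm_nonneg b, norm_nonneg a, norm_nonneg (a - b), sq_nonneg (‖a - b‖ - ‖a‖)]
  simp only [frobSq, Fin.sum_univ_two, Matrix.sub_apply]
  linarith [key (A 0 0) (B 0 0), key (A 0 1) (B 0 1), key (A 1 0) (B 1 0), key (A 1 1) (B 1 1)]

section Solutions

variable {q : ℝ → ℂ} {α : OnePoint ℂ} {z : ℂ} {Φ Φ₁ Θ Θ₁ F F₁ : ℝ → Matrix (Fin 2) (Fin 2) ℂ}

/-- Solutions are controlled only on [0, ∞); freezing them at their value at 0 for negative x gives
functions continuous on the whole line. -/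
theorem continuous_max_zero (hF : ∀ j, IsVecSolution q z (fun x => F x 0 j)
    (fun x => F x 1 j) (fun x => F₁ x 0 j) (fun x => F₁ x 1 j)) :
    Continuous fun x : ℝ => F (max x 0) := by
  refine continuous_matrix fun i j => ?_
  have hm : Continuous fun x : ℝ => max x 0 := by fun_prop
  fin_cases i
  · exact (hF j).fst.continuousOn.comp_continuous hm fun x => mem_Ici.2 (le_max_right _ _)
  · exact (hF j).snd.continuousOn.comp_continuous hm fun x => mem_Ici.2 (le_max_right _ _)

theorem IsVecSolution.sub_mul (hΘ : ∀ j, IsVecSolution q z (fun x => Θ x 0 j)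
    (fun x => Θ x 1 j) (fun x => Θ₁ x 0 j) (fun x => Θ₁ x 1 j))
    (hΦ : ∀ j, IsVecSolution q z (fun x => Φ x 0 j)
    (fun x => Φ x 1 j) (fun x => Φ₁ x 0 j) (fun x => Φ₁ x 1 j))
    (N : Matrix (Fin 2) (Fin 2) ℂ) (j : Fin 2) :
    IsVecSolution q z (fun x => (Θ x - Φ x * N) 0 j) (fun x => (Θ x - Φ x * N) 1 j)
      (fun x => (Θ₁ x - Φ₁ x * N) 0 j) (fun x => (Θ₁ x - Φ₁ x * N) 1 j) := by
  have h := (hΘ j).add ((IsVecSolution.mulVec hΦ (fun i => N i j)).const_mul (-1))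
  simpa [Matrix.mulVec, Matrix.mul_apply, dotProduct, sub_eq_add_neg] using h

/-- The squared norm of a matrix-valued solution in `L²(0, b)`. -/
noncomputable def energy (F : ℝ → Matrix (Fin 2) (Fin 2) ℂ) (b : ℝ) : ℝ :=
  ∫ x in (0)..b, frobSq (F (max x 0))

theorem ofReal_energy (hF : ∀ j, IsVecSolution q z (fun x => F x 0 j)
    (fun x => F x 1 j) (fun x => F₁ x 0 j) (fun x => F₁ x 1 j)) {b : ℝ} (hb : 0 ≤ b) :
    (energy F b : ℂ) = ∑ j, ∫ x in (0)..b,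
      (star (F x 0 j) * F x 0 j + star (F x 1 j) * F x 1 j) := by
  rw [energy, ← intervalIntegral.integral_ofReal, ← intervalIntegral.integral_finsetSum]
  · refine intervalIntegral.integral_congr fun x hx => ?_
    rw [uIcc_of_le hb] at hx
    have h (w : ℂ) : star w * w = ((‖w‖ ^ 2 : ℝ) : ℂ) := by simpa using Complex.conj_mul' w
    simp only [max_eq_left hx.1, h, frobSq, Fin.sum_univ_two]
    push_cast; ring
  · intro j _
    refine ContinuousOn.intervalIntegrable ?_
    rw [uIcc_of_le hb]
    have c0 := (hF j).fst.continuousOn.mono (Icc_subset_Ici_self : Icc 0 b ⊆ Ici 0)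
    have c1 := (hF j).snd.continuousOn.mono (Icc_subset_Ici_self : Icc 0 b ⊆ Ici 0)
    exact (c0.star.mul c0).add (c1.star.mul c1)

theorem init_eq_zero_of_energy (hF : ∀ j, IsVecSolution q z (fun x => F x 0 j)
    (fun x => F x 1 j) (fun x => F₁ x 0 j) (fun x => F₁ x 1 j)) {b : ℝ} (hb : 0 < b)
    (h : energy F b = 0) : F 0 = 0 ∧ F₁ 0 = 0 := by
  have h1 := ofReal_energy hF hb.le
  rw [h, Complex.ofReal_zero] at h1
  have hnn (j : Fin 2) : 0 ≤ ∫ x in (0)..b,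
      (star (F x 0 j) * F x 0 j + star (F x 1 j) * F x 1 j) := by
    rw [intervalIntegral.integral_of_le hb.le]
    refine integral_nonneg fun x => ?_
    exact add_nonneg (star_mul_self_nonneg _) (star_mul_self_nonneg _)
  have h2 := (Finset.sum_eq_zero_iff_of_nonneg (fun j _ => hnn j)).1 h1.symm
  have h3 (j : Fin 2) := (hF j).init_eq_zero hb (h2 j (Finset.mem_univ j))
  constructor <;> ext i j <;> fin_cases i
  exacts [(h3 j).1, (h3 j).2.1, (h3 j).2.2.1, (h3 j).2.2.2]

theorem energy_mono (hF : ∀ j, IsVecSolution q z (fun x => F x 0 j)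
    (fun x => F x 1 j) (fun x => F₁ x 0 j) (fun x => F₁ x 1 j)) {a b : ℝ} (ha : 0 ≤ a)
    (hab : a ≤ b) : energy F a ≤ energy F b :=
  intervalIntegral.integral_mono_interval le_rfl ha hab (ae_of_all _ fun _ => frobSq_nonneg _)
    ((continuous_frobSq.comp (continuous_max_zero hF)).intervalIntegrable _ _)

theorem continuous_energy_sub_mul (hΘ : ∀ j, IsVecSolution q z (fun x => Θ x 0 j)
    (fun x => Θ x 1 j) (fun x => Θ₁ x 0 j) (fun x => Θ₁ x 1 j))
    (hΦ : ∀ j, IsVecSolution q z (fun x => Φ x 0 j)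
    (fun x => Φ x 1 j) (fun x => Φ₁ x 0 j) (fun x => Φ₁ x 1 j)) (b : ℝ) :
    Continuous fun N : Matrix (Fin 2) (Fin 2) ℂ => energy (fun x => Θ x - Φ x * N) b := by
  have c1 := continuous_max_zero hΘ
  have c2 := continuous_max_zero hΦ
  refine intervalIntegral.continuous_parametric_intervalIntegral_of_continuous' ?_ _ _
  refine continuous_frobSq.comp ?_
  exact (c1.comp continuous_snd).sub ((c2.comp continuous_snd).matrix_mul continuous_fst)

/-- If F vanishes at b, only the Wronskian at 0 survives in Lagrange's identity with w = z. Summed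
over the columns it is tr(N - N*) = 2i Im tr N. Such an N lies on the boundary of the Weyl disc. -/
theorem energy_eq_of_apply_eq_zero (hz : z.im ≠ 0) {N : Matrix (Fin 2) (Fin 2) ℂ}
    (hF : ∀ j, IsVecSolution q z (fun x => F x 0 j)
    (fun x => F x 1 j) (fun x => F₁ x 0 j) (fun x => F₁ x 1 j)) (h0 : F 0 = bdryC α - bdryS α * N)
    (h1 : epsMat * F₁ 0 = bdryS α + bdryC α * N) {b : ℝ} (hb : 0 ≤ b) (h : F b = 0) :
    energy F b = (N 0 0 + N 1 1).im / z.im := by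
  have key (j : Fin 2) := (hF j).lagrange_interval (hF j) hb
  have hw (j : Fin 2) : IsVecSolution.wronskian (fun x => F x 0 j) (fun x => F x 1 j)
      (fun x => F₁ x 0 j) (fun x => F₁ x 1 j) (fun x => F x 0 j) (fun x => F x 1 j)
      (fun x => F₁ x 0 j) (fun x => F₁ x 1 j) b = 0 := by
    simp [IsVecSolution.wronskian, h]
  have hi (j : Fin 2) : ![F 0 0 j, F 0 1 j] = (bdryC α - bdryS α * N) *ᵥ Pi.single j 1 := by
    rw [← h0]; ext i; fin_cases i <;> simp
  have hi' (j : Fin 2) : ![F₁ 0 1 j, F₁ 0 0 j] = (bdryS α + bdryC α * N) *ᵥ Pi.single j 1 := by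
    rw [← h1]; ext i; fin_cases i <;> simp [epsMat, Matrix.vecMul, dotProduct, Fin.sum_univ_two]
  simp only [hw, IsVecSolution.wronskian_zero, hi, hi', bdryForm_weyl, sub_zero] at key
  have hE := ofReal_energy hF hb
  have hsum : (z - star z) * (energy F b : ℂ) = (N 0 0 + N 1 1) - star (N 0 0 + N 1 1) := by
    rw [hE, Finset.mul_sum, Fin.sum_univ_two, key, key]
    simp
    ring
  have him := congrArg Complex.im hsum
  simp at him
  rw [eq_div_iff hz]
  simp only [Complex.add_im]
  linarith

end Solutions

open scoped Matrix.Norms.Elementwise in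
-- The energy of Θ - ΦN grows quadratically in N, because Φ is injective on matrices, while the
-- right-hand side grows only linearly.
theorem isBounded_of_energy_le {q : ℝ → ℂ} {z : ℂ} {Φ Φ₁ Θ Θ₁ : ℝ → Matrix (Fin 2) (Fin 2) ℂ}
    (hΘ : ∀ j, IsVecSolution q z (fun x => Θ x 0 j)
    (fun x => Θ x 1 j) (fun x => Θ₁ x 0 j) (fun x => Θ₁ x 1 j))
    (hΦ : ∀ j, IsVecSolution q z (fun x => Φ x 0 j)
    (fun x => Φ x 1 j) (fun x => Φ₁ x 0 j) (fun x => Φ₁ x 1 j))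
    (hinj : ∀ N : Matrix (Fin 2) (Fin 2) ℂ, energy (fun x => Φ x * N) 1 = 0 → N = 0) :
    ∃ R, ∀ N : Matrix (Fin 2) (Fin 2) ℂ,
      energy (fun x => Θ x - Φ x * N) 1 ≤ (N 0 0 + N 1 1).im / z.im → ‖N‖ ≤ R := by
  have cΘ := continuous_max_zero hΘ
  have cΦ := continuous_max_zero hΦ
  have hcont : Continuous fun N : Matrix (Fin 2) (Fin 2) ℂ => energy (fun x => Φ x * N) 1 := by
    refine intervalIntegral.continuous_parametric_intervalIntegral_of_continuous' ?_ _ _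
    exact continuous_frobSq.comp ((cΦ.comp continuous_snd).matrix_mul continuous_fst)
  have hne : (Metric.sphere (0 : Matrix (Fin 2) (Fin 2) ℂ) 1).Nonempty :=
    NormedSpace.sphere_nonempty.2 zero_le_one
  obtain ⟨N₀, hN₀, hmin⟩ := (isCompact_sphere (0 : Matrix (Fin 2) (Fin 2) ℂ) 1).exists_isMinOn hne
    hcont.continuousOn
  have hnn (N : Matrix (Fin 2) (Fin 2) ℂ) : 0 ≤ energy (fun x => Φ x * N) 1 :=
    intervalIntegral.integral_nonneg zero_le_one fun _ _ => frobSq_nonneg _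
  set c := energy (fun x => Φ x * N₀) 1 with hc
  have hc0 : 0 < c := by
    refine lt_of_le_of_ne (hnn N₀) fun h => ?_
    have := hinj N₀ h.symm
    rw [this] at hN₀
    simp at hN₀
  have hge (N : Matrix (Fin 2) (Fin 2) ℂ) : c * ‖N‖ ^ 2 ≤ energy (fun x => Φ x * N) 1 := by
    rcases eq_or_ne N 0 with rfl | hN
    · simpa using hnn 0
    have hpos : 0 < ‖N‖ := norm_pos_iff.2 hN
    have hmem : ((‖N‖⁻¹ : ℝ) : ℂ) • N ∈ Metric.sphere (0 : Matrix (Fin 2) (Fin 2) ℂ) 1 := by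
      simp [norm_smul, hpos.ne']
    have h1 : c ≤ energy (fun x => Φ x * (((‖N‖⁻¹ : ℝ) : ℂ) • N)) 1 := hmin hmem
    have h2 : energy (fun x => Φ x * (((‖N‖⁻¹ : ℝ) : ℂ) • N)) 1 =
        (‖N‖ ^ 2)⁻¹ * energy (fun x => Φ x * N) 1 := by
      simp only [energy, Matrix.mul_smul, frobSq_smul]
      rw [intervalIntegral.integral_const_mul]
      simp
    rw [h2, inv_mul_eq_div, le_div_iff₀ (by positivity)] at h1
    exact h1
  set t := energy Θ 1
  have ht : 0 ≤ t := intervalIntegral.integral_nonneg zero_le_one fun _ _ => frobSq_nonneg _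
  set k := 2 / |z.im| with hk
  have hk0 : 0 ≤ k := by positivity
  -- The hypothesis yields (c/2)‖N‖² - t ≤ k‖N‖; once ‖N‖ > 1, t ≤ t‖N‖, hence ‖N‖ ≤ 2(k + t)/c.
  refine ⟨max 1 (2 * (k + t) / c), fun N hN => ?_⟩
  by_contra! hlt
  obtain ⟨hlt1, hlt2⟩ := max_lt_iff.1 hlt
  have hlow : 1 / 2 * energy (fun x => Φ x * N) 1 - t ≤ energy (fun x => Θ x - Φ x * N) 1 := by
    simp only [t, energy]
    have i1 : IntervalIntegrable (fun x => frobSq (Φ (max x 0) * N)) volume 0 1 :=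
      (continuous_frobSq.comp (cΦ.matrix_mul continuous_const)).intervalIntegrable _ _
    have i2 : IntervalIntegrable (fun x => frobSq (Θ (max x 0))) volume 0 1 :=
      (continuous_frobSq.comp cΘ).intervalIntegrable _ _
    have i3 : IntervalIntegrable (fun x => frobSq (Θ (max x 0) - Φ (max x 0) * N)) volume 0 1 :=
      (continuous_frobSq.comp (cΘ.sub (cΦ.matrix_mul continuous_const))).intervalIntegrable _ _
    rw [← intervalIntegral.integral_const_mul, ← intervalIntegral.integral_sub (i1.const_mul _) i2]
    exact intervalIntegral.integral_mono_on zero_le_one ((i1.const_mul _).sub i2) i3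
      fun x _ => half_frobSq_le _ _
  have hup : (N 0 0 + N 1 1).im / z.im ≤ k * ‖N‖ := by
    refine (le_abs_self _).trans ?_
    rw [abs_div, hk, div_mul_eq_mul_div]
    gcongr
    refine (Complex.abs_im_le_norm _).trans ((norm_add_le _ _).trans ?_)
    have h0 := Matrix.norm_entry_le_entrywise_sup_norm N (i := 0) (j := 0)
    have h1 := Matrix.norm_entry_le_entrywise_sup_norm N (i := 1) (j := 1)
    linarith
  have h3 := hge N
  rw [div_lt_iff₀ hc0] at hlt2
  nlinarith

/-- Weyl's nested discs: the matrices N for which Θ - ΦN has energy at most Im tr N / Im z on (0, b)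
form nonempty closed sets that shrink as b grows, and the first is compact. A common point has
finite energy on the half-line. -/
theorem exists_isMValue {q : ℝ → ℂ} (hq : MemLp q ⊤ (volume.restrict (Ioi (0 : ℝ))))
    (α : OnePoint ℂ) {z : ℂ} (hz : z.im ≠ 0) : ∃ M, IsMValue (hermPotential q) α z M := by
  have hεε : epsMat * epsMat = 1 := by
    ext i j; fin_cases i <;> fin_cases j <;> simp [epsMat]
  obtain ⟨Φ, Φ₁, hΦ, hΦ0, hΦ1⟩ := exists_isEigenSolution hq z (bdryS α) (-(epsMat * bdryC α))
  obtain ⟨Θ, Θ₁, hΘ, hΘ0, hΘ1⟩ := exists_isEigenSolution hq z (bdryC α) (epsMat * bdryS α)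
  have hΦ1' : epsMat * Φ₁ 0 = -bdryC α := by rw [hΦ1, mul_neg, ← mul_assoc, hεε, one_mul]
  have hΘ1' : epsMat * Θ₁ 0 = bdryS α := by rw [hΘ1, ← mul_assoc, hεε, one_mul]
  have hW (N : Matrix (Fin 2) (Fin 2) ℂ) := IsVecSolution.sub_mul hΘ hΦ N
  have hW0 (N : Matrix (Fin 2) (Fin 2) ℂ) : Θ 0 - Φ 0 * N = bdryC α - bdryS α * N := by
    rw [hΘ0, hΦ0]
  have hW1 (N : Matrix (Fin 2) (Fin 2) ℂ) : epsMat * (Θ₁ 0 - Φ₁ 0 * N) =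
      bdryS α + bdryC α * N := by
    rw [mul_sub, ← mul_assoc, hΦ1', hΘ1']; noncomm_ring
  -- `Φ(b)` is injective
  have hcol (p : Fin 2 → ℂ) (h0 : Φ 0 *ᵥ p = 0) (h1 : Φ₁ 0 *ᵥ p = 0) : p = 0 := by
    refine eq_zero_of_bdry α p (by rw [← hΦ0, h0]) ?_
    rw [← neg_eq_zero, ← Matrix.neg_mulVec, ← hΦ1', ← Matrix.mulVec_mulVec, h1, Matrix.mulVec_zero]
  -- A null vector of Φ(b) would give a solution satisfying the boundary condition at 0 and a
  -- Dirichlet condition at b, that is, a nonreal eigenvalue of a self-adjoint problem.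
  have hdet (b : ℝ) (hb : 0 < b) : (Φ b).det ≠ 0 := by
    intro hd
    obtain ⟨p, hp, hp0⟩ := Matrix.exists_mulVec_eq_zero_iff.2 hd
    have s := IsVecSolution.mulVec hΦ p
    have hL := s.lagrange_interval s hb.le
    have hb0 : IsVecSolution.wronskian (fun x => (Φ x *ᵥ p) 0) (fun x => (Φ x *ᵥ p) 1)
        (fun x => (Φ₁ x *ᵥ p) 0) (fun x => (Φ₁ x *ᵥ p) 1) (fun x => (Φ x *ᵥ p) 0)
        (fun x => (Φ x *ᵥ p) 1) (fun x => (Φ₁ x *ᵥ p) 0) (fun x => (Φ₁ x *ᵥ p) 1) b = 0 := by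
      simp [IsVecSolution.wronskian, hp0]
    have e0 : ![(Φ 0 *ᵥ p) 0, (Φ 0 *ᵥ p) 1] = bdryS α *ᵥ p := by
      rw [← hΦ0]; ext i; fin_cases i <;> simp
    have e1 : ![(Φ₁ 0 *ᵥ p) 1, (Φ₁ 0 *ᵥ p) 0] = -(bdryC α *ᵥ p) := by
      rw [← Matrix.neg_mulVec, ← hΦ1', ← Matrix.mulVec_mulVec]
      ext i; fin_cases i <;> simp [epsMat]
    rw [hb0, IsVecSolution.wronskian_zero, e0, e1, bdryForm_homogeneous, sub_zero] at hL
    obtain ⟨a1, a2, a3, a4⟩ := s.init_eq_zero hb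
      ((mul_eq_zero.1 hL).resolve_left (sub_star_ne_zero hz))
    refine hp (hcol p ?_ ?_) <;> ext i <;> fin_cases i
    exacts [a1, a2, a3, a4]
  -- The lengths n + 1 start at 1, so that the bound on (0, 1) applies to `D 0`.
  let D (n : ℕ) : Set (Matrix (Fin 2) (Fin 2) ℂ) :=
    {N | energy (fun x => Θ x - Φ x * N) (n + 1) ≤ (N 0 0 + N 1 1).im / z.im}
  have hDclosed (n : ℕ) : IsClosed (D n) := by
    refine isClosed_le (continuous_energy_sub_mul hΘ hΦ _) ?_
    have h0 : Continuous fun N : Matrix (Fin 2) (Fin 2) ℂ => N 0 0 + N 1 1 := by fun_prop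
    exact (Complex.continuous_im.comp h0).div_const _
  have hDne (n : ℕ) : (D n).Nonempty := by
    have hb : (0 : ℝ) < n + 1 := by positivity
    have hu := hdet _ hb
    -- This choice makes Θ - ΦN vanish at the right end, where the disc inequality is an equality.
    refine ⟨(Φ (n + 1))⁻¹ * Θ (n + 1), ?_⟩
    rw [mem_ofPred_eq]
    refine le_of_eq ?_
    refine energy_eq_of_apply_eq_zero (α := α) hz (hW _) (hW0 _) (hW1 _) hb.le ?_
    rw [← mul_assoc, Matrix.mul_nonsing_inv _ (isUnit_iff_ne_zero.2 hu), one_mul, sub_self]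
  have hDanti (n : ℕ) : D (n + 1) ⊆ D n := by
    intro N hN
    refine le_trans (energy_mono (hW N) (by positivity) ?_) hN
    push_cast; linarith
  have hDc : IsCompact (D 0) := by
    obtain ⟨R, hR⟩ := isBounded_of_energy_le (z := z) hΘ hΦ (fun N hN => by
      have hs (j : Fin 2) : IsVecSolution q z (fun x => (Φ x * N) 0 j) (fun x => (Φ x * N) 1 j)
          (fun x => (Φ₁ x * N) 0 j) (fun x => (Φ₁ x * N) 1 j) :=
        IsVecSolution.mulVec hΦ (fun i => N i j)
      obtain ⟨h0, h1⟩ := init_eq_zero_of_energy hs one_pos hN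
      ext i j
      have := hcol (fun i => N i j) (funext fun i => congrFun (congrFun h0 i) j)
        (funext fun i => congrFun (congrFun h1 i) j)
      exact congrFun this i)
    open scoped Matrix.Norms.Elementwise in
    refine (ProperSpace.isCompact_closedBall (0 : Matrix (Fin 2) (Fin 2) ℂ) R).of_isClosed_subset
      (hDclosed 0) fun N hN => ?_
    simpa using hR N (by simpa [D] using hN)
  obtain ⟨M, hM⟩ := IsCompact.nonempty_iInter_of_sequence_nonempty_isCompact_isClosed D hDanti hDne
    hDc hDclosed
  rw [mem_iInter] at hM
  have hL2 (i j : Fin 2) : MemLp (fun x => (Θ x - Φ x * M) i j) 2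
      (volume.restrict (Ioi (0 : ℝ))) := by
    have hcw := continuous_max_zero (hW M)
    have hcij : Continuous fun x => (Θ (max x 0) - Φ (max x 0) * M) i j := hcw.matrix_elem i j
    have hm : AEStronglyMeasurable (fun x => (Θ x - Φ x * M) i j)
        (volume.restrict (Ioi (0 : ℝ))) := by
      refine hcij.aestronglyMeasurable.congr ?_
      filter_upwards [ae_restrict_mem measurableSet_Ioi] with x hx
      rw [max_eq_left (le_of_lt hx)]
    rw [memLp_two_iff_integrable_sq_norm hm]
    have hi2 : IntegrableOn (fun x => ‖(Θ (max x 0) - Φ (max x 0) * M) i j‖ ^ 2) (Ioi 0) := by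
      refine integrableOn_Ioi_of_intervalIntegral_norm_bounded ((M 0 0 + M 1 1).im / z.im) 0
        (l := atTop) (b := fun n : ℕ => (n : ℝ) + 1) ?_ ?_ ?_
      · exact fun n => ((hcij.norm.pow 2).integrableOn_Icc).mono_set Ioc_subset_Icc_self
      · exact tendsto_natCast_atTop_atTop.atTop_add tendsto_const_nhds
      · refine Eventually.of_forall fun n => le_trans ?_ (hM n)
        refine intervalIntegral.integral_mono_on (by positivity)
          ((hcij.norm.pow 2).norm.intervalIntegrable _ _)
          ((continuous_frobSq.comp hcw).intervalIntegrable _ _) fun x _ => ?_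
        rw [norm_pow, norm_norm]
        refine le_trans ?_ (Finset.single_le_sum (f := fun i => ∑ j, ‖(Θ (max x 0) -
          Φ (max x 0) * M) i j‖ ^ 2) (fun _ _ => by positivity) (Finset.mem_univ i))
        exact Finset.single_le_sum (f := fun j => ‖(Θ (max x 0) -
          Φ (max x 0) * M) i j‖ ^ 2) (fun _ _ => by positivity) (Finset.mem_univ j)
    refine hi2.congr ?_
    filter_upwards [ae_restrict_mem measurableSet_Ioi] with x hx
    rw [max_eq_left (le_of_lt hx)]
  refine ⟨M, Φ, Φ₁, Θ, Θ₁, (isEigenSolution_iff hq).2 hΦ, (isEigenSolution_iff hq).2 hΘ, hΦ0, hΦ1',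
    hΘ0, hΘ1', fun N => ⟨fun hN => ?_, fun h => h ▸ hL2⟩⟩
  -- uniqueness: the difference is a square-integrable solution with homogeneous boundary data
  have key (j : Fin 2) : (fun i => (N - M) i j) = 0 := by
    refine IsVecSolution.bdry_data_eq_zero (α := α) hq hz
      (((hW M j)).add ((hW N j).const_mul (-1))) ((hL2 0 j).add ((hN 0 j).const_mul (-1)))
      ((hL2 1 j).add ((hN 1 j).const_mul (-1))) ?_ ?_
    · have : Φ 0 * (N - M) = (Θ 0 - Φ 0 * M) - (Θ 0 - Φ 0 * N) := by noncomm_ring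
      rw [hΦ0] at this
      have e : bdryS α *ᵥ (fun i => (N - M) i j) = fun i => (bdryS α * (N - M)) i j := rfl
      rw [e, this]
      ext i; fin_cases i <;> simp [sub_eq_add_neg, hΦ0]
    · have : epsMat * Φ₁ 0 * (N - M) =
          epsMat * (Θ₁ 0 - Φ₁ 0 * M) - epsMat * (Θ₁ 0 - Φ₁ 0 * N) := by noncomm_ring
      rw [hΦ1'] at this
      have e : -(bdryC α *ᵥ (fun i => (N - M) i j)) = fun i => (-bdryC α * (N - M)) i j := by
        rw [← Matrix.neg_mulVec]; rfl
      rw [e, this]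
      ext i; fin_cases i <;> simp [sub_eq_add_neg, epsMat, Matrix.vecMul, dotProduct]
  have h0 : N - M = 0 := by
    ext i j; exact congrFun (key j) i
  exact sub_eq_zero.1 h0

/-! ### Uniqueness of the measure in the Nevanlinna representation -/

/-- The Poisson kernel of the half-plane, without the factor `1 / π`. -/
noncomputable def cauchyKernel (y x t : ℝ) : ℝ := y⁻¹ * (1 + (y⁻¹ * (x - t)) ^ 2)⁻¹

theorem cauchyKernel_eq_im {y : ℝ} (hy : 0 < y) (x t : ℝ) :
    cauchyKernel y x t = (1 / ((t : ℂ) - ((x : ℂ) + y * Complex.I))).im := by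
  have h0 : (t - x) ^ 2 + y ^ 2 ≠ 0 := by positivity
  simp only [cauchyKernel, one_div, Complex.inv_im, Complex.normSq_apply]
  simp
  rw [show (t - x) * (t - x) + y * y = (t - x) ^ 2 + y ^ 2 by ring]
  field_simp
  ring

theorem continuous_cauchyKernel (y : ℝ) :
    Continuous fun p : ℝ × ℝ => cauchyKernel y p.2 p.1 := by
  unfold cauchyKernel
  refine continuous_const.mul (Continuous.inv₀ (by fun_prop) fun p => by positivity)

theorem cauchyKernel_nonneg {y : ℝ} (hy : 0 < y) (x t : ℝ) : 0 ≤ cauchyKernel y x t := by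
  unfold cauchyKernel; positivity

theorem integrable_cauchyKernel {y : ℝ} (hy : 0 < y) (t : ℝ) :
    Integrable fun x => cauchyKernel y x t :=
  ((integrable_inv_one_add_sq.comp_mul_left' (inv_ne_zero hy.ne')).comp_sub_right t).const_mul _

/-- The substitution x = ys + t moves the dependence on y from the kernel into f, which prepares the
limit y → 0 by dominated convergence. -/
theorem integral_mul_cauchyKernel {y : ℝ} (hy : 0 < y) (t : ℝ) (f : ℝ → ℝ) :
    ∫ x, f x * cauchyKernel y x t = ∫ s, f (y * s + t) * (1 + s ^ 2)⁻¹ := by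
  have h1 := Measure.integral_comp_mul_left (fun s => f (y * s + t) * (1 + s ^ 2)⁻¹) y⁻¹
  have h2 := integral_sub_right_eq_self (μ := volume)
    (fun x => f (y * (y⁻¹ * x) + t) * (1 + (y⁻¹ * x) ^ 2)⁻¹) t
  simp only [inv_inv, abs_of_pos hy, smul_eq_mul] at h1
  rw [h1] at h2
  calc _ = y⁻¹ * ∫ x, f (y * (y⁻¹ * (x - t)) + t) * (1 + (y⁻¹ * (x - t)) ^ 2)⁻¹ := by
        rw [← integral_const_mul]
        refine integral_congr_ae (ae_of_all _ fun x => ?_)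
        have : y * (y⁻¹ * (x - t)) + t = x := by field_simp; ring
        simp only [this, cauchyKernel]; ring
    _ = _ := by rw [h2, ← mul_assoc, inv_mul_cancel₀ hy.ne', one_mul]

theorem integrable_boundedContinuous_mul_cauchyKernel {y : ℝ} (hy : 0 < y)
    (f : BoundedContinuousFunction ℝ ℝ) (t : ℝ) :
    Integrable fun x => f x * cauchyKernel y x t :=
  (integrable_cauchyKernel hy t).bdd_mul f.continuous.aestronglyMeasurable
    (ae_of_all _ fun x => f.norm_coe_le_norm x)

theorem norm_integral_mul_cauchyKernel_le {y : ℝ} (hy : 0 < y)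
    (f : BoundedContinuousFunction ℝ ℝ) (t : ℝ) :
    ∫ x, ‖f x * cauchyKernel y x t‖ ≤ ‖f‖ * Real.pi := by
  have h1 : ∫ x, cauchyKernel y x t = Real.pi := by
    have := integral_mul_cauchyKernel hy t (fun _ => 1)
    simpa using this
  calc _ ≤ ∫ x, ‖f‖ * cauchyKernel y x t := by
        refine integral_mono (integrable_boundedContinuous_mul_cauchyKernel hy f t).norm
          ((integrable_cauchyKernel hy t).const_mul _) fun x => ?_
        beta_reduce
        rw [norm_mul, Real.norm_of_nonneg (cauchyKernel_nonneg hy x t)]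
        exact mul_le_mul_of_nonneg_right (f.norm_coe_le_norm x) (cauchyKernel_nonneg hy x t)
    _ = _ := by rw [integral_const_mul, h1]

theorem tendsto_integral_mul_cauchyKernel (f : BoundedContinuousFunction ℝ ℝ) (t : ℝ) :
    Tendsto (fun n : ℕ => ∫ x, f x * cauchyKernel (1 / ((n : ℝ) + 2)) x t) atTop
      (𝓝 (f t * Real.pi)) := by
  have hpos (n : ℕ) : (0 : ℝ) < 1 / ((n : ℝ) + 2) := by positivity
  simp only [fun n => integral_mul_cauchyKernel (hpos n) t f]
  have hlim : Tendsto (fun n : ℕ => (1 : ℝ) / ((n : ℝ) + 2)) atTop (𝓝 0) :=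
    tendsto_const_nhds.div_atTop (tendsto_natCast_atTop_atTop.atTop_add tendsto_const_nhds)
  have h := tendsto_integral_of_dominated_convergence (μ := volume)
    (F := fun (n : ℕ) s => f (1 / ((n : ℝ) + 2) * s + t) * (1 + s ^ 2)⁻¹)
    (f := fun s => f t * (1 + s ^ 2)⁻¹)
    (fun s => ‖f‖ * (1 + s ^ 2)⁻¹) ?_ (integrable_inv_one_add_sq.const_mul _) ?_ ?_
  · rwa [integral_const_mul, integral_univ_inv_one_add_sq] at h
  · intro n
    refine Continuous.aestronglyMeasurable ?_
    exact (f.continuous.comp (by fun_prop)).mul (Continuous.inv₀ (by fun_prop)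
      fun s => by positivity)
  · refine fun n => ae_of_all _ fun s => ?_
    rw [norm_mul, Real.norm_of_nonneg (by positivity : (0 : ℝ) ≤ (1 + s ^ 2)⁻¹)]
    exact mul_le_mul_of_nonneg_right (f.norm_coe_le_norm _) (by positivity)
  · refine ae_of_all _ fun s => Tendsto.mul_const _ ?_
    have : Tendsto (fun n : ℕ => 1 / ((n : ℝ) + 2) * s + t) atTop (𝓝 (0 * s + t)) :=
      (hlim.mul_const s).add_const t
    rw [zero_mul, zero_add] at this
    exact (f.continuous.tendsto t).comp this

theorem integral_integral_mul_cauchyKernel {ω : Measure ℝ} [IsFiniteMeasure ω] {y : ℝ}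
    (hy : 0 < y) (f : BoundedContinuousFunction ℝ ℝ) :
    ∫ t, (∫ x, f x * cauchyKernel y x t) ∂ω = ∫ x, f x * ∫ t, cauchyKernel y x t ∂ω := by
  have hm : AEStronglyMeasurable (fun p : ℝ × ℝ => f p.2 * cauchyKernel y p.2 p.1)
      (ω.prod volume) :=
    ((f.continuous.comp continuous_snd).mul (continuous_cauchyKernel y)).aestronglyMeasurable
  have hi : Integrable (fun p : ℝ × ℝ => f p.2 * cauchyKernel y p.2 p.1) (ω.prod volume) := by
    rw [integrable_prod_iff hm]
    refine ⟨ae_of_all _ fun t => integrable_boundedContinuous_mul_cauchyKernel hy f t, ?_⟩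
    refine Integrable.mono' (integrable_const (‖f‖ * Real.pi)) hm.norm.integral_prod_right'
      (ae_of_all _ fun t => ?_)
    rw [Real.norm_of_nonneg (integral_nonneg fun _ => norm_nonneg _)]
    exact norm_integral_mul_cauchyKernel_le hy f t
  rw [integral_integral_swap (f := fun t x => f x * cauchyKernel y x t) hi]
  simp only [integral_const_mul]

theorem integrable_inv_sub {ω : Measure ℝ} [IsFiniteMeasure ω] {z : ℂ} (hz : z.im ≠ 0) :
    Integrable (fun t : ℝ => 1 / ((t : ℂ) - z)) ω := by
  have hne (t : ℝ) : (t : ℂ) - z ≠ 0 := by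
    intro h; have := congrArg Complex.im h; simp at this; exact hz this
  refine Integrable.mono' (integrable_const (1 / |z.im|)) (Continuous.aestronglyMeasurable ?_)
    (ae_of_all _ fun t => ?_)
  · exact continuous_const.div (by fun_prop) hne
  · rw [norm_div, norm_one]
    have : |z.im| ≤ ‖(t : ℂ) - z‖ := by
      simpa using Complex.abs_im_le_norm ((t : ℂ) - z)
    gcongr

/-- Stieltjes inversion: the imaginary parts are Poisson integrals; integrated against a bounded
continuous f, with the order exchanged, they converge to π ∫ f dω as y → 0. The hypothesis is needed
only for Im z < 1, which lets the application avoid z = i. -/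
theorem ext_of_integral_inv_sub {ω ω' : Measure ℝ} [IsFiniteMeasure ω] [IsFiniteMeasure ω']
    (h : ∀ z : ℂ, 0 < z.im → z.im < 1 →
      ∫ t : ℝ, 1 / ((t : ℂ) - z) ∂ω = ∫ t : ℝ, 1 / ((t : ℂ) - z) ∂ω') : ω = ω' := by
  have hP (y : ℝ) (hy : 0 < y) (hy1 : y < 1) (x : ℝ) :
      ∫ t, cauchyKernel y x t ∂ω = ∫ t, cauchyKernel y x t ∂ω' := by
    have him : ((x : ℂ) + y * Complex.I).im = y := by simp
    have h1 := congrArg Complex.im (h (x + y * Complex.I) (by rwa [him]) (by rwa [him]))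
    have hz : ((x : ℂ) + y * Complex.I).im ≠ 0 := by rw [him]; exact hy.ne'
    have i1 := integral_im (𝕜 := ℂ) (integrable_inv_sub (ω := ω) hz)
    have i2 := integral_im (𝕜 := ℂ) (integrable_inv_sub (ω := ω') hz)
    simp only [RCLike.im_to_complex] at i1 i2
    simp only [fun t => cauchyKernel_eq_im hy x t]
    rw [i1, i2, h1]
  have hlim (ρ : Measure ℝ) [IsFiniteMeasure ρ] (f : BoundedContinuousFunction ℝ ℝ) :
      Tendsto (fun n : ℕ => ∫ x, f x * ∫ t, cauchyKernel (1 / ((n : ℝ) + 2)) x t ∂ρ) atTop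
        (𝓝 (∫ t, f t * Real.pi ∂ρ)) := by
    have hpos (n : ℕ) : (0 : ℝ) < 1 / ((n : ℝ) + 2) := by positivity
    simp only [← fun n => integral_integral_mul_cauchyKernel (ω := ρ) (hpos n) f]
    refine tendsto_integral_of_dominated_convergence (fun _ => ‖f‖ * Real.pi) ?_
      (integrable_const _) ?_ (ae_of_all _ fun t => tendsto_integral_mul_cauchyKernel f t)
    · intro n
      have : StronglyMeasurable fun p : ℝ × ℝ =>
          f p.2 * cauchyKernel (1 / ((n : ℝ) + 2)) p.2 p.1 :=
        ((f.continuous.comp continuous_snd).mul (continuous_cauchyKernel _)).stronglyMeasurable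
      exact this.integral_prod_right'.aestronglyMeasurable
    · exact fun n => ae_of_all _ fun t => (norm_integral_le_integral_norm _).trans
        (norm_integral_mul_cauchyKernel_le (hpos n) f t)
  refine ext_of_forall_integral_eq_of_IsFiniteMeasure fun f => ?_
  have h1 := hlim ω f
  have h2 := hlim ω' f
  have e : (fun n : ℕ => ∫ x, f x * ∫ t, cauchyKernel (1 / ((n : ℝ) + 2)) x t ∂ω) =
      fun n : ℕ => ∫ x, f x * ∫ t, cauchyKernel (1 / ((n : ℝ) + 2)) x t ∂ω' := by
    funext n
    have h3 : 1 / ((n : ℝ) + 2) < 1 := by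
      rw [div_lt_one (by positivity)]; linarith [n.cast_nonneg (α := ℝ)]
    simp only [hP _ (by positivity) h3]
  rw [e] at h1
  have h3 := tendsto_nhds_unique h1 h2
  rw [integral_mul_const, integral_mul_const] at h3
  exact mul_right_cancel₀ Real.pi_ne_zero h3

/-- The kernel of the Nevanlinna representation. -/
noncomputable def nevKernel (z : ℂ) (t : ℝ) : ℂ :=
  1 / ((t : ℂ) - z) - (t : ℂ) / (1 + (t : ℂ) ^ 2)

theorem ofReal_sub_ne_zero {z : ℂ} (hz : z.im ≠ 0) (t : ℝ) : (t : ℂ) - z ≠ 0 := by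
  intro h; have := congrArg Complex.im h; simp at this; exact hz this

theorem one_add_sq_ne_zero (t : ℝ) : 1 + (t : ℂ) ^ 2 ≠ 0 := by
  have : (1 + t ^ 2 : ℝ) ≠ 0 := by positivity
  exact_mod_cast this

/-- This reduces the Nevanlinna integral against (1 + t²) dω to the total mass and the Cauchy
transform of the finite measure ω. -/
theorem one_add_sq_mul_nevKernel {z : ℂ} (hz : z.im ≠ 0) (t : ℝ) :
    (1 + (t : ℂ) ^ 2) * nevKernel z t = z + (1 + z ^ 2) * (1 / ((t : ℂ) - z)) := by
  have h1 := ofReal_sub_ne_zero hz t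
  have h2 := one_add_sq_ne_zero t
  rw [nevKernel]
  field_simp
  ring

/-- The measure `(1 + t²) dω(t)`. -/
noncomputable def nevMeasure (ω : Measure ℝ) : Measure ℝ :=
  ω.withDensity fun t => ENNReal.ofReal (1 + t ^ 2)

theorem measurable_one_add_sq : Measurable fun t : ℝ => ENNReal.ofReal (1 + t ^ 2) := by fun_prop

theorem integral_nevMeasure (ω : Measure ℝ) (g : ℝ → ℂ) :
    ∫ t, g t ∂(nevMeasure ω) = ∫ t, (1 + (t : ℂ) ^ 2) * g t ∂ω := by
  rw [nevMeasure, integral_withDensity_eq_integral_toReal_smul₀ measurable_one_add_sq.aemeasurable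
    (ae_of_all _ fun t => ENNReal.ofReal_lt_top)]
  refine integral_congr_ae (ae_of_all _ fun t => ?_)
  beta_reduce
  rw [ENNReal.toReal_ofReal (by positivity), Complex.real_smul]
  push_cast; ring

theorem integrable_nevMeasure_iff (ω : Measure ℝ) (g : ℝ → ℂ) :
    Integrable g (nevMeasure ω) ↔ Integrable (fun t : ℝ => (1 + (t : ℂ) ^ 2) * g t) ω := by
  rw [nevMeasure, integrable_withDensity_iff_integrable_smul' measurable_one_add_sq
    (ae_of_all _ fun t => ENNReal.ofReal_lt_top)]
  refine integrable_congr (ae_of_all _ fun t => ?_)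
  beta_reduce
  rw [ENNReal.toReal_ofReal (by positivity), Complex.real_smul]
  push_cast; ring

theorem integrable_nevMeasure (ω : Measure ℝ) [IsFiniteMeasure ω] :
    Integrable (fun t : ℝ => 1 / (1 + t ^ 2)) (nevMeasure ω) := by
  rw [nevMeasure, integrable_withDensity_iff measurable_one_add_sq
    (ae_of_all _ fun t => ENNReal.ofReal_lt_top)]
  refine (integrable_const (1 : ℝ)).congr (ae_of_all _ fun t => ?_)
  beta_reduce
  rw [ENNReal.toReal_ofReal (by positivity)]
  have : (1 + t ^ 2 : ℝ) ≠ 0 := by positivity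
  field_simp

theorem integrable_nevKernel_nevMeasure (ω : Measure ℝ) [IsFiniteMeasure ω] {z : ℂ}
    (hz : z.im ≠ 0) : Integrable (nevKernel z) (nevMeasure ω) := by
  rw [integrable_nevMeasure_iff]
  simp only [one_add_sq_mul_nevKernel hz]
  exact (integrable_const z).add ((integrable_inv_sub hz).const_mul _)

theorem integral_nevKernel_nevMeasure (ω : Measure ℝ) [IsFiniteMeasure ω] {z : ℂ}
    (hz : z.im ≠ 0) : ∫ t, nevKernel z t ∂(nevMeasure ω) =
      z * ω.real univ + (1 + z ^ 2) * ∫ t : ℝ, 1 / ((t : ℂ) - z) ∂ω := by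
  rw [integral_nevMeasure]
  simp only [one_add_sq_mul_nevKernel hz]
  rw [integral_add (integrable_const z) ((integrable_inv_sub hz).const_mul _),
    integral_const_mul, integral_const, Complex.real_smul]
  ring

theorem exists_nevMeasure_eq {μ : Measure ℝ}
    (h : Integrable (fun t : ℝ => 1 / (1 + t ^ 2)) μ) :
    ∃ ω : Measure ℝ, IsFiniteMeasure ω ∧ nevMeasure ω = μ := by
  refine ⟨μ.withDensity fun t => (ENNReal.ofReal (1 + t ^ 2))⁻¹, ?_, ?_⟩
  · refine isFiniteMeasure_withDensity ?_
    have h1 := h.lintegral_lt_top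
    refine ne_of_lt (lt_of_eq_of_lt (lintegral_congr fun t => ?_) h1)
    rw [one_div, ENNReal.ofReal_inv_of_pos (by positivity)]
  · have h2 := withDensity_inv_same₀ (μ := μ)
      (f := fun t : ℝ => (ENNReal.ofReal (1 + t ^ 2))⁻¹) measurable_one_add_sq.inv.aemeasurable
      (ae_of_all _ fun t => by simp) (ae_of_all _ fun t => by simp; positivity)
    simp only [inv_inv] at h2
    exact h2

/-- The measure in the Nevanlinna representation is unique. -/
theorem nevanlinna_ext {μ μ' : Measure ℝ}
    (h : Integrable (fun t : ℝ => 1 / (1 + t ^ 2)) μ)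
    (h' : Integrable (fun t : ℝ => 1 / (1 + t ^ 2)) μ')
    (heq : ∀ z : ℂ, z.im ≠ 0 → ∫ t, nevKernel z t ∂μ = ∫ t, nevKernel z t ∂μ') : μ = μ' := by
  obtain ⟨ω, hω, rfl⟩ := exists_nevMeasure_eq h
  obtain ⟨ω', hω', rfl⟩ := exists_nevMeasure_eq h'
  congr 1
  -- At z = i the factor 1 + z² vanishes, so this instance compares the total masses of ω and ω'.
  have hI := heq Complex.I (by simp)
  rw [integral_nevKernel_nevMeasure ω (by simp), integral_nevKernel_nevMeasure ω' (by simp)] at hI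
  simp at hI
  refine ext_of_integral_inv_sub fun z hz hz1 => ?_
  have hzne : z.im ≠ 0 := hz.ne'
  have h1 := heq z hzne
  rw [integral_nevKernel_nevMeasure ω hzne, integral_nevKernel_nevMeasure ω' hzne, hI] at h1
  have h2 : 1 + z ^ 2 ≠ 0 := by
    intro h0
    have h3 : (z - Complex.I) * (z + Complex.I) = 0 := by
      linear_combination h0 - Complex.I_sq
    rcases mul_eq_zero.1 h3 with h4 | h4
    · have := congrArg Complex.im h4; simp at this; linarith
    · have := congrArg Complex.im h4; simp at this; linarith
  exact mul_left_cancel₀ h2 (add_left_cancel h1)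

/-! ### Spectral measures of unitary operators -/

section SpectralMeasure

variable {E : Type*} [NormedAddCommGroup E] [InnerProductSpace ℂ E] [CompleteSpace E]

/-- A continuous real-valued function, regarded as complex-valued. -/
def ofRealMap {X : Type*} [TopologicalSpace X] (f : C(X, ℝ)) : C(X, ℂ) :=
  ⟨fun x => (f x : ℂ), Complex.continuous_ofReal.comp f.continuous⟩

theorem cfcHom_ofRealMap_adjoint {U : E →L[ℂ] E} (hU : IsStarNormal U)
    (f : C(spectrum ℂ U, ℝ)) :
    ContinuousLinearMap.adjoint (cfcHom hU (ofRealMap f)) = cfcHom hU (ofRealMap f) := by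
  rw [← ContinuousLinearMap.star_eq_adjoint, ← map_star]
  congr 1
  ext x
  simp [ofRealMap]

theorem inner_cfcHom_ofRealMap_im {U : E →L[ℂ] E} (hU : IsStarNormal U) (w : E)
    (f : C(spectrum ℂ U, ℝ)) : (inner ℂ w (cfcHom hU (ofRealMap f) w)).im = 0 := by
  rw [← Complex.conj_eq_iff_im, inner_conj_symm, ← ContinuousLinearMap.adjoint_inner_right,
    cfcHom_ofRealMap_adjoint]

/-- The positive functional `f ↦ ⟨w, f(U) w⟩` on continuous functions on the spectrum of `U`. -/
noncomputable def spectralFunctional {U : E →L[ℂ] E} (hU : IsStarNormal U) (w : E) :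
    CompactlySupportedContinuousMap (spectrum ℂ U) ℝ →ₚ[ℝ] ℝ :=
  PositiveLinearMap.mk₀
    { toFun := fun f => (inner ℂ w (cfcHom hU (ofRealMap f.toContinuousMap) w)).re
      map_add' := fun f g => by
        have : ofRealMap (f + g).toContinuousMap =
            ofRealMap f.toContinuousMap + ofRealMap g.toContinuousMap := by
          ext x; simp [ofRealMap]
        rw [this, map_add, add_apply, inner_add_right, Complex.add_re]
      map_smul' := fun c f => by
        have : ofRealMap (c • f).toContinuousMap = (c : ℂ) • ofRealMap f.toContinuousMap := by
          ext x; simp [ofRealMap]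
        rw [this, map_smul, smul_apply, inner_smul_right, Complex.re_ofReal_mul]
        rfl }
    (fun f hf => by
      -- With r = √f, the value ⟨w, f(U)w⟩ equals ‖r(U)w‖², which is nonnegative.
      let r : C(spectrum ℂ U, ℝ) := ⟨fun x => √(f x), f.continuous.sqrt⟩
      have h1 : ofRealMap f.toContinuousMap = ofRealMap r * ofRealMap r := by
        ext x
        have h0 : 0 ≤ f x := hf x
        have h2 : f x = √(f x) * √(f x) := (Real.mul_self_sqrt h0).symm
        simp only [ofRealMap, r, ContinuousMap.coe_mk, ContinuousMap.mul_apply]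
        rw [← Complex.ofReal_mul]
        exact congrArg _ h2
      change 0 ≤ (inner ℂ w (cfcHom hU (ofRealMap f.toContinuousMap) w)).re
      rw [h1, map_mul]
      change 0 ≤ (inner ℂ w (cfcHom hU (ofRealMap r) (cfcHom hU (ofRealMap r) w))).re
      nth_rewrite 1 [← cfcHom_ofRealMap_adjoint hU r]
      rw [ContinuousLinearMap.adjoint_inner_right]
      exact inner_self_nonneg (𝕜 := ℂ))

/-- The spectral measure of a normal operator at a vector. -/
theorem exists_spectralMeasure {U : E →L[ℂ] E} (hU : IsStarNormal U) (w : E) :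
    ∃ ρ : Measure (spectrum ℂ U), IsFiniteMeasure ρ ∧
      ∀ f : C(spectrum ℂ U, ℂ), ∫ x, f x ∂ρ = inner ℂ w (cfcHom hU f w) := by
  have : CompactSpace (spectrum ℂ U) := ContinuousFunctionalCalculus.compactSpace_spectrum U
  set ρ := RealRMK.rieszMeasure (spectralFunctional hU w)
  have hfin : IsFiniteMeasure ρ :=
    ⟨(isCompact_univ : IsCompact (univ : Set (spectrum ℂ U))).measure_lt_top⟩
  refine ⟨ρ, hfin, fun f => ?_⟩
  have hreal (g : C(spectrum ℂ U, ℝ)) :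
      ∫ x, ((g x : ℝ) : ℂ) ∂ρ = inner ℂ w (cfcHom hU (ofRealMap g) w) := by
    have h := RealRMK.integral_rieszMeasure (spectralFunctional hU w)
      (CompactlySupportedContinuousMap.continuousMapEquiv g)
    rw [integral_complex_ofReal]
    apply Complex.ext
    · rw [Complex.ofReal_re]; exact h
    · rw [Complex.ofReal_im, inner_cfcHom_ofRealMap_im]
  let a : C(spectrum ℂ U, ℝ) := ⟨fun x => (f x).re, Complex.continuous_re.comp f.continuous⟩
  let b : C(spectrum ℂ U, ℝ) := ⟨fun x => (f x).im, Complex.continuous_im.comp f.continuous⟩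
  have hf : f = ofRealMap a + Complex.I • ofRealMap b := by
    ext x
    simp only [ofRealMap, a, b, ContinuousMap.add_apply, ContinuousMap.smul_apply,
      ContinuousMap.coe_mk, smul_eq_mul]
    rw [mul_comm]
    exact (Complex.re_add_im (f x)).symm
  have hint (g : C(spectrum ℂ U, ℝ)) : Integrable (fun x => ((g x : ℝ) : ℂ)) ρ :=
    (Complex.continuous_ofReal.comp g.continuous).integrable_of_hasCompactSupport
      (HasCompactSupport.of_compactSpace _)
  calc ∫ x, f x ∂ρ = ∫ x, (((a x : ℝ) : ℂ) + Complex.I * ((b x : ℝ) : ℂ)) ∂ρ := by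
        refine integral_congr_ae (ae_of_all _ fun x => ?_)
        beta_reduce
        nth_rewrite 1 [hf]
        simp [ofRealMap]
    _ = inner ℂ w (cfcHom hU (ofRealMap a) w) +
        Complex.I * inner ℂ w (cfcHom hU (ofRealMap b) w) := by
        rw [integral_add (hint a) ((hint b).const_mul _), integral_const_mul, hreal, hreal]
    _ = _ := by
        conv_rhs => rw [hf]
        rw [map_add, map_smul, add_apply, smul_apply, inner_add_right, inner_smul_right]

/-- An isometric densely defined map with dense range extends to a unitary operator. -/
theorem exists_unitary_of_dense {X : Type*} [AddCommGroup X] [Module ℂ X] (p p' : X →ₗ[ℂ] E)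
    (hp : DenseRange p) (hp' : DenseRange p') (h : ∀ x, ‖p x‖ = ‖p' x‖) :
    ∃ U : E →L[ℂ] E, U ∈ unitary (E →L[ℂ] E) ∧ ∀ x, U (p x) = p' x := by
  set U := p'.extendOfNorm p
  set V := p.extendOfNorm p'
  have hU (x : X) : U (p x) = p' x := LinearMap.extendOfNorm_eq hp ⟨1, fun x => by simp [h]⟩ x
  have hV (x : X) : V (p' x) = p x := LinearMap.extendOfNorm_eq hp' ⟨1, fun x => by simp [h]⟩ x
  have hUV (y : E) : U (V y) = y := by
    refine hp'.induction_on (p := fun y => U (V y) = y) y ?_ fun x => by rw [hV, hU]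
    exact isClosed_eq (by fun_prop) (by fun_prop)
  have hnorm (y : E) : ‖U y‖ = ‖y‖ := by
    refine hp.induction_on (p := fun y => ‖U y‖ = ‖y‖) y ?_ fun x => by rw [hU, h]
    exact isClosed_eq (by fun_prop) (by fun_prop)
  have h1 : star U * U = 1 := (ContinuousLinearMap.norm_map_iff_adjoint_comp_self U).1 hnorm
  have h2 : U * V = 1 := ContinuousLinearMap.ext fun y => hUV y
  have h3 : star U = V := by
    calc star U = star U * (U * V) := by rw [h2, mul_one]
      _ = V := by rw [← mul_assoc, h1, one_mul]
  exact ⟨U, Unitary.mem_iff.2 ⟨h1, by rw [h3, h2]⟩, hU⟩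

end SpectralMeasure

/-! ### Nevanlinna functions given by a positive kernel -/

section Kernel

variable {E : Type*} [NormedAddCommGroup E] [InnerProductSpace ℂ E]

/-- The kernel `(m(z) - conj m(w)) / (z - conj w)` is the Gram kernel of the family `W`. -/
def IsGramKernel (W : ℂ → E) (m : ℂ → ℂ) : Prop :=
  ∀ z w : ℂ, z.im ≠ 0 → w.im ≠ 0 → (z - star w) * inner ℂ (W w) (W z) = m z - star (m w)

variable {W : ℂ → E} {m : ℂ → ℂ}

/-- Combining the kernel identity at the four pairs from z and w eliminates m and leaves (z - conj
z)‖D‖² as a combination of ⟨W w, D⟩ and its conjugate with coefficients of modulus |z - w|.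
Cauchy–Schwarz finishes. -/
theorem IsGramKernel.norm_sub_le (h : IsGramKernel W m) {z w : ℂ} (hz : z.im ≠ 0)
    (hw : w.im ≠ 0) : |z.im| * ‖W z - W w‖ ≤ ‖z - w‖ * ‖W w‖ := by
  have e1 := h z z hz hz
  have e2 := h z w hz hw
  have e3 := h w z hw hz
  have e4 := h w w hw hw
  set D := W z - W w with hD
  have key : (z - star z) * inner ℂ D D =
      star (z - w) * inner ℂ (W w) D - (z - w) * inner ℂ D (W w) := by
    simp only [hD, inner_sub_left, inner_sub_right, star_sub]
    linear_combination e1 - e2 - e3 + e4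
  have hn := congrArg norm key
  have h1 : ‖z - star z‖ = 2 * |z.im| := by
    have : z - star z = ((2 * z.im : ℝ) : ℂ) * Complex.I := by
      apply Complex.ext <;> simp; ring
    rw [this, norm_mul, Complex.norm_real, Complex.norm_I, mul_one, Real.norm_eq_abs, abs_mul]
    simp
  have h2 : ‖inner ℂ D D‖ = ‖D‖ ^ 2 := by
    rw [inner_self_eq_norm_sq_to_K]; simp
  rw [norm_mul, h1, h2] at hn
  have h3 : ‖star (z - w) * inner ℂ (W w) D - (z - w) * inner ℂ D (W w)‖ ≤
      2 * (‖z - w‖ * ‖W w‖) * ‖D‖ := by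
    refine (_root_.norm_sub_le _ _).trans ?_
    rw [norm_mul, norm_mul, norm_star]
    have a1 := mul_le_mul_of_nonneg_left (norm_inner_le_norm (𝕜 := ℂ) (W w) D) (norm_nonneg (z - w))
    have a2 := mul_le_mul_of_nonneg_left (norm_inner_le_norm (𝕜 := ℂ) D (W w)) (norm_nonneg (z - w))
    linarith
  rcases eq_or_lt_of_le (norm_nonneg D) with h0 | h0
  · rw [← h0, mul_zero]; positivity
  · have : |z.im| * ‖D‖ * ‖D‖ ≤ ‖z - w‖ * ‖W w‖ * ‖D‖ := by nlinarith
    exact le_of_mul_le_mul_right this h0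

/-- W is continuous at w by `norm_sub_le`, and w is approached along its multiples (1 + 1/(n + 1))w.
So omitting one point does not reduce the closed span. -/
theorem IsGramKernel.mem_closure (h : IsGramKernel W m) {w : ℂ} (hw : w.im ≠ 0)
    (S : Submodule ℂ E) (hS : ∀ z, z.im ≠ 0 → z ≠ w → W z ∈ S) : W w ∈ closure (S : Set E) := by
  have hpos (n : ℕ) : (0 : ℝ) < 1 / ((n : ℝ) + 1) := by positivity
  let z (n : ℕ) : ℂ := (1 + 1 / ((n : ℝ) + 1) : ℝ) * w
  have him (n : ℕ) : (z n).im = (1 + 1 / ((n : ℝ) + 1)) * w.im := by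
    rw [← Complex.im_ofReal_mul]
  have hsub (n : ℕ) : z n - w = (1 / ((n : ℝ) + 1) : ℝ) * w := by
    simp only [z]; push_cast; ring
  have hw0 : w ≠ 0 := fun h => hw (by simp [h])
  have hz (n : ℕ) : (z n).im ≠ 0 := by
    rw [him]; exact mul_ne_zero (by linarith [hpos n]) hw
  have hne (n : ℕ) : z n ≠ w := by
    rw [← sub_ne_zero, hsub]
    exact mul_ne_zero (Complex.ofReal_ne_zero.2 (hpos n).ne') hw0
  refine mem_closure_of_tendsto (b := atTop) (f := fun n => W (z n)) ?_
    (Eventually.of_forall fun n => hS _ (hz n) (hne n))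
  rw [tendsto_iff_norm_sub_tendsto_zero]
  have hb (n : ℕ) : ‖W (z n) - W w‖ ≤ 1 / ((n : ℝ) + 1) * (‖w‖ * ‖W w‖ / |w.im|) := by
    have h1 := h.norm_sub_le (hz n) hw
    rw [hsub, norm_mul, Complex.norm_real, Real.norm_of_nonneg (hpos n).le, him, abs_mul,
      abs_of_pos (by linarith [hpos n] : (0 : ℝ) < 1 + 1 / ((n : ℝ) + 1))] at h1
    have hwp : 0 < |w.im| := abs_pos.2 hw
    rw [← mul_div_assoc, le_div_iff₀ hwp]
    have h2 : 0 ≤ 1 / ((n : ℝ) + 1) * (|w.im| * ‖W (z n) - W w‖) := by positivity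
    nlinarith
  refine squeeze_zero (fun n => norm_nonneg _) hb ?_
  simpa using tendsto_one_div_add_atTop_nhds_zero_nat.mul_const (‖w‖ * ‖W w‖ / |w.im|)

/-- The Cayley transform of the multiplication relation underlying a Gram kernel. -/
theorem IsGramKernel.exists_unitary [CompleteSpace E] (h : IsGramKernel W m)
    (hd : Dense (Submodule.span ℂ (W '' {z | z.im ≠ 0}) : Set E)) :
    ∃ U : E →L[ℂ] E, U ∈ unitary (E →L[ℂ] E) ∧ ∀ z : ℂ, z.im ≠ 0 →
      U ((z - Complex.I) • W z) = (z + Complex.I) • W z - (2 * Complex.I) • W Complex.I := by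
  let a (z : {z : ℂ // z.im ≠ 0}) : E := ((z : ℂ) - Complex.I) • W z
  let b (z : {z : ℂ // z.im ≠ 0}) : E :=
    ((z : ℂ) + Complex.I) • W z - (2 * Complex.I) • W Complex.I
  -- The map a(z) ↦ b(z) preserves inner products: m cancels between the kernel identities at (z,
  -- w), (i, w), (z, i) and (i, i).
  have hab (w z : {z : ℂ // z.im ≠ 0}) : inner ℂ (a w) (a z) = inner ℂ (b w) (b z) := by
    have e1 := h z w z.2 w.2
    have e2 := h Complex.I w (by simp) w.2
    have e3 := h z Complex.I z.2 (by simp)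
    have e4 := h Complex.I Complex.I (by simp) (by simp)
    simp only [Complex.star_def, Complex.conj_I] at e1 e2 e3 e4
    simp only [a, b, inner_sub_left, inner_sub_right, inner_smul_left, inner_smul_right, map_sub,
      map_add, map_mul, Complex.conj_I, Complex.conj_ofNat]
    linear_combination 2 * Complex.I * e1 - 2 * Complex.I * e2 - 2 * Complex.I * e3
      + 2 * Complex.I * e4
  let p := Finsupp.linearCombination ℂ a
  let p' := Finsupp.linearCombination ℂ b
  have hin (x : {z : ℂ // z.im ≠ 0} →₀ ℂ) : inner ℂ (p x) (p x) = inner ℂ (p' x) (p' x) := by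
    simp only [p, p', Finsupp.linearCombination_apply, Finsupp.sum, sum_inner, inner_sum,
      inner_smul_left, inner_smul_right, hab]
  have hnorm (x : {z : ℂ // z.im ≠ 0} →₀ ℂ) : ‖p x‖ = ‖p' x‖ := by
    have h1 := hin x
    rw [inner_self_eq_norm_sq_to_K, inner_self_eq_norm_sq_to_K] at h1
    have h2 : ‖p x‖ ^ 2 = ‖p' x‖ ^ 2 := by exact_mod_cast h1
    exact (pow_left_inj₀ (norm_nonneg _) (norm_nonneg _) two_ne_zero).1 h2
  have hdense (S : Submodule ℂ E) (w : ℂ) (hw : w.im ≠ 0)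
      (hS : ∀ z, z.im ≠ 0 → z ≠ w → W z ∈ S) : Dense (S : Set E) := by
    have h1 : Submodule.span ℂ (W '' {z | z.im ≠ 0}) ≤ S.topologicalClosure := by
      rw [Submodule.span_le]
      rintro _ ⟨z, hz, rfl⟩
      by_cases hzw : z = w
      · rw [hzw]; exact h.mem_closure hw S hS
      · exact S.le_topologicalClosure (hS z hz hzw)
    have h2 : Dense (S.topologicalClosure : Set E) := hd.mono h1
    rw [Submodule.topologicalClosure_coe] at h2
    exact dense_closure.1 h2
  have hp : DenseRange p := by
    have := hdense (LinearMap.range p) Complex.I (by simp) fun z hz hzi =>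
      ⟨Finsupp.single ⟨z, hz⟩ (z - Complex.I)⁻¹, by
        simp [p, a, smul_smul, inv_mul_cancel₀ (sub_ne_zero.2 hzi)]⟩
    rwa [LinearMap.coe_range] at this
  -- At z = -i, b is -2i W(i), so W(i) is in the range; then b(z) yields W(z) for every nonreal z ≠
  -- -i.
  have hp' : DenseRange p' := by
    have hI : W Complex.I ∈ LinearMap.range p' :=
      ⟨Finsupp.single ⟨-Complex.I, by simp⟩ (-(2 * Complex.I)⁻¹), by
        simp only [p', Finsupp.linearCombination_single, b, neg_add_cancel, zero_smul, zero_sub,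
          smul_neg, smul_smul]
        rw [neg_mul, inv_mul_cancel₀ (by simp), neg_smul, one_smul, neg_neg]⟩
    have := hdense (LinearMap.range p') (-Complex.I) (by simp) fun z hz hzi => by
      have hne : z + Complex.I ≠ 0 := fun h0 => hzi (eq_neg_of_add_eq_zero_left h0)
      have h1 : b ⟨z, hz⟩ ∈ LinearMap.range p' := ⟨Finsupp.single ⟨z, hz⟩ 1, by simp [p']⟩
      have h2 := (LinearMap.range p').add_mem h1
        ((LinearMap.range p').smul_mem (2 * Complex.I) hI)
      have h3 := (LinearMap.range p').smul_mem (z + Complex.I)⁻¹ h2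
      simpa [b, smul_smul, inv_mul_cancel₀ hne] using h3
    rwa [LinearMap.coe_range] at this
  obtain ⟨U, hU, hUp⟩ := exists_unitary_of_dense p p' hp hp' hnorm
  refine ⟨U, hU, fun z hz => ?_⟩
  simpa [p, p', a, b] using hUp (Finsupp.single ⟨z, hz⟩ 1)

end Kernel

/-! ### From the Cayley transform to the Nevanlinna representation -/

section Nevanlinna

variable {E : Type*} [NormedAddCommGroup E] [InnerProductSpace ℂ E] [CompleteSpace E]
variable {W : ℂ → E} {m : ℂ → ℂ}

/-- The denominator `z (1 - u) + i (1 + u)` of the Cayley transform does not vanish on the unit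
circle. -/
theorem cayleyDenom_ne_zero {z u : ℂ} (hz : z.im ≠ 0) (hu : ‖u‖ = 1) :
    z * (1 - u) + Complex.I * (1 + u) ≠ 0 := by
  intro h
  have h1 : z + Complex.I = (z - Complex.I) * u := by linear_combination h
  have h2 := congrArg (fun x => ‖x‖ ^ 2) h1
  simp only [norm_mul, hu, mul_one, Complex.sq_norm, Complex.normSq_apply, Complex.add_re,
    Complex.add_im, Complex.sub_re, Complex.sub_im, Complex.I_re, Complex.I_im] at h2
  exact hz (by nlinarith)

/-- The real number corresponding to a point of the unit circle under the Cayley transform. -/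
noncomputable def cayleyReal (u : ℂ) : ℝ := (Complex.I * (u + 1) / (u - 1)).re

theorem coe_cayleyReal {u : ℂ} (hu : ‖u‖ = 1) :
    (cayleyReal u : ℂ) = Complex.I * (u + 1) / (u - 1) := by
  have h0 : u ≠ 0 := by rintro rfl; simp at hu
  refine Complex.conj_eq_iff_re.1 ?_
  have hc : (starRingEnd ℂ) u = u⁻¹ := (Complex.inv_eq_conj hu).symm
  simp only [map_div₀, map_mul, map_add, map_sub, map_one, Complex.conj_I, hc]
  by_cases h1 : u = 1
  · simp [h1]
  have h2 : u - 1 ≠ 0 := sub_ne_zero.2 h1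
  have h3 : u⁻¹ - 1 ≠ 0 := sub_ne_zero.2 fun h => h1 (by simpa using congrArg (·⁻¹) h)
  rw [div_eq_div_iff h3 h2]
  field_simp
  ring

theorem two_I_div_cayleyDenom {z u : ℂ} (hz : z.im ≠ 0) (hu : ‖u‖ = 1) (h1 : u ≠ 1) :
    2 * Complex.I / (z * (1 - u) + Complex.I * (1 + u)) =
      ((cayleyReal u : ℂ) - Complex.I) / ((cayleyReal u : ℂ) - z) := by
  rw [div_eq_div_iff (cayleyDenom_ne_zero hz hu) (ofReal_sub_ne_zero hz _), coe_cayleyReal hu]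
  have h2 : u - 1 ≠ 0 := sub_ne_zero.2 h1
  field_simp
  ring

theorem two_le_norm_cayleyDenom {y : ℝ} (hy : 1 ≤ y) {u : ℂ} (hu : ‖u‖ = 1) :
    2 ≤ ‖(y * Complex.I) * (1 - u) + Complex.I * (1 + u)‖ := by
  have h1 : (y * Complex.I) * (1 - u) + Complex.I * (1 + u) =
      Complex.I * (((y + 1 : ℝ) : ℂ) - ((y - 1 : ℝ) : ℂ) * u) := by push_cast; ring
  rw [h1, norm_mul, Complex.norm_I, one_mul]
  have h2 := norm_sub_norm_le ((y + 1 : ℝ) : ℂ) (((y - 1 : ℝ) : ℂ) * u)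
  rw [norm_mul, hu, Complex.norm_real, Complex.norm_real, mul_one,
    Real.norm_of_nonneg (by linarith), Real.norm_of_nonneg (by linarith)] at h2
  linarith

/-- The point u = 1 corresponds to t = ∞; this limit isolates its mass. -/
theorem tendsto_two_I_div_cayleyDenom {u : ℂ} :
    Tendsto (fun y : ℝ => 2 * Complex.I / ((y * Complex.I) * (1 - u) + Complex.I * (1 + u))) atTop
      (𝓝 (Set.indicator {1} (fun _ => 1) u)) := by
  by_cases h1 : u = 1
  · subst h1
    have h2 : 2 * Complex.I / (Complex.I * (1 + 1)) = 1 := by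
      rw [div_eq_one_iff_eq (by norm_num)]; ring
    simp [h2]
  · rw [indicator_of_notMem (by simpa using h1)]
    simp only [div_eq_mul_inv]
    rw [← mul_zero (2 * Complex.I)]
    refine tendsto_const_nhds.mul (tendsto_inv₀_cobounded.comp ?_)
    rw [← tendsto_norm_atTop_iff_cobounded]
    refine tendsto_atTop_mono (f := fun y : ℝ => y * ‖1 - u‖ - ‖1 + u‖) (fun y => ?_) ?_
    · have h2 := norm_sub_le_norm_add ((y * Complex.I) * (1 - u)) (Complex.I * (1 + u))
      simp only [norm_mul, Complex.norm_I, Complex.norm_real, mul_one, one_mul,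
        Real.norm_eq_abs] at h2
      have h3 := mul_le_mul_of_nonneg_right (le_abs_self y) (norm_nonneg (1 - u))
      linarith
    · exact tendsto_atTop_add_const_right _ _
        (tendsto_id.atTop_mul_const (norm_pos_iff.2 (sub_ne_zero.2 (Ne.symm h1))))

/-- The defining relation of U rearranges to d(U)W(z) = 2i W(i) with d(u) = z(1 - u) + i(1 + u).
Since d has no zero on the unit circle, W(z) = (2i/d)(U)W(i), and the spectral measure of U at W(i)
applies. -/
theorem IsGramKernel.exists_circleMeasure (h : IsGramKernel W m)
    (hd : Dense (Submodule.span ℂ (W '' {z | z.im ≠ 0}) : Set E)) :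
    ∃ (σ : Set ℂ) (ρ : Measure σ), IsFiniteMeasure ρ ∧ (∀ u ∈ σ, ‖u‖ = 1) ∧
      ∀ z : ℂ, z.im ≠ 0 → inner ℂ (W Complex.I) (W z) =
        ∫ u : σ, 2 * Complex.I / (z * (1 - (u : ℂ)) + Complex.I * (1 + (u : ℂ))) ∂ρ := by
  obtain ⟨U, hU, hUW⟩ := h.exists_unitary hd
  have hn : IsStarNormal U := ⟨(Unitary.mem_iff.1 hU).1.trans (Unitary.mem_iff.1 hU).2.symm⟩
  have hs (u : ℂ) (hu : u ∈ spectrum ℂ U) : ‖u‖ = 1 := by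
    simpa using spectrum.subset_circle_of_unitary hU hu
  obtain ⟨ρ, hρ, hint⟩ := exists_spectralMeasure hn (W Complex.I)
  refine ⟨spectrum ℂ U, ρ, hρ, hs, fun z hz => ?_⟩
  let d : C(spectrum ℂ U, ℂ) :=
    ⟨fun u => z * (1 - (u : ℂ)) + Complex.I * (1 + (u : ℂ)), by fun_prop⟩
  have hd0 (u : spectrum ℂ U) : d u ≠ 0 := cayleyDenom_ne_zero hz (hs u u.2)
  let g : C(spectrum ℂ U, ℂ) := ⟨fun u => 2 * Complex.I / d u,
    continuous_const.div d.continuous hd0⟩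
  have hgd : g * d = algebraMap ℂ C(spectrum ℂ U, ℂ) (2 * Complex.I) := by
    ext u
    exact div_mul_cancel₀ _ (hd0 u)
  have hdU : cfcHom hn d (W z) = (2 * Complex.I) • W Complex.I := by
    have h1 : d = algebraMap ℂ C(spectrum ℂ U, ℂ) (z + Complex.I) -
        (z - Complex.I) • ((ContinuousMap.id ℂ).restrict (spectrum ℂ U)) := by
      ext u
      simp [d]
      ring
    rw [h1, map_sub, map_smul, cfcHom_id, AlgHomClass.commutes]
    have h2 := hUW z hz
    rw [map_smul] at h2
    simp only [sub_apply, smul_apply, Algebra.algebraMap_eq_smul_one, one_apply_eq_self]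
    rw [h2]
    abel
  have hgW : cfcHom hn g (W Complex.I) = W z := by
    have h1 : cfcHom hn (g * d) (W z) = (2 * Complex.I) • W z := by
      rw [hgd, AlgHomClass.commutes, Algebra.algebraMap_eq_smul_one, smul_apply,
        one_apply_eq_self]
    rw [map_mul, mul_apply_eq_comp, hdU, map_smul] at h1
    exact smul_right_injective E (by simp : 2 * Complex.I ≠ 0) h1
  rw [← hgW, ← hint]
  rfl

theorem IsGramKernel.exists_measure_of_dense (h : IsGramKernel W m)
    (hd : Dense (Submodule.span ℂ (W '' {z | z.im ≠ 0}) : Set E))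
    (h0 : Tendsto (fun y : ℝ => inner ℂ (W Complex.I) (W (y * Complex.I))) atTop (𝓝 0)) :
    ∃ ω : Measure ℝ, IsFiniteMeasure ω ∧ ∀ z : ℂ, z.im ≠ 0 →
      m z - ((m Complex.I).re : ℂ) = ∫ t, nevKernel z t ∂(nevMeasure ω) := by
  obtain ⟨σ, ρ, hρ, hs, hint⟩ := h.exists_circleMeasure hd
  have hlim : Tendsto (fun y : ℝ => inner ℂ (W Complex.I) (W (y * Complex.I))) atTop
      (𝓝 (∫ u : σ, Set.indicator {1} (fun _ => (1 : ℂ)) (u : ℂ) ∂ρ)) := by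
    have h1 : Tendsto (fun y : ℝ => ∫ u : σ, 2 * Complex.I /
        ((y * Complex.I) * (1 - (u : ℂ)) + Complex.I * (1 + (u : ℂ))) ∂ρ) atTop
        (𝓝 (∫ u : σ, Set.indicator {1} (fun _ => (1 : ℂ)) (u : ℂ) ∂ρ)) := by
      refine tendsto_integral_filter_of_dominated_convergence (fun _ => 1) ?_ ?_
        (integrable_const _) (ae_of_all _ fun u => tendsto_two_I_div_cayleyDenom)
      · exact Eventually.of_forall fun y => Measurable.aestronglyMeasurable (by fun_prop)
      · filter_upwards [eventually_ge_atTop 1] with y hy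
        refine ae_of_all _ fun u => ?_
        have h2 := two_le_norm_cayleyDenom hy (hs u u.2)
        rw [norm_div, div_le_one (by linarith)]
        simpa using h2
    refine h1.congr' ?_
    filter_upwards [eventually_ge_atTop 1] with y hy
    rw [hint _ (by simp; linarith)]
  -- The mass at u = 1 is the limit of ⟨W(i), W(iy)⟩, which is zero by hypothesis. Off that point
  -- the Cayley transform to the line is valid; its value at u = 1, given by division by zero, is
  -- irrelevant.
  have hne : ∀ᵐ u : σ ∂ρ, (u : ℂ) ≠ 1 := by
    have h1 := tendsto_nhds_unique hlim h0
    have hm : MeasurableSet {u : σ | (u : ℂ) = 1} := measurable_subtype_coe (measurableSet_singleton 1)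
    have h2 : (fun u : σ => Set.indicator {1} (fun _ => (1 : ℂ)) (u : ℂ)) =
        Set.indicator {u : σ | (u : ℂ) = 1} fun _ => (1 : ℂ) := by
      ext u; simp [indicator_apply]
    rw [h2, integral_indicator_const _ hm] at h1
    have h3 : ρ.real {u : σ | (u : ℂ) = 1} = 0 := by simpa using h1
    rw [measureReal_eq_zero_iff] at h3
    simpa [ae_iff] using h3
  have hτ : Measurable fun u : σ => cayleyReal u := by unfold cayleyReal; fun_prop
  let ω := ρ.map fun u : σ => cayleyReal u
  have hω : IsFiniteMeasure ω := inferInstance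
  have hinner (z : ℂ) (hz : z.im ≠ 0) : m z - star (m Complex.I) =
      (z + Complex.I) * ω.real univ + (1 + z ^ 2) * ∫ t : ℝ, 1 / ((t : ℂ) - z) ∂ω := by
    have h1 := h z Complex.I hz (by simp)
    rw [hint z hz, Complex.star_def, Complex.conj_I, sub_neg_eq_add] at h1
    have h2 : ∫ u : σ, 2 * Complex.I / (z * (1 - (u : ℂ)) + Complex.I * (1 + (u : ℂ))) ∂ρ =
        ∫ t : ℝ, ((t : ℂ) - Complex.I) / ((t : ℂ) - z) ∂ω := by
      rw [integral_map hτ.aemeasurable (Measurable.aestronglyMeasurable (by fun_prop))]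
      refine integral_congr_ae ?_
      filter_upwards [hne] with u hu
      exact two_I_div_cayleyDenom hz (hs u u.2) hu
    rw [← Complex.star_def, h2, ← integral_const_mul] at h1
    rw [← h1]
    have h3 (t : ℝ) : (z + Complex.I) * (((t : ℂ) - Complex.I) / ((t : ℂ) - z)) =
        (z + Complex.I) + (1 + z ^ 2) * (1 / ((t : ℂ) - z)) := by
      have := ofReal_sub_ne_zero hz t
      field_simp
      linear_combination -Complex.I_sq
    simp only [h3]
    rw [integral_add (integrable_const _) ((integrable_inv_sub hz).const_mul _),
      integral_const_mul, integral_const, Complex.real_smul]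
    ring
  refine ⟨ω, hω, fun z hz => ?_⟩
  rw [integral_nevKernel_nevMeasure ω hz]
  have e1 := hinner z hz
  -- At z = i this reads Im m(i) = ω(ℝ), which converts conj m(i) into Re m(i) - iω(ℝ).
  have e2 := hinner Complex.I (by simp)
  rw [Complex.I_sq] at e2
  have e3 := congrArg Complex.im e2
  simp at e3
  have e4 : star (m Complex.I) = ((m Complex.I).re : ℂ) - Complex.I * ω.real univ := by
    apply Complex.ext
    · simp
    · simp; linarith
  rw [e4] at e1
  linear_combination e1

/-- A function with a positive kernel is given by a Nevanlinna representation. -/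
theorem IsGramKernel.exists_measure (h : IsGramKernel W m)
    (h0 : Tendsto (fun y : ℝ => inner ℂ (W Complex.I) (W (y * Complex.I))) atTop (𝓝 0)) :
    ∃ ω : Measure ℝ, IsFiniteMeasure ω ∧ ∀ z : ℂ, z.im ≠ 0 →
      m z - ((m Complex.I).re : ℂ) = ∫ t, nevKernel z t ∂(nevMeasure ω) := by
  classical
  -- Restricting to the closed span secures density; the value 0 of V at real points is never used.
  let K := (Submodule.span ℂ (W '' {z | z.im ≠ 0})).topologicalClosure
  have hK (z : ℂ) (hz : z.im ≠ 0) : W z ∈ K :=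
    Submodule.le_topologicalClosure _ (Submodule.subset_span (mem_image_of_mem W hz))
  have : CompleteSpace K := (Submodule.isClosed_topologicalClosure _).completeSpace_coe
  let V (z : ℂ) : K := if hz : z.im ≠ 0 then ⟨W z, hK z hz⟩ else 0
  have hV (z : ℂ) (hz : z.im ≠ 0) : (V z : E) = W z := by simp only [V, dif_pos hz]
  have hg : IsGramKernel V m := fun z w hz hw => by
    rw [Submodule.coe_inner, hV z hz, hV w hw]; exact h z w hz hw
  refine hg.exists_measure_of_dense ?_ (h0.congr' ?_)
  · intro x
    have hx : (x : E) ∈ closure (Submodule.span ℂ (W '' {z | z.im ≠ 0}) : Set E) := x.2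
    rw [closure_subtype]
    convert hx using 2
    rw [← K.coe_subtype, ← Submodule.map_coe, Submodule.map_span, image_image]
    congr 2
    exact image_congr fun z hz => hV z hz
  · filter_upwards [eventually_gt_atTop 0] with y hy
    rw [Submodule.coe_inner, hV _ (by simp), hV _ (by simp; exact hy.ne')]

end Nevanlinna

/-! ### The Weyl solutions tend weakly to zero along the imaginary axis -/

/-- The Hilbert space `L²((0, ∞); ℂ²)`. -/
abbrev HalfLineL2 : Type :=
  WithLp 2 (Lp ℂ 2 (volume.restrict (Ioi (0 : ℝ))) × Lp ℂ 2 (volume.restrict (Ioi (0 : ℝ))))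

/-- The element of `L²((0, ∞); ℂ²)` with the components `f` and `g`. -/
noncomputable def pairL2 {f g : ℝ → ℂ} (hf : MemLp f 2 (volume.restrict (Ioi (0 : ℝ))))
    (hg : MemLp g 2 (volume.restrict (Ioi (0 : ℝ)))) : HalfLineL2 :=
  WithLp.toLp 2 (hf.toLp f, hg.toLp g)

section

variable {f g u v : ℝ → ℂ} (hf : MemLp f 2 (volume.restrict (Ioi (0 : ℝ))))
  (hg : MemLp g 2 (volume.restrict (Ioi (0 : ℝ)))) (hu : MemLp u 2 (volume.restrict (Ioi (0 : ℝ))))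
  (hv : MemLp v 2 (volume.restrict (Ioi (0 : ℝ))))

theorem inner_toLp_halfLine : inner ℂ (hf.toLp f) (hu.toLp u) =
    ∫ x in Ioi (0 : ℝ), star (f x) * u x := by
  rw [L2.inner_def]
  refine integral_congr_ae ?_
  filter_upwards [hf.coeFn_toLp, hu.coeFn_toLp] with x h1 h2
  rw [h1, h2, RCLike.inner_apply, mul_comm]
  rfl

theorem inner_pairL2 : inner ℂ (pairL2 hf hg) (pairL2 hu hv) =
    ∫ x in Ioi (0 : ℝ), (star (f x) * u x + star (g x) * v x) := by
  rw [WithLp.prod_inner_apply]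
  simp only [pairL2]
  rw [inner_toLp_halfLine hf hu, inner_toLp_halfLine hg hv, integral_add]
  · exact hf.star.integrable_mul hu
  · exact hg.star.integrable_mul hv

end

theorem hasSecondDeriv_of_contDiff {F : ℝ → ℂ} (hF : ContDiff ℝ 2 F) :
    HasSecondDeriv F (deriv F) (deriv (deriv F)) := by
  have h1 : ContDiff ℝ 1 (deriv F) :=
    (contDiff_succ_iff_deriv (n := 1) (f := F)).1 hF |>.2.2
  have c2 : Continuous (deriv (deriv F)) := h1.continuous_deriv le_rfl
  refine HasSecondDeriv.of_integral_eq h1.continuous (fun a b => c2.intervalIntegrable a b) ?_ ?_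
  · intro x _
    rw [intervalIntegral.integral_deriv_eq_sub
      (fun t _ => (hF.differentiable (by norm_num)).differentiableAt)
      (h1.continuous.intervalIntegrable _ _)]
    ring
  · intro x _
    rw [intervalIntegral.integral_deriv_eq_sub
      (fun t _ => (h1.differentiable (by norm_num)).differentiableAt)
      (c2.intervalIntegrable _ _)]
    ring

/-- A smooth function with compact support in `(0, ∞)`. -/
structure IsHalfLineTest (φ : ℝ → ℝ) : Prop where
  contDiff : ContDiff ℝ 2 φ
  hasCompactSupport : HasCompactSupport φ
  tsupport_subset : tsupport φ ⊆ Ioi 0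

namespace IsHalfLineTest

variable {φ : ℝ → ℝ} (h : IsHalfLineTest φ)
include h

theorem contDiff_coe : ContDiff ℝ 2 fun x => (φ x : ℂ) :=
  Complex.ofRealCLM.contDiff.comp h.contDiff

theorem hasCompactSupport_coe : HasCompactSupport fun x => (φ x : ℂ) :=
  h.hasCompactSupport.comp_left (g := fun x : ℝ => (x : ℂ)) Complex.ofReal_zero

theorem tsupport_coe : tsupport (fun x => (φ x : ℂ)) ⊆ Ioi 0 :=
  (tsupport_comp_subset (g := fun x : ℝ => (x : ℂ)) Complex.ofReal_zero φ).trans h.tsupport_subset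

theorem memLp : MemLp (fun x => (φ x : ℂ)) 2 (volume.restrict (Ioi (0 : ℝ))) :=
  (h.contDiff_coe.continuous.memLp_of_hasCompactSupport h.hasCompactSupport_coe).restrict _

theorem memLp_deriv_deriv :
    MemLp (deriv (deriv fun x => (φ x : ℂ))) 2 (volume.restrict (Ioi (0 : ℝ))) :=
  ((((contDiff_succ_iff_deriv (n := 1)).1 h.contDiff_coe).2.2.continuous_deriv
    le_rfl).memLp_of_hasCompactSupport h.hasCompactSupport_coe.deriv.deriv).restrict _

theorem apply_zero : (φ 0 : ℂ) = 0 :=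
  image_eq_zero_of_notMem_tsupport (f := fun x => (φ x : ℂ)) fun h0 =>
    lt_irrefl (0 : ℝ) (h.tsupport_coe h0)

theorem deriv_zero : deriv (fun x => (φ x : ℂ)) 0 = 0 :=
  image_eq_zero_of_notMem_tsupport fun h0 =>
    lt_irrefl (0 : ℝ) (h.tsupport_coe (tsupport_deriv_subset h0))

/-- The weak form of the equation `-f'' + p f = z g`. -/
theorem mul_integral {z : ℂ} {p f g f₁ : ℝ → ℂ}
    (hp : MemLp p ⊤ (volume.restrict (Ioi (0 : ℝ))))
    (hs : HasSecondDeriv f f₁ fun x => p x * f x - z * g x)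
    (hf : MemLp f 2 (volume.restrict (Ioi (0 : ℝ))))
    (hg : MemLp g 2 (volume.restrict (Ioi (0 : ℝ)))) :
    z * ∫ x in Ioi (0 : ℝ), star (φ x : ℂ) * g x =
      ∫ x in Ioi (0 : ℝ), star (star (p x) * (φ x : ℂ) -
        star (deriv (deriv fun x => (φ x : ℂ)) x)) * f x := by
  have hG := (hasSecondDeriv_of_contDiff h.contDiff_coe).green_Ioi hs h.memLp h.memLp_deriv_deriv
    hf (IsVecSolution.memLp_second hp z hf hg)
  rw [h.apply_zero, h.deriv_zero] at hG
  have hi1 : IntegrableOn (fun x => star (φ x : ℂ) * g x) (Ioi 0) :=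
    h.memLp.star.integrable_mul hg
  have hi2 : IntegrableOn (fun x => (φ x : ℂ) * (p x * f x - z * g x) -
      deriv (deriv fun x => (φ x : ℂ)) x * f x) (Ioi 0) :=
    (h.memLp.integrable_mul (IsVecSolution.memLp_second hp z hf hg)).sub
      (h.memLp_deriv_deriv.integrable_mul hf)
  rw [← integral_const_mul]
  have e : ∫ x in Ioi (0 : ℝ), star (star (p x) * (φ x : ℂ) -
        star (deriv (deriv fun x => (φ x : ℂ)) x)) * f x =
      ∫ x in Ioi (0 : ℝ), (((φ x : ℂ) * (p x * f x - z * g x) -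
        deriv (deriv fun x => (φ x : ℂ)) x * f x) + z * (star (φ x : ℂ) * g x)) := by
    refine integral_congr_ae (ae_of_all _ fun x => ?_)
    simp
    ring
  rw [e, integral_add hi2 (hi1.const_mul z), hG]
  ring

end IsHalfLineTest

theorem ae_eq_zero_of_forall_test {f : ℝ → ℂ} (hf : MemLp f 2 (volume.restrict (Ioi (0 : ℝ))))
    (h : ∀ φ, IsHalfLineTest φ → ∫ x in Ioi (0 : ℝ), star (φ x : ℂ) * f x = 0) :
    f =ᵐ[volume.restrict (Ioi (0 : ℝ))] 0 := by
  have h1 : LocallyIntegrableOn f (Ioi 0) := by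
    refine LocallyIntegrableOn.mono_set (s := univ ∩ Ioi 0) ?_ (by simp)
    rw [univ_inter]
    exact locallyIntegrableOn_of_locallyIntegrable_restrict (hf.locallyIntegrable (by norm_num))
  have h2 := isOpen_Ioi.ae_eq_zero_of_integral_contDiff_smul_eq_zero h1 fun φ h1 h2 h3 => by
    have h4 := h φ ⟨h1.of_le (WithTop.coe_le_coe.2 (le_top : (2 : ℕ∞) ≤ ⊤)), h2, h3⟩
    rw [← h4, setIntegral_eq_integral_of_forall_compl_eq_zero]
    · refine integral_congr_ae (ae_of_all _ fun x => ?_)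
      simp
    · intro x hx
      rw [image_eq_zero_of_notMem_tsupport fun h5 => hx (h3 h5)]
      simp
  exact (ae_restrict_iff' measurableSet_Ioi).2 h2

/-- A bounded family tends weakly to zero if it does so against a set with trivial orthogonal
complement. -/
theorem tendsto_inner_of_forall_mem {E ι : Type*} [NormedAddCommGroup E] [InnerProductSpace ℂ E]
    [CompleteSpace E] {l : Filter ι} {w : ι → E} {C : ℝ} (hC : ∀ᶠ i in l, ‖w i‖ ≤ C) (D : Set E)
    (hD : ∀ x, (∀ d ∈ D, inner ℂ d x = 0) → x = 0)
    (h : ∀ d ∈ D, Tendsto (fun i => inner ℂ d (w i)) l (𝓝 0)) (x : E) :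
    Tendsto (fun i => inner ℂ x (w i)) l (𝓝 0) := by
  have hspan (s : E) (hs : s ∈ Submodule.span ℂ D) :
      Tendsto (fun i => inner ℂ s (w i)) l (𝓝 0) := by
    induction hs using Submodule.span_induction with
    | mem s hs => exact h s hs
    | zero => simpa using tendsto_const_nhds
    | add s t _ _ h1 h2 => simpa [inner_add_left] using h1.add h2
    | smul c s _ h1 => simpa [inner_smul_left, mul_comm] using h1.const_mul ((starRingEnd ℂ) c)
  have htop : (Submodule.span ℂ D).topologicalClosure = ⊤ := by
    rw [Submodule.topologicalClosure_eq_top_iff, Submodule.eq_bot_iff]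
    exact fun y hy => hD y fun d hd =>
      (Submodule.mem_orthogonal _ _).1 hy d (Submodule.subset_span hd)
  have hx : x ∈ closure (Submodule.span ℂ D : Set E) := by
    rw [← Submodule.topologicalClosure_coe, htop]; trivial
  rw [Metric.tendsto_nhds]
  intro ε hε
  obtain ⟨s, hs, hxs⟩ := Metric.mem_closure_iff.1 hx (ε / (2 * (|C| + 1))) (by positivity)
  filter_upwards [Metric.tendsto_nhds.1 (hspan s hs) (ε / 2) (by positivity), hC] with i h1 h2
  rw [dist_zero_right] at h1 ⊢
  have h3 : ‖inner ℂ (x - s) (w i)‖ ≤ ε / 2 := by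
    refine (norm_inner_le_norm _ _).trans ?_
    rw [dist_eq_norm, lt_div_iff₀ (by positivity)] at hxs
    have h4 : ‖w i‖ ≤ |C| + 1 := by linarith [le_abs_self C]
    have h5 := mul_le_mul_of_nonneg_left h4 (norm_nonneg (x - s))
    linarith
  calc ‖inner ℂ x (w i)‖ = ‖inner ℂ (x - s) (w i) + inner ℂ s (w i)‖ := by
        rw [← inner_add_left, sub_add_cancel]
    _ < ε := by linarith [norm_add_le (inner ℂ (x - s) (w i)) (inner ℂ s (w i))]

/-- From `norm_sub_le` with w = i: y‖W(iy) - W(i)‖ ≤ (y - 1)‖W(i)‖. -/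
theorem IsGramKernel.norm_le {E : Type*} [NormedAddCommGroup E] [InnerProductSpace ℂ E]
    {W : ℂ → E} {m : ℂ → ℂ} (h : IsGramKernel W m) {y : ℝ} (hy : 1 ≤ y) :
    ‖W (y * Complex.I)‖ ≤ 2 * ‖W Complex.I‖ := by
  have h1 := h.norm_sub_le (z := y * Complex.I) (w := Complex.I) (by simp; linarith) (by simp)
  have h2 : (y : ℂ) * Complex.I - Complex.I = ((y - 1 : ℝ) : ℂ) * Complex.I := by push_cast; ring
  rw [h2, norm_mul, Complex.norm_I, Complex.norm_real, Real.norm_of_nonneg (by linarith)] at h1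
  simp [abs_of_pos (by linarith : 0 < y)] at h1
  have h3 := norm_sub_norm_le (W (y * Complex.I)) (W Complex.I)
  have h4 : ‖W (y * Complex.I) - W Complex.I‖ ≤ ‖W Complex.I‖ := by
    by_contra! h5
    nlinarith [norm_nonneg (W Complex.I)]
  linarith

theorem tendsto_zero_of_I_mul {a : ℝ → ℂ} {C : ℝ}
    (h : ∀ᶠ y : ℝ in atTop, ‖(y * Complex.I) * a y‖ ≤ C) : Tendsto a atTop (𝓝 0) := by
  refine squeeze_zero_norm' (a := fun y : ℝ => C / y) ?_ (tendsto_const_nhds.div_atTop tendsto_id)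
  filter_upwards [h, eventually_gt_atTop 0] with y hy h0
  rw [norm_mul, norm_mul, Complex.norm_I, mul_one, Complex.norm_real,
    Real.norm_of_nonneg h0.le] at hy
  rw [le_div_iff₀ h0]
  linarith

theorem star_dotProduct_mulVec_star (M : Matrix (Fin 2) (Fin 2) ℂ) (v : Fin 2 → ℂ) :
    star (star v ⬝ᵥ (M *ᵥ v)) = star v ⬝ᵥ (Mᴴ *ᵥ v) := by
  simp [Matrix.mulVec, dotProduct, Fin.sum_univ_two]
  ring

/-- W(z) is the Weyl solution in L². For the weak limit it suffices, by boundedness of W(iy), to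
test against compactly supported smooth pairs d; there z⟨d, W(z)⟩ = ⟨Hd, W(z)⟩ stays bounded, H
being the differential expression, so ⟨d, W(iy)⟩ = O(1/y). -/
theorem exists_isGramKernel {q : ℝ → ℂ} {α : OnePoint ℂ} {M : ℂ → Matrix (Fin 2) (Fin 2) ℂ}
    (hq : MemLp q ⊤ (volume.restrict (Ioi (0 : ℝ))))
    (hM : ∀ z : ℂ, z.im ≠ 0 → IsWeylMatrix q α z (M z)) (v : Fin 2 → ℂ) :
    ∃ W : ℂ → HalfLineL2, IsGramKernel W (fun z => star v ⬝ᵥ (M z *ᵥ v)) ∧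
      Tendsto (fun y : ℝ => inner ℂ (W Complex.I) (W (y * Complex.I))) atTop (𝓝 0) := by
  classical
  choose! f g f₁ g₁ hw using fun (z : ℂ) (hz : z.im ≠ 0) => hM z hz v
  let W (z : ℂ) : HalfLineL2 :=
    if hz : z.im ≠ 0 then pairL2 (hw z hz).memLp_fst (hw z hz).memLp_snd else 0
  have hW (z : ℂ) (hz : z.im ≠ 0) : W z = pairL2 (hw z hz).memLp_fst (hw z hz).memLp_snd := by
    simp only [W, dif_pos hz]
  have hG : IsGramKernel W (fun z => star v ⬝ᵥ (M z *ᵥ v)) := fun z w hz hw' => by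
    rw [hW z hz, hW w hw', inner_pairL2, (hw w hw').kernel hq (hw z hz), Matrix.sub_mulVec,
      dotProduct_sub, star_dotProduct_mulVec_star]
  refine ⟨W, hG, ?_⟩
  have hbd : ∀ᶠ y : ℝ in atTop, ‖W (y * Complex.I)‖ ≤ 2 * ‖W Complex.I‖ := by
    filter_upwards [eventually_ge_atTop 1] with y hy using hG.norm_le hy
  have him (y : ℝ) (hy : 1 ≤ y) : ((y : ℂ) * Complex.I).im ≠ 0 := by simp; linarith
  have hz0 : MemLp (fun _ => (0 : ℂ)) 2 (volume.restrict (Ioi (0 : ℝ))) := MemLp.zero'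
  refine tendsto_inner_of_forall_mem hbd
    ({d | ∃ (φ : ℝ → ℝ) (h : IsHalfLineTest φ), d = pairL2 h.memLp hz0} ∪
      {d | ∃ (φ : ℝ → ℝ) (h : IsHalfLineTest φ), d = pairL2 hz0 h.memLp}) ?_ ?_ _
  · intro x hx
    have mx1 := Lp.memLp (WithLp.ofLp x).1
    have mx2 := Lp.memLp (WithLp.ofLp x).2
    have hxe : x = pairL2 mx1 mx2 := by simp only [pairL2, Lp.toLp_coeFn]
    have e1 := ae_eq_zero_of_forall_test mx1 fun φ hφ => by
      have := hx _ (Or.inl ⟨φ, hφ, rfl⟩)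
      rw [hxe, inner_pairL2] at this
      simpa using this
    have e2 := ae_eq_zero_of_forall_test mx2 fun φ hφ => by
      have := hx _ (Or.inr ⟨φ, hφ, rfl⟩)
      rw [hxe, inner_pairL2] at this
      simpa using this
    have e3 := (Lp.eq_zero_iff_ae_eq_zero).2 e1
    have e4 := (Lp.eq_zero_iff_ae_eq_zero).2 e2
    have : WithLp.ofLp x = 0 := Prod.ext e3 e4
    simpa using this
  · have hη (p : ℝ → ℂ) (hp : MemLp p ⊤ (volume.restrict (Ioi (0 : ℝ)))) (φ : ℝ → ℝ)
        (h : IsHalfLineTest φ) : MemLp (fun x => star (p x) * (φ x : ℂ) -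
          star (deriv (deriv fun x => (φ x : ℂ)) x)) 2 (volume.restrict (Ioi (0 : ℝ))) :=
      (h.memLp.mul hp.star).sub h.memLp_deriv_deriv.star
    rintro _ (⟨φ, h, rfl⟩ | ⟨φ, h, rfl⟩)
    · refine tendsto_zero_of_I_mul (C := ‖pairL2 hz0 (hη q hq φ h)‖ * (2 * ‖W Complex.I‖)) ?_
      filter_upwards [hbd, eventually_ge_atTop 1] with y hy h1
      have h2 := him y h1
      have h3 : (y * Complex.I) * inner ℂ (pairL2 h.memLp hz0) (W (y * Complex.I)) =
          inner ℂ (pairL2 hz0 (hη q hq φ h)) (W (y * Complex.I)) := by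
        rw [hW _ h2, inner_pairL2, inner_pairL2]
        have := h.mul_integral hq (hw _ h2).sol.snd (hw _ h2).memLp_snd (hw _ h2).memLp_fst
        simpa using this
      rw [h3]
      exact (norm_inner_le_norm _ _).trans (by gcongr)
    · refine tendsto_zero_of_I_mul
        (C := ‖pairL2 (hη (fun x => star (q x)) hq.star φ h) hz0‖ * (2 * ‖W Complex.I‖)) ?_
      filter_upwards [hbd, eventually_ge_atTop 1] with y hy h1
      have h2 := him y h1
      have h3 : (y * Complex.I) * inner ℂ (pairL2 hz0 h.memLp) (W (y * Complex.I)) =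
          inner ℂ (pairL2 (hη (fun x => star (q x)) hq.star φ h) hz0) (W (y * Complex.I)) := by
        rw [hW _ h2, inner_pairL2, inner_pairL2]
        have := h.mul_integral hq.star (hw _ h2).sol.fst (hw _ h2).memLp_fst (hw _ h2).memLp_snd
        simpa using this
      rw [h3]
      exact (norm_inner_le_norm _ _).trans (by gcongr)

/-- The Nevanlinna representation of the quadratic forms of the `M`-function. -/
theorem exists_measure_dotProduct {q : ℝ → ℂ} {α : OnePoint ℂ}
    {M : ℂ → Matrix (Fin 2) (Fin 2) ℂ} (hq : MemLp q ⊤ (volume.restrict (Ioi (0 : ℝ))))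
    (hM : ∀ z : ℂ, z.im ≠ 0 → IsWeylMatrix q α z (M z)) (v : Fin 2 → ℂ) :
    ∃ μ : Measure ℝ, Integrable (fun t : ℝ => 1 / (1 + t ^ 2)) μ ∧
      ∀ z : ℂ, z.im ≠ 0 → Integrable (nevKernel z) μ ∧
        star v ⬝ᵥ ((M z - matRe (M Complex.I)) *ᵥ v) = ∫ t, nevKernel z t ∂μ := by
  obtain ⟨W, hW, h0⟩ := exists_isGramKernel hq hM v
  obtain ⟨ω, hω, h⟩ := hW.exists_measure h0
  refine ⟨nevMeasure ω, integrable_nevMeasure ω, fun z hz =>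
    ⟨integrable_nevKernel_nevMeasure ω hz, ?_⟩⟩
  rw [← h z hz, Matrix.sub_mulVec, dotProduct_sub]
  congr 1
  have h1 := star_dotProduct_mulVec_star (M Complex.I) v
  rw [matRe, Matrix.smul_mulVec, dotProduct_smul, Matrix.add_mulVec, dotProduct_add, ← h1,
    Complex.star_def, Complex.add_conj, smul_eq_mul]
  push_cast
  ring

/-! ### Matrix measures from their quadratic forms -/

/-- Vectors whose quadratic forms determine a `2 × 2` matrix. -/
noncomputable def polarVec : Fin 4 → Fin 2 → ℂ :=
  ![![1, 0], ![0, 1], ![1, 1], ![1, Complex.I]]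

/-- The matrices dual to `polarVec`. -/
noncomputable def polarMat : Fin 4 → Matrix (Fin 2) (Fin 2) ℂ :=
  ![!![1, -(1 - Complex.I) / 2; -(1 + Complex.I) / 2, 0],
    !![0, -(1 - Complex.I) / 2; -(1 + Complex.I) / 2, 1],
    !![0, 1 / 2; 1 / 2, 0], !![0, -Complex.I / 2; Complex.I / 2, 0]]

theorem sum_polar (X : Matrix (Fin 2) (Fin 2) ℂ) :
    ∑ k, (star (polarVec k) ⬝ᵥ (X *ᵥ polarVec k)) • polarMat k = X := by
  ext i j
  fin_cases i <;> fin_cases j <;>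
    simp [Fin.sum_univ_four, polarVec, polarMat, Matrix.mulVec, dotProduct, Fin.sum_univ_two] <;>
    ring_nf <;> simp [Complex.I_sq] <;> ring

theorem isHermitian_polarMat (k : Fin 4) : (polarMat k).IsHermitian := by
  ext i j
  fin_cases k <;> fin_cases i <;> fin_cases j <;> simp [polarMat] <;> ring

theorem coe_re_dotProduct {X : Matrix (Fin 2) (Fin 2) ℂ} (h : X.IsHermitian) (v : Fin 2 → ℂ) :
    (((star v ⬝ᵥ (X *ᵥ v)).re : ℝ) : ℂ) = star v ⬝ᵥ (X *ᵥ v) := by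
  refine Complex.conj_eq_iff_re.1 ?_
  have := star_dotProduct_mulVec_star X v
  rwa [h.eq] at this

/-- The coefficients expressing a quadratic form through its values at `polarVec`. -/
noncomputable def polarCoeff (v : Fin 2 → ℂ) (k : Fin 4) : ℝ := (star v ⬝ᵥ (polarMat k *ᵥ v)).re

/-- Every quadratic form value is a combination of four fixed ones, with real coefficients
independent of X. Reality matters: the same relation is later imposed on positive measures. -/
theorem sum_polarCoeff (X : Matrix (Fin 2) (Fin 2) ℂ) (v : Fin 2 → ℂ) :
    ∑ k, (polarCoeff v k : ℂ) * (star (polarVec k) ⬝ᵥ (X *ᵥ polarVec k)) =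
      star v ⬝ᵥ (X *ᵥ v) := by
  conv_rhs => rw [← sum_polar X, Matrix.sum_mulVec, dotProduct_sum]
  refine Finset.sum_congr rfl fun k _ => ?_
  rw [polarCoeff, coe_re_dotProduct (isHermitian_polarMat k), Matrix.smul_mulVec, dotProduct_smul,
    smul_eq_mul, mul_comm]

theorem measure_lt_top_of_integrable {μ : Measure ℝ}
    (h : Integrable (fun t : ℝ => 1 / (1 + t ^ 2)) μ) {B : Set ℝ} (hb : Bornology.IsBounded B) :
    μ B < ⊤ := by
  obtain ⟨C, hC⟩ := hb.exists_norm_le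
  have hsub : B ⊆ {t : ℝ | 1 / (1 + C ^ 2) ≤ ‖1 / (1 + t ^ 2)‖} := by
    intro t ht
    have h1 := hC t ht
    have h2 : t ^ 2 ≤ C ^ 2 := by
      rw [← sq_abs t]; exact pow_le_pow_left₀ (abs_nonneg t) h1 2
    rw [mem_ofPred_eq, Real.norm_of_nonneg (by positivity)]
    gcongr
  exact (measure_mono hsub).trans_lt (h.measure_norm_ge_lt_top (by positivity))

/-- Splitting the coefficients into positive and negative parts gives two positive measures with the
same Nevanlinna transform, which coincide by `nevanlinna_ext`. In the code `ENNReal.ofReal` does the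
truncation. -/
theorem sum_mul_real_eq_zero {ι : Type*} [Fintype ι] (c : ι → ℝ) (μ : ι → Measure ℝ)
    (h : ∀ i, Integrable (fun t : ℝ => 1 / (1 + t ^ 2)) (μ i))
    (hk : ∀ i, ∀ z : ℂ, z.im ≠ 0 → Integrable (nevKernel z) (μ i))
    (h0 : ∀ z : ℂ, z.im ≠ 0 → ∑ i, (c i : ℂ) * ∫ t, nevKernel z t ∂(μ i) = 0) {B : Set ℝ}
    (hb : Bornology.IsBounded B) : ∑ i, c i * (μ i).real B = 0 := by
  let S (a : ι → ℝ) : Measure ℝ := ∑ i, ENNReal.ofReal (a i) • μ i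
  have hS (a : ι → ℝ) : Integrable (fun t : ℝ => 1 / (1 + t ^ 2)) (S a) :=
    integrable_finsetSum_measure.2 fun i _ => (h i).smul_measure ENNReal.ofReal_ne_top
  have hSi (a : ι → ℝ) (z : ℂ) (hz : z.im ≠ 0) : ∫ t, nevKernel z t ∂(S a) =
      ∑ i, ((max (a i) 0 : ℝ) : ℂ) * ∫ t, nevKernel z t ∂(μ i) := by
    rw [integral_finsetSum_measure fun i _ => (hk i z hz).smul_measure ENNReal.ofReal_ne_top]
    refine Finset.sum_congr rfl fun i _ => ?_
    rw [integral_smul_measure, ENNReal.toReal_ofReal', Complex.real_smul]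
  have hsplit (i : ι) : c i = max (c i) 0 - max (-c i) 0 := (max_zero_sub_max_neg_zero_eq_self _).symm
  have heq : S c = S fun i => -c i := by
    refine nevanlinna_ext (hS _) (hS _) fun z hz => ?_
    rw [hSi _ z hz, hSi _ z hz, ← sub_eq_zero, ← h0 z hz, ← Finset.sum_sub_distrib]
    refine Finset.sum_congr rfl fun i _ => ?_
    rw [← sub_mul, ← Complex.ofReal_sub, ← hsplit]
  have hreal (a : ι → ℝ) : (S a).real B = ∑ i, max (a i) 0 * (μ i).real B := by
    simp only [measureReal_def, S, Measure.coe_finsetSum, Finset.sum_apply]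
    rw [ENNReal.toReal_sum fun i _ => ?_]
    · refine Finset.sum_congr rfl fun i _ => ?_
      rw [Measure.smul_apply, smul_eq_mul, ENNReal.toReal_mul, ENNReal.toReal_ofReal']
    · exact (ENNReal.mul_lt_top ENNReal.ofReal_lt_top (measure_lt_top_of_integrable (h i) hb)).ne
  have h1 := congrArg (fun m : Measure ℝ => m.real B) heq
  simp only [hreal] at h1
  rw [← sub_eq_zero, ← Finset.sum_sub_distrib] at h1
  rw [← h1]
  refine Finset.sum_congr rfl fun i _ => ?_
  rw [← sub_mul, ← hsplit]

theorem measure_ext_of_isBounded {μ ν : Measure ℝ}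
    (h : ∀ B : Set ℝ, MeasurableSet B → Bornology.IsBounded B → μ B = ν B) : μ = ν := by
  refine Measure.ext fun B hB => ?_
  have hU : B = ⋃ n : ℕ, B ∩ Metric.closedBall 0 n := by
    rw [← inter_iUnion, Metric.iUnion_closedBall_nat, inter_univ]
  have hm : Monotone fun n : ℕ => B ∩ Metric.closedBall (0 : ℝ) n := fun m n hmn =>
    inter_subset_inter_right _ (Metric.closedBall_subset_closedBall (by exact_mod_cast hmn))
  rw [hU, hm.measure_iUnion, hm.measure_iUnion]
  exact iSup_congr fun n => h _ (hB.inter Metric.isClosed_closedBall.measurableSet)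
    (Metric.isBounded_closedBall.subset inter_subset_right)

namespace MatrixMeasure

variable (Sg : MatrixMeasure) (v : Fin 2 → ℂ) {B : Set ℝ}

theorem coe_quadVal (B : Set ℝ) : (Sg.quadVal v B : ℂ) = star v ⬝ᵥ (Sg.toFun B *ᵥ v) :=
  coe_re_dotProduct (Sg.posSemidef B).isHermitian v

theorem quad_real (hB : MeasurableSet B) (hb : Bornology.IsBounded B) :
    (Sg.quad v).real B = Sg.quadVal v B := by
  rw [measureReal_def, Sg.quad_apply v B hB hb, ENNReal.toReal_ofReal (Sg.quadVal_nonneg v B)]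

theorem quad_lt_top (hb : Bornology.IsBounded B) : Sg.quad v B < ⊤ := by
  obtain ⟨r, hr⟩ := hb.subset_closedBall 0
  refine (measure_mono hr).trans_lt ?_
  rw [Sg.quad_apply v _ Metric.isClosed_closedBall.measurableSet Metric.isBounded_closedBall]
  exact ENNReal.ofReal_lt_top

theorem toFun_eq_sum (B : Set ℝ) :
    Sg.toFun B = ∑ k, (Sg.quadVal (polarVec k) B : ℂ) • polarMat k := by
  conv_lhs => rw [← sum_polar (Sg.toFun B)]
  exact Finset.sum_congr rfl fun k _ => by rw [coe_quadVal]

theorem ext_of_quad {Sg Sg' : MatrixMeasure} (h : ∀ v, Sg.quad v = Sg'.quad v) : Sg = Sg' := by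
  refine MatrixMeasure.ext (funext fun B => ?_)
  by_cases hB : MeasurableSet B ∧ Bornology.IsBounded B
  · rw [toFun_eq_sum, toFun_eq_sum]
    refine Finset.sum_congr rfl fun k _ => ?_
    rw [← quad_real _ _ hB.1 hB.2, h, quad_real _ _ hB.1 hB.2]
  · rw [Sg.eq_zero B hB, Sg'.eq_zero B hB]

/-- A family of measures with the polarisation identity is given by a matrix measure. -/
theorem exists_quad_eq (μ : (Fin 2 → ℂ) → Measure ℝ)
    (hfin : ∀ v, ∀ B : Set ℝ, Bornology.IsBounded B → μ v B < ⊤)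
    (h : ∀ v, ∀ B : Set ℝ, MeasurableSet B → Bornology.IsBounded B →
      ∑ k, polarCoeff v k * (μ (polarVec k)).real B = (μ v).real B) :
    ∃ Sg : MatrixMeasure, ∀ v, Sg.quad v = μ v := by
  classical
  let S (B : Set ℝ) : Matrix (Fin 2) (Fin 2) ℂ :=
    if MeasurableSet B ∧ Bornology.IsBounded B then
      ∑ k, ((μ (polarVec k)).real B : ℂ) • polarMat k else 0
  have hS (v : Fin 2 → ℂ) (B : Set ℝ) (hB : MeasurableSet B) (hb : Bornology.IsBounded B) :
      star v ⬝ᵥ (S B *ᵥ v) = ((μ v).real B : ℂ) := by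
    simp only [S, if_pos (And.intro hB hb)]
    rw [← h v B hB hb, Matrix.sum_mulVec, dotProduct_sum]
    push_cast
    refine Finset.sum_congr rfl fun k _ => ?_
    rw [polarCoeff, coe_re_dotProduct (isHermitian_polarMat k), Matrix.smul_mulVec,
      dotProduct_smul, smul_eq_mul, mul_comm]
  let Sg : MatrixMeasure :=
    { toFun := S
      eq_zero := fun B hB => if_neg hB
      posSemidef := fun B => by
        by_cases hB : MeasurableSet B ∧ Bornology.IsBounded B
        · refine Matrix.PosSemidef.of_dotProduct_mulVec_nonneg ?_ fun v => ?_
          · simp only [S, if_pos hB, Matrix.IsHermitian, Matrix.conjTranspose_sum,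
              Matrix.conjTranspose_smul, (isHermitian_polarMat _).eq, Complex.star_def,
              Complex.conj_ofReal]
          · rw [hS v B hB.1 hB.2]
            exact_mod_cast measureReal_nonneg
        · simp only [S, if_neg hB]
          exact Matrix.PosSemidef.zero
      hasSum_iUnion := fun f hf hd hb => by
        have hbi (i : ℕ) : Bornology.IsBounded (f i) := hb.subset (subset_iUnion f i)
        simp only [S, if_pos (And.intro (MeasurableSet.iUnion hf) hb),
          if_pos (And.intro (hf _) (hbi _))]
        refine hasSum_sum fun k _ => HasSum.smul_const ?_ _
        refine Complex.hasSum_ofReal.2 ?_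
        have h1 := measure_iUnion (μ := μ (polarVec k)) hd hf
        simp only [measureReal_def]
        have h2 := (hfin (polarVec k) _ hb).ne
        rw [h1] at h2 ⊢
        rw [ENNReal.tsum_toReal_eq fun i => (hfin _ _ (hbi i)).ne]
        exact ENNReal.hasSum_toReal h2 }
  refine ⟨Sg, fun v => measure_ext_of_isBounded fun B hB hb => ?_⟩
  rw [Sg.quad_apply v B hB hb, quadVal]
  change ENNReal.ofReal (star v ⬝ᵥ (S B *ᵥ v)).re = _
  rw [hS v B hB hb, Complex.ofReal_re, ofReal_measureReal (hfin v B hb).ne]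

end MatrixMeasure

theorem exists_isSpectralMeasure {q : ℝ → ℂ}
    (hq : MemLp q ⊤ (volume.restrict (Ioi (0 : ℝ)))) (α : OnePoint ℂ) :
    ∃ Sg : MatrixMeasure, IsSpectralMeasure (hermPotential q) α Sg := by
  choose! M hM using fun (z : ℂ) (hz : z.im ≠ 0) => exists_isMValue hq α hz
  choose μ hμ hrep using fun v =>
    exists_measure_dotProduct hq (fun z hz => (hM z hz).isWeylMatrix hq) v
  obtain ⟨Sg, hSg⟩ := MatrixMeasure.exists_quad_eq μ
    (fun v B hb => measure_lt_top_of_integrable (hμ v) hb) fun v B hB hb => by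
      -- The index `none` stands for the measure of v itself, with coefficient -1.
      have h1 := sum_mul_real_eq_zero (ι := Option (Fin 4))
        (fun i => i.elim (-1) (polarCoeff v)) (fun i => i.elim (μ v) fun k => μ (polarVec k))
        (fun i => by cases i <;> exact hμ _) (fun i z hz => by cases i <;> exact (hrep _ z hz).1)
        (fun z hz => by
          rw [Fintype.sum_option]
          simp only [Option.elim_none, Option.elim_some, ← (hrep _ z hz).2]
          rw [sum_polarCoeff]
          push_cast
          ring) hb
      rw [Fintype.sum_option] at h1
      simp only [Option.elim_none, Option.elim_some] at h1
      linarith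
  refine ⟨Sg, M, hM, fun v => by rw [hSg]; exact hμ v, fun z hz v => ?_⟩
  rw [hSg]
  exact hrep v z hz

theorem IsSpectralMeasure.unique {q : ℝ → ℂ}
    (hq : MemLp q ⊤ (volume.restrict (Ioi (0 : ℝ)))) {α : OnePoint ℂ} {Sg Sg' : MatrixMeasure}
    (h : IsSpectralMeasure (hermPotential q) α Sg)
    (h' : IsSpectralMeasure (hermPotential q) α Sg') : Sg = Sg' := by
  obtain ⟨M, hM, hi, hr⟩ := h
  obtain ⟨M', hM', hi', hr'⟩ := h'
  have hMM (z : ℂ) (hz : z.im ≠ 0) : M z = M' z :=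
    ((hM z hz).isWeylMatrix hq).unique hq hz ((hM' z hz).isWeylMatrix hq)
  refine MatrixMeasure.ext_of_quad fun v => nevanlinna_ext (hi v) (hi' v) fun z hz => ?_
  refine ((hr z hz v).2.symm.trans ?_).trans (hr' z hz v).2
  rw [hMM z hz, hMM _ (by simp)]

/-! ### The spectral pair -/

/-! ### Densities tested on bounded Borel sets -/

section BoundedSets

variable {ν : Measure ℝ}

theorem ae_of_forall_closedBall {p : ℝ → Prop}
    (h : ∀ n : ℕ, ∀ᵐ t ∂(ν.restrict (Metric.closedBall 0 n)), p t) : ∀ᵐ t ∂ν, p t := by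
  rw [← Measure.restrict_univ (μ := ν), ← Metric.iUnion_closedBall_nat (0 : ℝ),
    ae_restrict_iUnion_iff]
  exact h

theorem ae_eq_of_forall_isBounded {f g : ℝ → ℂ}
    (hf : ∀ B : Set ℝ, MeasurableSet B → Bornology.IsBounded B → IntegrableOn f B ν)
    (hg : ∀ B : Set ℝ, MeasurableSet B → Bornology.IsBounded B → IntegrableOn g B ν)
    (h : ∀ B : Set ℝ, MeasurableSet B → Bornology.IsBounded B →
      ∫ t in B, f t ∂ν = ∫ t in B, g t ∂ν) : f =ᵐ[ν] g := by
  refine ae_of_forall_closedBall fun n => ?_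
  have hm : MeasurableSet (Metric.closedBall (0 : ℝ) n) := Metric.isClosed_closedBall.measurableSet
  refine Integrable.ae_eq_of_forall_setIntegral_eq _ _ (hf _ hm Metric.isBounded_closedBall)
    (hg _ hm Metric.isBounded_closedBall) fun s hs _ => ?_
  rw [Measure.restrict_restrict hs]
  exact h _ (hs.inter hm) (Metric.isBounded_closedBall.subset inter_subset_right)

theorem ae_le_of_forall_isBounded {f g : ℝ → ℝ}
    (hf : ∀ B : Set ℝ, MeasurableSet B → Bornology.IsBounded B → IntegrableOn f B ν)
    (hg : ∀ B : Set ℝ, MeasurableSet B → Bornology.IsBounded B → IntegrableOn g B ν)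
    (h : ∀ B : Set ℝ, MeasurableSet B → Bornology.IsBounded B →
      ∫ t in B, f t ∂ν ≤ ∫ t in B, g t ∂ν) : f ≤ᵐ[ν] g := by
  refine ae_of_forall_closedBall fun n => ?_
  have hm : MeasurableSet (Metric.closedBall (0 : ℝ) n) := Metric.isClosed_closedBall.measurableSet
  refine ae_le_of_forall_setIntegral_le (hf _ hm Metric.isBounded_closedBall)
    (hg _ hm Metric.isBounded_closedBall) fun s hs _ => ?_
  rw [Measure.restrict_restrict hs]
  exact h _ (hs.inter hm) (Metric.isBounded_closedBall.subset inter_subset_right)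

/-- For each fixed c, Re(cf) ≤ |c| almost everywhere. A countable dense set of c gives one null set
for all c, and then c = conj f(t) yields |f(t)|² ≤ |f(t)|. -/
theorem ae_norm_le_one_of_forall_isBounded {f : ℝ → ℂ}
    (hν : ∀ B : Set ℝ, Bornology.IsBounded B → ν B < ⊤)
    (hf : ∀ B : Set ℝ, MeasurableSet B → Bornology.IsBounded B → IntegrableOn f B ν)
    (h : ∀ B : Set ℝ, MeasurableSet B → Bornology.IsBounded B →
      ‖∫ t in B, f t ∂ν‖ ≤ ν.real B) : ∀ᵐ t ∂ν, ‖f t‖ ≤ 1 := by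
  have h1 (c : ℂ) : (fun t => (c * f t).re) ≤ᵐ[ν] fun _ => ‖c‖ := by
    refine ae_le_of_forall_isBounded (fun B hB hb => ((hf B hB hb).const_mul c).re)
      (fun B hB hb => integrableOn_const (hν B hb).ne) fun B hB hb => ?_
    calc ∫ t in B, (c * f t).re ∂ν = (∫ t in B, c * f t ∂ν).re :=
          integral_re ((hf B hB hb).const_mul c)
      _ = (c * ∫ t in B, f t ∂ν).re := by rw [integral_const_mul]
      _ ≤ ‖c * ∫ t in B, f t ∂ν‖ := Complex.re_le_norm _
      _ ≤ ‖c‖ * ν.real B := by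
          rw [norm_mul]; exact mul_le_mul_of_nonneg_left (h B hB hb) (norm_nonneg c)
      _ = ∫ t in B, ‖c‖ ∂ν := by rw [setIntegral_const, smul_eq_mul, mul_comm]
  have h2 : ∀ᵐ t ∂ν, ∀ n, (TopologicalSpace.denseSeq ℂ n * f t).re ≤
      ‖TopologicalSpace.denseSeq ℂ n‖ := ae_all_iff.2 fun n => h1 _
  filter_upwards [h2] with t ht
  have h3 : ∀ c : ℂ, (c * f t).re ≤ ‖c‖ := fun c =>
    (TopologicalSpace.denseRange_denseSeq ℂ).induction_on (p := fun c => (c * f t).re ≤ ‖c‖) c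
      (isClosed_le (by fun_prop) (by fun_prop)) ht
  have h4 := h3 ((starRingEnd ℂ) (f t))
  rw [mul_comm, Complex.mul_conj, Complex.ofReal_re, Complex.normSq_eq_norm_sq,
    Complex.norm_conj] at h4
  by_contra! h5
  nlinarith

end BoundedSets

namespace MatrixMeasure

variable (Sg : MatrixMeasure) (v : Fin 2 → ℂ) {B : Set ℝ}

instance : IsFiniteMeasureOnCompacts (Sg.quad v) := ⟨fun _ hK => Sg.quad_lt_top v hK.isBounded⟩

theorem toFun_one_zero (B : Set ℝ) : Sg.toFun B 1 0 = star (Sg.toFun B 0 1) :=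
  ((Sg.posSemidef B).isHermitian.apply 1 0).symm

theorem toFun_diag_zero (B : Set ℝ) : Sg.toFun B 0 0 = (Sg.quadVal (polarVec 0) B : ℂ) := by
  simp [coe_quadVal, polarVec, Matrix.mulVec, dotProduct, Fin.sum_univ_two]

theorem toFun_diag_one (B : Set ℝ) : Sg.toFun B 1 1 = (Sg.quadVal (polarVec 1) B : ℂ) := by
  simp [coe_quadVal, polarVec, Matrix.mulVec, dotProduct, Fin.sum_univ_two]

theorem norm_toFun_sq_le (B : Set ℝ) : ‖Sg.toFun B 0 1‖ ^ 2 ≤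
    Sg.quadVal (polarVec 0) B * Sg.quadVal (polarVec 1) B := by
  have h := (Sg.posSemidef B).det_nonneg
  rw [Matrix.det_fin_two, toFun_one_zero, toFun_diag_zero, toFun_diag_one, Complex.star_def,
    Complex.mul_conj, Complex.normSq_eq_norm_sq, ← Complex.ofReal_mul, ← Complex.ofReal_sub] at h
  have h1 : 0 ≤ Sg.quadVal (polarVec 0) B * Sg.quadVal (polarVec 1) B - ‖Sg.toFun B 0 1‖ ^ 2 := by
    exact_mod_cast h
  linarith

/-- Adding the nonnegative form at (v₀, -v₁) cancels the off-diagonal terms. Hence every `quad v` is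
dominated by the diagonal entries. -/
theorem quadVal_le (B : Set ℝ) : Sg.quadVal v B ≤
    2 * (‖v 0‖ ^ 2 * Sg.quadVal (polarVec 0) B + ‖v 1‖ ^ 2 * Sg.quadVal (polarVec 1) B) := by
  have h := Sg.quadVal_nonneg ![v 0, -v 1] B
  have h1 : ((Sg.quadVal ![v 0, -v 1] B + Sg.quadVal v B : ℝ) : ℂ) =
      ((2 * (‖v 0‖ ^ 2 * Sg.quadVal (polarVec 0) B +
        ‖v 1‖ ^ 2 * Sg.quadVal (polarVec 1) B) : ℝ) : ℂ) := by
    push_cast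
    rw [← toFun_diag_zero, ← toFun_diag_one, coe_quadVal, coe_quadVal, ← Complex.conj_mul',
      ← Complex.conj_mul']
    simp [Matrix.mulVec, dotProduct, Fin.sum_univ_two]
    ring
  have h2 : Sg.quadVal ![v 0, -v 1] B + Sg.quadVal v B = 2 * (‖v 0‖ ^ 2 *
    Sg.quadVal (polarVec 0) B + ‖v 1‖ ^ 2 * Sg.quadVal (polarVec 1) B) := by exact_mod_cast h1
  linarith

theorem quad_absolutelyContinuous (h : Sg.quad (polarVec 0) = Sg.quad (polarVec 1)) :
    Sg.quad v ≪ Sg.quad (polarVec 0) := by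
  have hbd {B : Set ℝ} (hB : MeasurableSet B) (hb : Bornology.IsBounded B)
      (h0 : Sg.quad (polarVec 0) B = 0) : Sg.quad v B = 0 := by
    have e0 := Sg.quad_real (polarVec 0) hB hb
    have e1 := Sg.quad_real (polarVec 1) hB hb
    rw [← h] at e1
    have hz : (Sg.quad (polarVec 0)).real B = 0 := by rw [measureReal_def, h0]; rfl
    rw [hz] at e0 e1
    rw [Sg.quad_apply v B hB hb]
    have := Sg.quadVal_le v B
    rw [← e0, ← e1] at this
    exact ENNReal.ofReal_eq_zero.2 (by simpa using this)
  refine Measure.AbsolutelyContinuous.mk fun B hB h0 => ?_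
  rw [← inter_univ B, ← Metric.iUnion_closedBall_nat (0 : ℝ), inter_iUnion]
  refine measure_iUnion_null fun n => hbd (hB.inter Metric.isClosed_closedBall.measurableSet)
    (Metric.isBounded_closedBall.subset inter_subset_right)
    (measure_mono_null inter_subset_left h0)

/-- The off-diagonal entry of a matrix measure has a density with respect to the diagonal. -/
theorem exists_density (h : Sg.quad (polarVec 0) = Sg.quad (polarVec 1)) :
    ∃ ψ : ℝ → ℂ, Measurable ψ ∧ ∀ B : Set ℝ, MeasurableSet B → Bornology.IsBounded B →
      IntegrableOn ψ B (Sg.quad (polarVec 0)) ∧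
        Sg.toFun B 0 1 = ∫ t in B, ψ t ∂(Sg.quad (polarVec 0)) := by
  set ν := Sg.quad (polarVec 0) with hν
  let d (k : Fin 4) (t : ℝ) : ℂ := (((Sg.quad (polarVec k)).rnDeriv ν t).toReal : ℂ)
  have hdi (k : Fin 4) (B : Set ℝ) (hb : Bornology.IsBounded B) :
      IntegrableOn (fun t => ((Sg.quad (polarVec k)).rnDeriv ν t).toReal) B ν :=
    Measure.integrableOn_toReal_rnDeriv (Sg.quad_lt_top _ hb).ne
  have hdB (k : Fin 4) (B : Set ℝ) (hB : MeasurableSet B) (hb : Bornology.IsBounded B) :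
      ∫ t in B, d k t ∂ν = (Sg.quadVal (polarVec k) B : ℂ) := by
    rw [integral_complex_ofReal, Measure.setIntegral_toReal_rnDeriv
      (Sg.quad_absolutelyContinuous _ h), Sg.quad_real _ hB hb]
  -- This is the off-diagonal entry of the polarisation formula, with the four values replaced by
  -- Radon–Nikodym densities.
  refine ⟨fun t => ∑ k, d k t * polarMat k 0 1, by fun_prop, fun B hB hb => ⟨?_, ?_⟩⟩
  · exact integrable_finsetSum _ fun k _ => ((hdi k B hb).ofReal).mul_const _
  · rw [integral_finsetSum _ fun k _ => ((hdi k B hb).ofReal).mul_const _, toFun_eq_sum,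
      Matrix.sum_apply]
    refine Finset.sum_congr rfl fun k _ => ?_
    rw [integral_mul_const, hdB k B hB hb]
    simp

end MatrixMeasure

/-! ### Symmetries of the spectral measure and construction of the pair -/

section Symmetry

variable {q : ℝ → ℂ} {α : OnePoint ℂ} {Sg : MatrixMeasure}

theorem nevKernel_neg (z : ℂ) (t : ℝ) : nevKernel z (-t) = -nevKernel (-z) t := by
  simp only [nevKernel]
  push_cast
  rw [show -(t : ℂ) - z = -((t : ℂ) - -z) by ring, neg_sq, one_div, one_div, inv_neg]
  ring

theorem IsSpectralMeasure.quad_diag_eq (hq : MemLp q ⊤ (volume.restrict (Ioi (0 : ℝ))))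
    (h : IsSpectralMeasure (hermPotential q) α Sg) :
    Sg.quad (polarVec 0) = Sg.quad (polarVec 1) := by
  obtain ⟨M, hM, hi, hr⟩ := h
  refine nevanlinna_ext (hi _) (hi _) fun z hz => ?_
  refine ((hr z hz _).2.symm.trans ?_).trans (hr z hz _).2
  have h1 := ((hM z hz).isWeylMatrix hq).diag_eq hq
  have h2 := ((hM Complex.I (by simp)).isWeylMatrix hq).diag_eq hq
  simp [polarVec, Matrix.mulVec, dotProduct, Fin.sum_univ_two, matRe, h1, h2]

theorem sigMat_mul_mul (X : Matrix (Fin 2) (Fin 2) ℂ) :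
    sigMat * X * sigMat = !![X 0 0, -X 0 1; -X 1 0, X 1 1] := by
  nth_rewrite 1 [Matrix.eta_fin_two X]
  simp [sigMat]

theorem sigMat_mulVec (v : Fin 2 → ℂ) : sigMat *ᵥ v = ![v 0, -v 1] := by
  ext i; fin_cases i <;> simp [sigMat, Matrix.mulVec, dotProduct, Fin.sum_univ_two]

/-- The Nevanlinna kernel is odd under (z, t) ↦ (-z, -t), matching M(-z) = -σM(z)σ. The constant
term matches as well: M(-i) = M(i)* gives σ Re M(i) σ = -Re M(i). -/
theorem IsSpectralMeasure.map_neg_quad (hq : MemLp q ⊤ (volume.restrict (Ioi (0 : ℝ))))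
    (h : IsSpectralMeasure (hermPotential q) α Sg) (v : Fin 2 → ℂ) :
    (Sg.quad (sigMat *ᵥ v)).map (fun t => -t) = Sg.quad v := by
  obtain ⟨M, hM, hi, hr⟩ := h
  have hW (z : ℂ) (hz : z.im ≠ 0) := (hM z hz).isWeylMatrix hq
  have hneg (z : ℂ) (hz : z.im ≠ 0) : M (-z) = -(sigMat * M z * sigMat) :=
    (hW (-z) (by simpa using hz)).unique hq (by simpa using hz) (hW z hz).reflect
  have hadj : M (-Complex.I) = (M Complex.I)ᴴ := by
    refine (hW (-Complex.I) (by simp)).conjTranspose_eq hq ?_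
    simpa using hW Complex.I (by simp)
  have hm : Measurable fun t : ℝ => -t := measurable_neg
  refine nevanlinna_ext ?_ (hi v) fun z hz => ?_
  · rw [integrable_map_measure (Measurable.aestronglyMeasurable (by fun_prop)) hm.aemeasurable]
    simpa [Function.comp_def] using hi (sigMat *ᵥ v)
  · have hk : Measurable (nevKernel z) := by unfold nevKernel; fun_prop
    rw [integral_map hm.aemeasurable hk.aestronglyMeasurable]
    simp only [nevKernel_neg]
    have e1 := (hr (-z) (by simpa using hz) (sigMat *ᵥ v)).2
    have e2 := (hr z hz v).2
    rw [integral_neg]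
    refine (congrArg (fun x => -x) e1.symm).trans (Eq.trans ?_ e2)
    have e3 := hneg Complex.I (by simp)
    rw [hneg z hz]
    rw [hadj] at e3
    rw [matRe, e3, sigMat_mul_mul, sigMat_mul_mul, sigMat_mulVec]
    simp [Matrix.mulVec, dotProduct, Fin.sum_univ_two]
    ring

theorem sigMat_mulVec_polarVec_zero : sigMat *ᵥ polarVec 0 = polarVec 0 := by
  rw [sigMat_mulVec]
  simp [polarVec]

/-- By polarisation the reflection law of the quadratic forms says that Σ(-B) = σΣ(B)σ, which
negates the off-diagonal entries. -/
theorem IsSpectralMeasure.toFun_neg (hq : MemLp q ⊤ (volume.restrict (Ioi (0 : ℝ))))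
    (h : IsSpectralMeasure (hermPotential q) α Sg) {B : Set ℝ} (hB : MeasurableSet B)
    (hb : Bornology.IsBounded B) :
    Sg.toFun ((fun t => -t) ⁻¹' B) 0 1 = -Sg.toFun B 0 1 := by
  have hB' : MeasurableSet ((fun t : ℝ => -t) ⁻¹' B) := measurable_neg hB
  have hb' : Bornology.IsBounded ((fun t : ℝ => -t) ⁻¹' B) := by
    have : (fun t : ℝ => -t) ⁻¹' B = -B := rfl
    rw [this]; exact hb.neg
  have hv (v : Fin 2 → ℂ) : star v ⬝ᵥ (Sg.toFun ((fun t => -t) ⁻¹' B) *ᵥ v) =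
      star v ⬝ᵥ ((sigMat * Sg.toFun B * sigMat) *ᵥ v) := by
    have e1 := h.map_neg_quad hq (sigMat *ᵥ v)
    have e2 : sigMat *ᵥ (sigMat *ᵥ v) = v := by
      rw [sigMat_mulVec, sigMat_mulVec]
      ext i; fin_cases i <;> simp
    rw [e2] at e1
    have e3 := congrArg (fun m : Measure ℝ => m.real B) e1
    beta_reduce at e3
    rw [map_measureReal_apply measurable_neg hB, Sg.quad_real _ hB' hb', Sg.quad_real _ hB hb] at e3
    rw [← Sg.coe_quadVal, e3, Sg.coe_quadVal]
    rw [sigMat_mul_mul, sigMat_mulVec]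
    simp [Matrix.mulVec, dotProduct, Fin.sum_univ_two]
    ring
  have key : Sg.toFun ((fun t => -t) ⁻¹' B) = sigMat * Sg.toFun B * sigMat := by
    rw [← sum_polar (Sg.toFun _), ← sum_polar (sigMat * _ * _)]
    exact Finset.sum_congr rfl fun k _ => by rw [hv]
  rw [key, sigMat_mul_mul]
  simp

theorem MatrixMeasure.HasDensity.eq_quad {ν : Measure ℝ} {ψ : ℝ → ℂ}
    (h : Sg.HasDensity ν fun t => !![1, ψ t; star (ψ t), 1]) : ν = Sg.quad (polarVec 0) := by
  refine measure_ext_of_isBounded fun B hB hb => ?_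
  have h1 := h B hB hb 0 0
  simp only [Matrix.of_apply, Matrix.cons_val', Matrix.cons_val_zero, Matrix.cons_val_fin_one] at h1
  -- Integrability of the diagonal density 1 forces ν(B) to be finite, so its real value loses
  -- nothing.
  have hfin : ν B ≠ ⊤ := by
    have := h1.1
    rw [integrableOn_const_iff (by simp)] at this
    exact (this.resolve_left (by simp)).ne
  have h2 := h1.2
  rw [setIntegral_const, Sg.toFun_diag_zero, Complex.real_smul, mul_one, Complex.ofReal_inj,
    ← Sg.quad_real _ hB hb] at h2
  rw [← ofReal_measureReal hfin, ← h2, ofReal_measureReal (Sg.quad_lt_top _ hb).ne]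

theorem IsSpectralMeasure.exists_isSpectralPair (hq : MemLp q ⊤ (volume.restrict (Ioi (0 : ℝ))))
    (h : IsSpectralMeasure (hermPotential q) α Sg) :
    ∃ ψ : ℝ → ℂ, IsSpectralPair Sg (Sg.quad (polarVec 0)) ψ := by
  have hd := h.quad_diag_eq hq
  obtain ⟨ψ, hm, hψ⟩ := Sg.exists_density hd
  set ν := Sg.quad (polarVec 0) with hν
  have hfin (B : Set ℝ) (hb : Bornology.IsBounded B) : ν B < ⊤ := Sg.quad_lt_top _ hb
  have heven : ν.map (fun t => -t) = ν := by
    have := h.map_neg_quad hq (polarVec 0)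
    rwa [sigMat_mulVec_polarVec_zero] at this
  have hle : ∀ᵐ t ∂ν, ‖ψ t‖ ≤ 1 := by
    refine ae_norm_le_one_of_forall_isBounded hfin (fun B hB hb => (hψ B hB hb).1)
      fun B hB hb => ?_
    rw [← (hψ B hB hb).2]
    have h1 := Sg.norm_toFun_sq_le B
    rw [← Sg.quad_real _ hB hb, ← Sg.quad_real _ hB hb, ← hd, ← sq] at h1
    -- Since both diagonal entries equal ν, det Σ(B) ≥ 0 reads |Σ₀₁(B)|² ≤ ν(B)².
    exact (pow_le_pow_iff_left₀ (norm_nonneg _) measureReal_nonneg two_ne_zero).1 h1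
  -- Evenness of ν moves the reflection from ψ to the set, where `toFun_neg` supplies the sign.
  have hint (B : Set ℝ) (hB : MeasurableSet B) (hb : Bornology.IsBounded B) :
      IntegrableOn (fun t => ψ (-t)) B ν ∧ ∫ t in B, ψ (-t) ∂ν = ∫ t in B, -ψ t ∂ν := by
    have hB' : MeasurableSet ((fun t : ℝ => -t) ⁻¹' B) := measurable_neg hB
    have hb' : Bornology.IsBounded ((fun t : ℝ => -t) ⁻¹' B) := hb.neg
    have hp : (fun t : ℝ => -t) ⁻¹' ((fun t : ℝ => -t) ⁻¹' B) = B := by ext t; simp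
    have hme : MeasurableEmbedding fun t : ℝ => -t := (MeasurableEquiv.neg ℝ).measurableEmbedding
    constructor
    · have h1 := (hψ _ hB' hb').1
      rw [← heven, hme.integrableOn_map_iff, hp] at h1
      exact h1
    · have h1 := hme.setIntegral_map (μ := ν) ψ ((fun t : ℝ => -t) ⁻¹' B)
      rw [heven, hp, ← (hψ _ hB' hb').2, h.toFun_neg hq hB hb, (hψ B hB hb).2] at h1
      rw [← h1, integral_neg]
  have hodd : ∀ᵐ t ∂ν, ψ (-t) = -ψ t :=
    ae_eq_of_forall_isBounded (fun B hB hb => (hint B hB hb).1)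
      (fun B hB hb => (hψ B hB hb).1.neg) fun B hB hb => (hint B hB hb).2
  refine ⟨ψ, heven, memLp_top_of_bound hm.aestronglyMeasurable 1 hle, hodd, hle, ?_⟩
  intro B hB hb i j
  have hone : IntegrableOn (fun _ => (1 : ℂ)) B ν := integrableOn_const (hfin B hb).ne
  have hreal : ∫ t in B, (1 : ℂ) ∂ν = (ν.real B : ℂ) := by
    rw [setIntegral_const, Complex.real_smul, mul_one]
  fin_cases i <;> fin_cases j
  · exact ⟨hone, by
      simpa [hreal, ← Sg.quad_real _ hB hb] using Sg.toFun_diag_zero B⟩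
  · exact hψ B hB hb
  · refine ⟨Complex.conjCLE.integrable_comp_iff.2 (hψ B hB hb).1, ?_⟩
    exact (Sg.toFun_one_zero B).trans ((congrArg star (hψ B hB hb).2).trans integral_conj.symm)
  · exact ⟨hone, by
      simpa [hreal, ← Sg.quad_real _ hB hb, ← hd] using Sg.toFun_diag_one B⟩

end Symmetry

theorem theorem1p2 (q : ℝ → ℂ) (hq : MemLp q (⊤ : ℝ≥0∞) (volume.restrict (Ioi (0 : ℝ))))
    (α : OnePoint ℂ) :
    (∃! Sg : MatrixMeasure, IsSpectralMeasure (hermPotential q) α Sg) ∧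
    ∀ Sg : MatrixMeasure, IsSpectralMeasure (hermPotential q) α Sg →
      ∃ (ν : Measure ℝ) (ψ : ℝ → ℂ), IsSpectralPair Sg ν ψ ∧
        ∀ (ν' : Measure ℝ) (ψ' : ℝ → ℂ), IsSpectralPair Sg ν' ψ' →
          ν' = ν ∧ ψ' =ᵐ[ν] ψ := by
  obtain ⟨Sg, hSg⟩ := exists_isSpectralMeasure hq α
  refine ⟨⟨Sg, hSg, fun S hS => hS.unique hq hSg⟩, fun S hS => ?_⟩
  obtain ⟨ψ, hψ⟩ := hS.exists_isSpectralPair hq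
  refine ⟨S.quad (polarVec 0), ψ, hψ, fun ν' ψ' h' => ?_⟩
  obtain rfl := h'.density.eq_quad
  refine ⟨rfl, ae_eq_of_forall_isBounded (fun B hB hb => (h'.density B hB hb 0 1).1)
    (fun B hB hb => (hψ.density B hB hb 0 1).1) fun B hB hb => ?_⟩
  exact (h'.density B hB hb 0 1).2.symm.trans (hψ.density B hB hb 0 1).2
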